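/- Let $\mathbf T^2=(\mathbb R/2\pi\mathbb Z)^2$ and let $\mathcal N$ be a lattice polygon with nonempty interior. Let $\mathcal H$ be an oriented line arrangement in $\mathbf T^2$, that is, a finite family of images in $\mathbf T^2$ of lines in $\mathbb R^2$, each oriented by a primitive integer direction vector. Assume that $\mathcal H$ is dual to $\mathcal N$: the classes of parallel, equally oriented lines of $\mathcal H$ correspond bijectively to the facets $\Gamma$ of $\mathcal N$, the sum of the direction vectors of the lines in the class of $\Gamma$ being the outward normal vector of $\Gamma$ whose integer length is that of $\Gamma$. Assume also that $\mathcal H$ is simple: no three distinct lines of the family have a common point. Let $\iota$ be an index map of $\mathcal H$, that is, a map from the set of cells (the connected components of $\mathbf T^2\setminus\mathcal H$) to $\mathbb Z$ such that, when a line with tangent vector $\gamma$ is crossed in the direction $\ell$, the index increases or decreases by one according to whether $(\ell,\gamma)$ is a positively or a negatively oriented basis. The index graph $G^-$ is the mixed bicolored multigraph with a white vertex $v(P)$ for each cell with $\iota(P)\equiv1 \pmod 4$, a black vertex $v(P)$ for each cell with $\iota(P)\equiv-1\pmod 4$, and, for each intersection point $p$ of two lines, one edge joining the two cells $P_1,P_2$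 of odd index that lie in opposite sectors at $p$. This edge is undirected if $\iota(P_1)\not\equiv\iota(P_2)\pmod 4$; otherwise it is directed from the cell whose edges at $p$ are oriented towards $p$ to the cell whose edges at $p$ are oriented away from $p$. The first Yang–Baxter modification at a triangular cell $P$ of even index whose corners give a directed triangle on three vertices of the same color adds a vertex $v(P)$ of the opposite color and replaces the three directed edges by undirected edges from $v(P)$ to the three vertices. Assume that $|\iota(P)|\le2$ for every cell $P$, and that every cell with $|\iota(P)|=2$ is a triangle. Then the first Yang–Baxter modification can be applied to $G^-$ successively at all cells with $|\iota(P)|=2$, once at each. Every mixed graph $G$ obtained in this way (the dimer model of $(\mathcal H,\iota)$) has only undirected edges, each joining a white and a black vertex. It is embedded in $\mathbf T^2$ as follows: $v(P)$ is the center of mass of $P$; the edges at $v(P)$ with $|\iota(P)|=2$ are straight line segments from the center of mass of $P$, across the three sides of $P$, to the centers of mass of the adjacent cells; every other edge, at an intersection point $p$ between cells $P_1$ and $P_2$, is the union of the line segments from the centers of mass of $P_1$ and $P_2$ to $p$. The image of this embedding is a strong deformation retract of the combinatorial coamoeba $$\mathcal D=\bigcup_{|\iota(P)|>0}\overline P .$$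 -/

import Mathlib

open Filter Topology MeasureTheory

/-! ### The torus and oriented line arrangements in it -/

/-- The real two-torus `(ℝ / 2πℤ)²`. -/
abbrev Torus : Type := AddCircle (2 * Real.pi) × AddCircle (2 * Real.pi)

/-- The universal covering map `ℝ² → (ℝ / 2πℤ)²`. -/
noncomputable def torusProj (x : ℝ × ℝ) : Torus := ((x.1 : AddCircle (2 * Real.pi)), (x.2 : AddCircle (2 * Real.pi)))

/-- The determinant of a pair of plane vectors; it is positive exactly when the pair is a positively
oriented basis. -/
def cross (u v : ℝ × ℝ) : ℝ := u.1 * v.2 - u.2 * v.1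

/-- An oriented line (oriented closed geodesic) in the torus: the image of a line in `ℝ²` whose
direction is the primitive integer vector `dir`. It is cut out by one equation
`dir.1 θ₂ - dir.2 θ₁ = offset`. -/
structure TorusLine where
  dir : ℤ × ℤ
  primitive : IsCoprime dir.1 dir.2
  offset : AddCircle (2 * Real.pi)

/-- The underlying set of an oriented line. -/
def TorusLine.carrier (L : TorusLine) : Set Torus :=
  {θ | L.dir.1 • θ.2 - L.dir.2 • θ.1 = L.offset}

/-- The tangent vector of an oriented line, as a vector of `ℝ²`. -/
def TorusLine.tangent (L : TorusLine) : ℝ × ℝ := ((L.dir.1 : ℝ), (L.dir.2 : ℝ))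

/-- An oriented line arrangement in the torus: a family of oriented lines. -/
abbrev Arrangement (I : Type*) : Type _ := I → TorusLine

/-! ### Lattice polygons and dual arrangements -/

/-- The determinant of a pair of integer vectors. -/
def intCross (u v : ℤ × ℤ) : ℤ := u.1 * v.2 - u.2 * v.1

/-- The convex hull of the finite set `A` of lattice points is a (two-dimensional) polygon: `A` is
not contained in a line. -/
def SpansPolygon (A : Finset (ℤ × ℤ)) : Prop :=
  ∃ α ∈ A, ∃ β ∈ A, ∃ δ ∈ A, intCross (β - α) (δ - α) ≠ 0

/-- `v`, `w` are the endpoints of a facet of the convex hull of `A`, in counterclockwise order: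
`A` lies to the left of the oriented line from `v` to `w`, and the points of `A` on this line
lie between `v` and `w`. -/
def IsFacet (A : Finset (ℤ × ℤ)) (v w : ℤ × ℤ) : Prop :=
  v ∈ A ∧ w ∈ A ∧ v ≠ w ∧ ∀ α ∈ A, 0 ≤ intCross (w - v) (α - v) ∧
    (intCross (w - v) (α - v) = 0 →
      0 ≤ (α - v).1 * (w - v).1 + (α - v).2 * (w - v).2 ∧
      0 ≤ (α - w).1 * (v - w).1 + (α - w).2 * (v - w).2)

/-- Clockwise rotation by the angle `π / 2`. It maps a facet (oriented counterclockwise) to its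
outward normal vector. -/
def rotCW (u : ℤ × ℤ) : ℤ × ℤ := (u.2, -u.1)

/-- The oriented line `L` is parallel to the nonzero integer vector `u`, with the same orientation. -/
def TorusLine.IsParallel (L : TorusLine) (u : ℤ × ℤ) : Prop := ∃ k : ℤ, 0 < k ∧ u = k • L.dir

namespace Arrangement

variable {I : Type*}

open Classical in
/-- The arrangement `H` is dual to the polygon spanned by `A`: its classes of (equally oriented)
parallel lines correspond to the facets `Γ` of the polygon, in such a way that the homology class
of the sum of the lines in a class is the outward normal vector `γ` of the facet, of the same
integer length as `Γ`. The homology class of an oriented line is its primitive direction vector. -/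
def IsDual [Fintype I] (H : Arrangement I) (A : Finset (ℤ × ℤ)) : Prop :=
  (∀ i, ∃ v w, IsFacet A v w ∧ (H i).IsParallel (rotCW (w - v))) ∧
  ∀ v w, IsFacet A v w →
    ∑ i ∈ Finset.univ.filter (fun i => (H i).IsParallel (rotCW (w - v))), (H i).dir
      = rotCW (w - v)

/-- Three distinct members of a simple arrangement have no common point. -/
def IsSimple (H : Arrangement I) : Prop :=
  ∀ i j k, i ≠ j → j ≠ k → i ≠ k →
    (H i).carrier ∩ (H j).carrier ∩ (H k).carrier = ∅

/-! ### Cells and the index map -/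

/-- The complement of the arrangement in the torus. -/
def compl (H : Arrangement I) : Set Torus := (⋃ i, (H i).carrier)ᶜ

/-- The complement of the preimage of the arrangement in the universal cover. -/
def liftCompl (H : Arrangement I) : Set (ℝ × ℝ) := torusProj ⁻¹' H.compl

/-- The cells of the arrangement: the connected components of its complement in the torus. -/
def Cell (H : Arrangement I) : Type :=
  {P : Set Torus // ∃ θ ∈ H.compl, P = connectedComponentIn H.compl θ}

/-- The cells of the preimage of the arrangement in the universal cover. -/
def IsLiftCell (H : Arrangement I) (P : Set (ℝ × ℝ)) : Prop :=
  ∃ x ∈ H.liftCompl, P = connectedComponentIn H.liftCompl x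

/-- `R` is a cell in the universal cover that lies over the cell `P` of the torus. -/
def IsLiftOf (H : Arrangement I) (R : Set (ℝ × ℝ)) (P : H.Cell) : Prop :=
  H.IsLiftCell R ∧ torusProj '' R = P.1

/-- The cell entered when one leaves the point `p` of the torus in the direction `u`, that is, the
cell that contains `p + t u` for all sufficiently small `t > 0` (empty if there is none). -/
def sector (H : Arrangement I) (p : Torus) (u : ℝ × ℝ) : Set Torus :=
  {q | ∀ᶠ t : ℝ in 𝓝[>] 0, q ∈ connectedComponentIn H.compl (p + torusProj (t • u))}

/-- The cell in the universal cover entered when one leaves `x` in the direction `u`. -/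
def liftSector (H : Arrangement I) (x u : ℝ × ℝ) : Set (ℝ × ℝ) :=
  {y | ∀ᶠ t : ℝ in 𝓝[>] 0, y ∈ connectedComponentIn H.liftCompl (x + t • u)}

/-- An index map: a function on the cells subject to the crossing rule. When a line with tangent
vector `γ` is crossed in the direction `ℓ`, the index increases by one if `(ℓ, γ)` is a positively
oriented basis. (So it decreases by one if `(ℓ, γ)` is negatively oriented.) -/
def IsIndexMap (H : Arrangement I) (ι : H.Cell → ℤ) : Prop :=
  ∀ i p, p ∈ (H i).carrier → (∀ j, j ≠ i → p ∉ (H j).carrier) →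
    ∀ ℓ : ℝ × ℝ, 0 < cross ℓ (H i).tangent →
      ∀ P Q : H.Cell, P.1 = H.sector p (-ℓ) → Q.1 = H.sector p ℓ → ι Q = ι P + 1

/-- A cell is a triangle if it is covered by an open triangle of the universal cover. -/
def IsTriangle (H : Arrangement I) (P : H.Cell) : Prop :=
  ∃ a b c : ℝ × ℝ, AffineIndependent ℝ ![a, b, c] ∧
    H.IsLiftOf (interior (convexHull ℝ {a, b, c})) P

/-- The combinatorial coamoeba: the union of the closed cells of nonzero index. -/
def combCoamoeba (H : Arrangement I) (ι : H.Cell → ℤ) : Set Torus :=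
  ⋃ P : {P : H.Cell // 0 < |ι P|}, closure P.1.1

/-- An intersection point of two lines of the arrangement. The two lines are listed so that their
tangent vectors form a positively oriented basis; thus, in a simple arrangement, each intersection
point occurs exactly once. -/
structure Crossing (H : Arrangement I) where
  fst : I
  snd : I
  pt : Torus
  cross_pos : 0 < cross (H fst).tangent (H snd).tangent
  mem_fst : pt ∈ (H fst).carrier
  mem_snd : pt ∈ (H snd).carrier

/-- The direction `u` is tangent to neither of the two lines through the crossing. -/
def Crossing.IsTransverse {H : Arrangement I} (c : H.Crossing) (u : ℝ × ℝ) : Prop :=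
  cross (H c.fst).tangent u ≠ 0 ∧ cross (H c.snd).tangent u ≠ 0

/-- `P` and `Q` are the cells in two opposite ones of the four sectors at the crossing `c`. -/
def Crossing.IsOpposite {H : Arrangement I} (c : H.Crossing) (P Q : H.Cell) : Prop :=
  ∃ u, c.IsTransverse u ∧ P.1 = H.sector c.pt u ∧ Q.1 = H.sector c.pt (-u)

/-- `P` and `Q` are the cells at `c` such that the edges of `P` are oriented towards `c`, while
those of `Q` are oriented away from `c`. -/
def Crossing.IsFromTo {H : Arrangement I} (c : H.Crossing) (P Q : H.Cell) : Prop :=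
  P.1 = H.sector c.pt (-((H c.fst).tangent + (H c.snd).tangent)) ∧
  Q.1 = H.sector c.pt ((H c.fst).tangent + (H c.snd).tangent)

/-- The crossing `c` is a corner of the cell `P`. -/
def Crossing.IsCorner {H : Arrangement I} (c : H.Crossing) (P : H.Cell) : Prop :=
  ∃ u, c.IsTransverse u ∧ P.1 = H.sector c.pt u

end Arrangement

/-! ### Mixed bicolored graphs and the first Yang–Baxter modification -/

/-- A mixed bicolored multigraph `(W, B, U, D)`, with vertices in `V` and edges labelled by elements
of `E`: an undirected edge is a label with an unordered pair of endpoints, a directed edge is a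
label with an ordered pair of endpoints. -/
@[ext]
structure MixedGraph (V E : Type*) where
  W : Set V
  B : Set V
  U : Set (E × Sym2 V)
  D : Set (E × (V × V))

namespace MixedGraph

variable {V E : Type*}

/-- The vertices of a mixed graph. -/
def verts (G : MixedGraph V E) : Set V := G.W ∪ G.B

/-- The labels of the edges of a mixed graph. -/
def edges (G : MixedGraph V E) : Set E := Prod.fst '' G.U ∪ Prod.fst '' G.D

/-- There are no directed edges, the two colors are disjoint, and each edge joins a white vertex and
a black vertex. -/
def IsBipartite (G : MixedGraph V E) : Prop :=
  G.D = ∅ ∧ Disjoint G.W G.B ∧ ∀ a ∈ G.U, ∃ w ∈ G.W, ∃ b ∈ G.B, a.2 = s(w, b)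

/-- `G'` arises from `G` by the first Yang–Baxter modification, with new vertex `x`, at the oriented
triangle with edges `e 0 : v 0 → v 1`, `e 1 : v 1 → v 2`, `e 2 : v 2 → v 0` and vertices of the same
color: the triangle is replaced by a star, whose center `x` has the opposite color. The edge `e i`
becomes the undirected edge from `x` to the vertex `v (i + 2)` opposite to it in the triangle. -/
def IsYangBaxterMove (G G' : MixedGraph V E) (x : V) (e : Fin 3 → E) (v : Fin 3 → V) : Prop :=
  Function.Injective e ∧ x ∉ G.verts ∧ (∀ i, (e i, (v i, v (i + 1))) ∈ G.D) ∧
  G'.U = G.U ∪ Set.range (fun i => (e i, s(x, v (i + 2)))) ∧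
  G'.D = G.D \ Set.range (fun i => (e i, (v i, v (i + 1)))) ∧
  (((∀ i, v i ∈ G.W) ∧ G'.W = G.W ∧ G'.B = insert x G.B) ∨
    ((∀ i, v i ∈ G.B) ∧ G'.W = insert x G.W ∧ G'.B = G.B))

/-- An embedding of a mixed graph in the torus: distinct vertices are mapped to distinct points, and
edges to curves between the endpoints that are simple (up to coinciding endpoints of loops) and
whose relative interiors meet neither vertices nor other edges. -/
structure TorusEmbedding (G : MixedGraph V E) where
  pos : V → Torus
  curve : E → C(unitInterval, Torus)
  pos_injOn : Set.InjOn pos G.verts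
  undirected_ends : ∀ e x y, (e, s(x, y)) ∈ G.U →
    (curve e 0 = pos x ∧ curve e 1 = pos y) ∨ (curve e 0 = pos y ∧ curve e 1 = pos x)
  directed_ends : ∀ e x y, (e, (x, y)) ∈ G.D → curve e 0 = pos x ∧ curve e 1 = pos y
  curve_simple : ∀ e ∈ G.edges, ∀ s t : unitInterval, s ∈ Set.Ioo 0 1 →
    curve e s = curve e t → s = t
  curve_avoids_verts : ∀ e ∈ G.edges, ∀ x ∈ G.verts, ∀ s : unitInterval, s ∈ Set.Ioo 0 1 →
    curve e s ≠ pos x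
  curve_avoids_curve : ∀ e ∈ G.edges, ∀ e' ∈ G.edges, e ≠ e' → ∀ s t : unitInterval,
    s ∈ Set.Ioo 0 1 → curve e s ≠ curve e' t

/-- The subset of the torus covered by an embedded graph. -/
def TorusEmbedding.carrier {G : MixedGraph V E} (Φ : G.TorusEmbedding) : Set Torus :=
  Φ.pos '' G.verts ∪ ⋃ e ∈ G.edges, Set.range (Φ.curve e)

end MixedGraph

/-! ### The index graph, the dimer model and its drawing -/

namespace Arrangement

variable {I : Type*}

/-- The (odd) index graph. Its vertices are the cells of odd index, white if the index is `1` modulo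
`4` and black if it is `-1` modulo `4`. Each crossing at which two cells of odd index meet yields an
edge between them: an edge directed according to the orientations of the lines if the two indices
agree modulo `4`, and an undirected edge otherwise. -/
def indexGraph (H : Arrangement I) (ι : H.Cell → ℤ) : MixedGraph H.Cell H.Crossing where
  W := {P | ι P ≡ 1 [ZMOD 4]}
  B := {P | ι P ≡ -1 [ZMOD 4]}
  U := {a | ∃ c P Q, a = (c, s(P, Q)) ∧ Odd (ι P) ∧ Odd (ι Q) ∧ ¬ ι P ≡ ι Q [ZMOD 4] ∧
    c.IsOpposite P Q}
  D := {a | ∃ c P Q, a = (c, (P, Q)) ∧ Odd (ι P) ∧ Odd (ι Q) ∧ ι P ≡ ι Q [ZMOD 4] ∧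
    c.IsFromTo P Q}

/-- `G'` arises from `G` by the first Yang–Baxter modification at the cell `P`: the directed
triangle given by the corners of `P` is replaced by a star with center `P`. -/
def IsYangBaxterAt (H : Arrangement I) (P : H.Cell) (G G' : MixedGraph H.Cell H.Crossing) : Prop :=
  ∃ e v, (∀ i, (e i).IsCorner P) ∧ G.IsYangBaxterMove G' P e v

/-- `H.YangBaxterSeq ι S G`: the graph `G` is obtained from the index graph by successively applying
the first Yang–Baxter modification at the members of the set `S` of cells of index `2` or `-2`, once
at each, in some order. -/
inductive YangBaxterSeq (H : Arrangement I) (ι : H.Cell → ℤ) :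
    Set H.Cell → MixedGraph H.Cell H.Crossing → Prop
  | nil : YangBaxterSeq H ι ∅ (H.indexGraph ι)
  | step {S : Set H.Cell} {G G' : MixedGraph H.Cell H.Crossing} (P : H.Cell) :
      YangBaxterSeq H ι S G → |ι P| = 2 → P ∉ S → H.IsYangBaxterAt P G G' →
      YangBaxterSeq H ι (insert P S) G'

/-- `G` is the dimer model of `(H, ι)`: it is obtained from the index graph by the first Yang–Baxter
modifications at all the cells of index `2` or `-2`. -/
def IsDimerModel (H : Arrangement I) (ι : H.Cell → ℤ) (G : MixedGraph H.Cell H.Crossing) : Prop :=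
  H.YangBaxterSeq ι {P | |ι P| = 2} G

/-- The center of mass of a plane region. -/
noncomputable def centerOfMass (R : Set (ℝ × ℝ)) : ℝ × ℝ := ⨍ x in R, x

/-- The embedding of the dimer model in the torus by centers of mass. A vertex is placed at the
center of mass of its cell. An edge at a crossing `p` that was not affected by a modification is the
union of the two line segments from the centers of mass of the two cells to `p`. The edges at a
vertex `v(P)` with `P` of index `2` or `-2` are straight line segments: the one labelled by the
corner `p` of the triangle `P` runs from the center of mass of `P` to that of the neighbor of `P`
across the side opposite to `p`. (Segments are taken in the universal cover.) -/
structure IsCenterOfMassEmbedding (H : Arrangement I) (ι : H.Cell → ℤ)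
    {G : MixedGraph H.Cell H.Crossing} (Φ : G.TorusEmbedding) : Prop where
  pos_eq : ∀ P ∈ G.verts, ∀ R, H.IsLiftOf R P → Φ.pos P = torusProj (centerOfMass R)
  broken : ∀ c P Q, (c, s(P, Q)) ∈ G.U → |ι P| ≠ 2 → |ι Q| ≠ 2 →
    ∀ x, torusProj x = c.pt → ∀ u, c.IsTransverse u →
      H.IsLiftOf (H.liftSector x u) P → H.IsLiftOf (H.liftSector x (-u)) Q →
      Set.range (Φ.curve c) = torusProj ''
        (segment ℝ (centerOfMass (H.liftSector x u)) x ∪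
          segment ℝ x (centerOfMass (H.liftSector x (-u))))
  straight : ∀ c P Q, (c, s(P, Q)) ∈ G.U → |ι P| = 2 →
    ∀ x, torusProj x = c.pt → ∀ R S, H.IsLiftOf R P → H.IsLiftOf S Q →
      x ∈ closure R → x ∉ closure S → (closure R ∩ closure S).Nontrivial →
      Set.range (Φ.curve c) = torusProj '' segment ℝ (centerOfMass R) (centerOfMass S)

end Arrangement

/-- `A` is a strong deformation retract of `X`, for subsets of a topological space: there is a
homotopy in `X`, constant on `A`, from the identity to a map with values in `A`. -/
def IsStrongDeformationRetract {Y : Type*} [TopologicalSpace Y] (A X : Set Y) : Prop :=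
  A ⊆ X ∧ ∃ r : C(X, X), (∀ x, (r x : Y) ∈ A) ∧
    Nonempty (ContinuousMap.HomotopyRel (ContinuousMap.id X) r {x : X | (x : Y) ∈ A})

/-! ### The universal covering of the torus -/

/-- The deck transformation vector attached to a pair of integers. -/
noncomputable def deckVec (k : ℤ × ℤ) : ℝ × ℝ := (k.1 * (2 * Real.pi), k.2 * (2 * Real.pi))

theorem torusProj_eq_iff {x y : ℝ × ℝ} : torusProj x = torusProj y ↔ ∃ k, y = x + deckVec k := by
  have key : ∀ a b : ℝ, (a : AddCircle (2 * Real.pi)) = b ↔ ∃ n : ℤ, b = a + n * (2 * Real.pi) := by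
    intro a b
    rw [eq_comm, ← sub_eq_zero, ← AddCircle.coe_sub, AddCircle.coe_eq_zero_iff]
    refine exists_congr fun n => ?_
    rw [zsmul_eq_mul]
    constructor <;> intro h <;> linarith
  simp only [torusProj, Prod.mk.injEq, key, deckVec]
  constructor
  · rintro ⟨⟨m, hm⟩, n, hn⟩
    exact ⟨(m, n), Prod.ext hm hn⟩
  · rintro ⟨k, rfl⟩
    exact ⟨⟨k.1, rfl⟩, k.2, rfl⟩

@[simp] theorem torusProj_add_deckVec (x : ℝ × ℝ) (k : ℤ × ℤ) :
    torusProj (x + deckVec k) = torusProj x := (torusProj_eq_iff.2 ⟨k, rfl⟩).symm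

theorem torusProj_add (x y : ℝ × ℝ) : torusProj (x + y) = torusProj x + torusProj y := rfl

theorem isOpenQuotientMap_torusProj : IsOpenQuotientMap torusProj := by
  have h : IsOpenQuotientMap (fun x : ℝ => (x : AddCircle (2 * Real.pi))) :=
    QuotientAddGroup.isOpenQuotientMap_mk
  exact h.prodMap h

theorem torusProj_surjective : Function.Surjective torusProj := isOpenQuotientMap_torusProj.surjective

theorem continuous_torusProj : Continuous torusProj := isOpenQuotientMap_torusProj.continuous

namespace Arrangement

variable {I : Type*} (H : Arrangement I)

/-! ### Height functions of the lines -/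

/-- A real representative of the offset of a line. -/
noncomputable def offsetLift (i : I) : ℝ := (QuotientAddGroup.mk_surjective (H i).offset).choose

theorem coe_offsetLift (i : I) : (H.offsetLift i : AddCircle (2 * Real.pi)) = (H i).offset :=
  (QuotientAddGroup.mk_surjective (H i).offset).choose_spec

/-- The slope of the height function of a line along a vector. -/
noncomputable def slope (i : I) (v : ℝ × ℝ) : ℝ := cross (H i).tangent v / (2 * Real.pi)

/-- The height function of a line; the lifts of the line to the plane are the level sets at the
integers. -/
noncomputable def height (i : I) (x : ℝ × ℝ) : ℝ := H.slope i x - H.offsetLift i / (2 * Real.pi)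

theorem slope_add (i : I) (v w : ℝ × ℝ) : H.slope i (v + w) = H.slope i v + H.slope i w := by
  simp only [slope, cross, Prod.fst_add, Prod.snd_add]; ring

theorem slope_smul (i : I) (t : ℝ) (v : ℝ × ℝ) : H.slope i (t • v) = t * H.slope i v := by
  simp only [slope, cross, Prod.smul_fst, Prod.smul_snd, smul_eq_mul]; ring

theorem slope_neg (i : I) (v : ℝ × ℝ) : H.slope i (-v) = -H.slope i v := by
  simp only [slope, cross, Prod.fst_neg, Prod.snd_neg]; ring

theorem slope_sub (i : I) (v w : ℝ × ℝ) : H.slope i (v - w) = H.slope i v - H.slope i w := by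
  rw [sub_eq_add_neg, slope_add, slope_neg, sub_eq_add_neg]

theorem height_add (i : I) (x v : ℝ × ℝ) : H.height i (x + v) = H.height i x + H.slope i v := by
  rw [height, height, slope_add]; ring

theorem slope_vsub (i : I) (x y : ℝ × ℝ) : H.slope i (x - y) = H.height i x - H.height i y := by
  rw [height, height, slope_sub]; ring

theorem slope_neg_iff {i : I} {v : ℝ × ℝ} : H.slope i v < 0 ↔ cross (H i).tangent v < 0 := by
  rw [slope, div_lt_iff₀ Real.two_pi_pos, zero_mul]

theorem slope_eq_zero_iff {i : I} {v : ℝ × ℝ} : H.slope i v = 0 ↔ cross (H i).tangent v = 0 := by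
  rw [slope, div_eq_zero_iff, or_iff_left Real.two_pi_pos.ne']

theorem continuous_slope (i : I) : Continuous (H.slope i) := by
  unfold slope cross; fun_prop

theorem continuous_height (i : I) : Continuous (H.height i) :=
  (H.continuous_slope i).sub continuous_const

/-- The effect of a deck transformation on the heights. -/
def deck (k : ℤ × ℤ) (i : I) : ℤ := (H i).dir.1 * k.2 - (H i).dir.2 * k.1

theorem slope_deckVec (i : I) (k : ℤ × ℤ) : H.slope i (deckVec k) = H.deck k i := by
  have := Real.pi_pos.ne'
  simp only [slope, cross, deckVec, TorusLine.tangent, deck]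
  push_cast; field_simp

theorem height_add_deckVec (i : I) (x : ℝ × ℝ) (k : ℤ × ℤ) :
    H.height i (x + deckVec k) = H.height i x + H.deck k i := by
  rw [height_add, slope_deckVec]

/-- The point `x` lies on a lift of the line `i`. -/
def On (i : I) (x : ℝ × ℝ) : Prop := ∃ m : ℤ, H.height i x = m

theorem mem_carrier_iff {i : I} {x : ℝ × ℝ} : torusProj x ∈ (H i).carrier ↔ H.On i x := by
  have h1 : torusProj x ∈ (H i).carrier ↔
      ((((H i).dir.1 • x.2 - (H i).dir.2 • x.1 - H.offsetLift i : ℝ)) : AddCircle (2 * Real.pi)) = 0 := by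
    rw [AddCircle.coe_sub, AddCircle.coe_sub, coe_offsetLift, sub_eq_zero, AddCircle.coe_zsmul,
      AddCircle.coe_zsmul]
    rfl
  rw [h1, AddCircle.coe_eq_zero_iff]
  refine exists_congr fun n => ?_
  have := Real.pi_pos.ne'
  simp only [height, slope, cross, TorusLine.tangent, zsmul_eq_mul]
  rw [← sub_div, div_eq_iff Real.two_pi_pos.ne']
  exact eq_comm

theorem mem_liftCompl_iff {x : ℝ × ℝ} : x ∈ H.liftCompl ↔ ∀ i, ¬ H.On i x := by
  simp [liftCompl, compl, mem_carrier_iff]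

theorem On.add_deckVec {H : Arrangement I} {i : I} {x : ℝ × ℝ} (h : H.On i x) (k : ℤ × ℤ) : H.On i (x + deckVec k) := by
  obtain ⟨m, hm⟩ := h
  exact ⟨m + H.deck k i, by rw [height_add_deckVec, hm]; push_cast; rfl⟩

/-! ### Open and closed cells in the plane -/

/-- The open cell of the plane with given integer parts of the heights. -/
def OpenCell (n : I → ℤ) : Set (ℝ × ℝ) := {x | ∀ i, n i < H.height i x ∧ H.height i x < n i + 1}

/-- The closed cell of the plane with given integer parts of the heights. -/
def ClosedCell (n : I → ℤ) : Set (ℝ × ℝ) := {x | ∀ i, n i ≤ H.height i x ∧ H.height i x ≤ n i + 1}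

/-- The integer vectors that belong to a cell of the plane. -/
def IsCellVec (n : I → ℤ) : Prop := (H.OpenCell n).Nonempty

/-- The sign attached to a side of a strip. -/
def sg (b : Bool) : ℤ := if b then 1 else -1

/-- The distance of a point from a side of a cell, measured by the height function. -/
noncomputable def gap (n : I → ℤ) (k : I × Bool) (x : ℝ × ℝ) : ℝ :=
  if k.2 then n k.1 + 1 - H.height k.1 x else H.height k.1 x - n k.1

open Classical in
/-- The vector of the cell on the other side of a side. -/
noncomputable def step (n : I → ℤ) (k : I × Bool) : I → ℤ :=
  Function.update n k.1 (n k.1 + sg k.2)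

/-- The opposite side of the same strip. -/
def rev (k : I × Bool) : I × Bool := (k.1, !k.2)

@[simp] theorem rev_rev (k : I × Bool) : rev (rev k) = k := by simp [rev]

theorem rev_ne (k : I × Bool) : rev k ≠ k := by
  rcases k with ⟨i, b⟩; cases b <;> simp [rev]

theorem sg_not (b : Bool) : sg (!b) = -sg b := by cases b <;> simp [sg]

theorem sg_injective : Function.Injective sg := by decide

theorem step_same (n : I → ℤ) (k : I × Bool) : step n k k.1 = n k.1 + sg k.2 := by simp [step]

theorem step_of_ne (n : I → ℤ) (k : I × Bool) {i : I} (h : i ≠ k.1) : step n k i = n i := by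
  simp [step, h]

@[simp] theorem step_step_rev (n : I → ℤ) (k : I × Bool) : step (step n k) (rev k) = n := by
  funext i
  by_cases h : i = k.1
  · subst h
    have := step_same (step n k) (rev k)
    rw [show (rev k).1 = k.1 from rfl, show (rev k).2 = !k.2 from rfl, sg_not, step_same] at this
    rw [this]; ring
  · rw [step_of_ne _ _ (by exact h), step_of_ne _ _ h]

theorem step_ne (n : I → ℤ) (k : I × Bool) : step n k ≠ n := by
  intro h
  have := congrFun h k.1
  rw [step_same] at this
  rcases k with ⟨i, b⟩; cases b <;> simp [sg] at this

theorem gap_add (n : I → ℤ) (k : I × Bool) (x v : ℝ × ℝ) :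
    H.gap n k (x + v) = H.gap n k x - sg k.2 * H.slope k.1 v := by
  rcases k with ⟨i, b⟩; cases b <;> simp [gap, sg, height_add] <;> ring

theorem sg_slope_sub (n : I → ℤ) (k : I × Bool) (x y : ℝ × ℝ) :
    sg k.2 * H.slope k.1 (x - y) = H.gap n k y - H.gap n k x := by
  rcases k with ⟨i, b⟩; cases b <;> simp [gap, sg, slope_vsub]

theorem gap_add_smul_sub (n : I → ℤ) (k : I × Bool) (x y z : ℝ × ℝ) (t : ℝ) :
    H.gap n k (x + t • (y - z)) = H.gap n k x + t * (H.gap n k y - H.gap n k z) := by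
  rw [gap_add, slope_smul]
  linear_combination (-t) * H.sg_slope_sub n k y z

theorem gap_combo (n : I → ℤ) (k : I × Bool) (x y : ℝ × ℝ) {a b : ℝ} (h : a + b = 1) :
    H.gap n k (a • x + b • y) = a * H.gap n k x + b * H.gap n k y := by
  have : a • x + b • y = x + b • (y - x) := by
    rw [← eq_sub_iff_add_eq] at h; subst h; module
  rw [this, gap_add_smul_sub, ← eq_sub_iff_add_eq] at *
  subst h; ring

theorem continuous_gap (n : I → ℤ) (k : I × Bool) : Continuous (H.gap n k) := by
  rcases k with ⟨i, b⟩
  cases b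
  · exact (H.continuous_height i).sub continuous_const
  · exact continuous_const.sub (H.continuous_height i)

theorem gap_add_gap_rev (n : I → ℤ) (k : I × Bool) (x : ℝ × ℝ) :
    H.gap n k x + H.gap n (rev k) x = 1 := by
  rcases k with ⟨i, b⟩; cases b <;> simp [gap, rev]

theorem gap_step_same (n : I → ℤ) (k : I × Bool) (x : ℝ × ℝ) :
    H.gap (step n k) k x = H.gap n k x + 1 := by
  rcases k with ⟨i, b⟩; cases b <;> simp [gap, step, sg] <;> ring

theorem gap_step_rev (n : I → ℤ) (k : I × Bool) (x : ℝ × ℝ) :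
    H.gap (step n k) (rev k) x = - H.gap n k x := by
  rcases k with ⟨i, b⟩; cases b <;> simp [gap, step, sg, rev]

theorem gap_step_of_ne (n : I → ℤ) {k k' : I × Bool} (h : k'.1 ≠ k.1) (x : ℝ × ℝ) :
    H.gap (step n k) k' x = H.gap n k' x := by
  simp [gap, step_of_ne _ _ h]

theorem mem_openCell_iff {n : I → ℤ} {x : ℝ × ℝ} : x ∈ H.OpenCell n ↔ ∀ k, 0 < H.gap n k x := by
  simp only [OpenCell, Set.mem_ofPred_eq, Prod.forall, Bool.forall_bool, gap]
  refine forall_congr' fun i => ?_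
  simp

theorem mem_closedCell_iff {n : I → ℤ} {x : ℝ × ℝ} :
    x ∈ H.ClosedCell n ↔ ∀ k, 0 ≤ H.gap n k x := by
  simp only [ClosedCell, Set.mem_ofPred_eq, Prod.forall, Bool.forall_bool, gap]
  refine forall_congr' fun i => ?_
  simp

theorem openCell_subset_closedCell (n : I → ℤ) : H.OpenCell n ⊆ H.ClosedCell n :=
  fun _ h i => ⟨(h i).1.le, (h i).2.le⟩

theorem isClosed_closedCell (n : I → ℤ) : IsClosed (H.ClosedCell n) := by
  simp only [ClosedCell, Set.ofPred_forall]
  exact isClosed_iInter fun i => (isClosed_le continuous_const (H.continuous_height i)).inter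
    (isClosed_le (H.continuous_height i) continuous_const)

theorem isOpen_openCell [Finite I] (n : I → ℤ) : IsOpen (H.OpenCell n) := by
  simp only [OpenCell, Set.ofPred_forall]
  exact isOpen_iInter_of_finite fun i => (isOpen_lt continuous_const (H.continuous_height i)).inter
    (isOpen_lt (H.continuous_height i) continuous_const)

theorem convex_closedCell (n : I → ℤ) : Convex ℝ (H.ClosedCell n) := by
  intro x hx y hy a b ha hb hab
  rw [mem_closedCell_iff] at *
  intro k
  rw [gap_combo _ _ _ _ _ hab]
  have := hx k; have := hy k
  positivity

theorem convex_openCell (n : I → ℤ) : Convex ℝ (H.OpenCell n) := by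
  intro x hx y hy a b ha hb hab
  rw [mem_openCell_iff] at *
  intro k
  rw [gap_combo _ _ _ _ _ hab]
  have := hx k; have := hy k
  rcases ha.eq_or_lt with h | h
  · subst h; rw [zero_add] at hab; subst hab; simpa using hy k
  · positivity

theorem gap_add_deckVec (n : I → ℤ) (k : I × Bool) (x : ℝ × ℝ) (d : ℤ × ℤ) :
    H.gap (n + H.deck d) k (x + deckVec d) = H.gap n k x := by
  rcases k with ⟨i, b⟩
  cases b
  · simp [gap, height_add_deckVec]
  · simp [gap, height_add_deckVec]; ring

theorem step_add (n d : I → ℤ) (k : I × Bool) : step (n + d) k = step n k + d := by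
  funext i
  by_cases h : i = k.1
  · subst h; simp [step_same]; ring
  · simp [step_of_ne _ _ h]

theorem mem_openCell_add_deckVec {n : I → ℤ} {x : ℝ × ℝ} {d : ℤ × ℤ} :
    x + deckVec d ∈ H.OpenCell (n + H.deck d) ↔ x ∈ H.OpenCell n := by
  simp [mem_openCell_iff, gap_add_deckVec]

theorem mem_closedCell_add_deckVec {n : I → ℤ} {x : ℝ × ℝ} {d : ℤ × ℤ} :
    x + deckVec d ∈ H.ClosedCell (n + H.deck d) ↔ x ∈ H.ClosedCell n := by
  simp [mem_closedCell_iff, gap_add_deckVec]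

theorem openCell_add_deck (n : I → ℤ) (d : ℤ × ℤ) :
    H.OpenCell (n + H.deck d) = (· + deckVec d) '' H.OpenCell n := by
  ext x
  constructor
  · intro h
    refine ⟨x - deckVec d, ?_, by simp⟩
    rwa [← H.mem_openCell_add_deckVec (d := d), sub_add_cancel]
  · rintro ⟨y, hy, rfl⟩
    exact H.mem_openCell_add_deckVec.2 hy

theorem IsCellVec.add_deck {H : Arrangement I} {n : I → ℤ} (h : H.IsCellVec n) (d : ℤ × ℤ) :
    H.IsCellVec (n + H.deck d) := by
  rw [IsCellVec, openCell_add_deck]; exact h.image _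

theorem mem_closedCell_step {n : I → ℤ} {k : I × Bool} {x : ℝ × ℝ} (hx : x ∈ H.ClosedCell n)
    (h : H.gap n k x = 0) : x ∈ H.ClosedCell (step n k) := by
  rw [mem_closedCell_iff] at *
  intro k'
  by_cases h1 : k'.1 = k.1
  · have : k' = k ∨ k' = rev k := by
      rcases k with ⟨i, b⟩; rcases k' with ⟨j, c⟩
      simp only at h1; subst h1
      cases b <;> cases c <;> simp [rev]
    rcases this with rfl | rfl
    · rw [gap_step_same, h]; norm_num
    · rw [gap_step_rev, h]; norm_num
  · rw [gap_step_of_ne _ _ h1]; exact hx k'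

theorem on_of_gap_eq_zero {n : I → ℤ} {k : I × Bool} {x : ℝ × ℝ} (h : H.gap n k x = 0) :
    H.On k.1 x := by
  rcases k with ⟨i, b⟩
  cases b <;> simp only [gap] at h
  · exact ⟨n i, by simpa [sub_eq_zero] using h⟩
  · refine ⟨n i + 1, ?_⟩
    push_cast
    simp at h; linarith

theorem exists_gap_eq_zero {n : I → ℤ} {i : I} {x : ℝ × ℝ} (hx : x ∈ H.ClosedCell n)
    (h : H.On i x) : ∃ b, H.gap n (i, b) x = 0 := by
  obtain ⟨m, hm⟩ := h
  have := hx i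
  rw [hm] at this
  have h1 : n i ≤ m := by exact_mod_cast this.1
  have h2 : m ≤ n i + 1 := by exact_mod_cast this.2
  rcases h1.eq_or_lt with h | h
  · exact ⟨false, by simp [gap, hm, h]⟩
  · have : m = n i + 1 := by omega
    exact ⟨true, by simp [gap, hm, this]⟩

/-! ### Generic arrangements -/

/-- An arrangement is generic if it is simple and not all of its lines are parallel. -/
structure IsGeneric : Prop where
  simple : H.IsSimple
  spans : ∃ i j, cross (H i).tangent (H j).tangent ≠ 0

variable {H}

theorem eq_of_on_three (hs : H.IsSimple) {i j k : I} {x : ℝ × ℝ} (hi : H.On i x) (hj : H.On j x)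
    (hk : H.On k x) : i = j ∨ j = k ∨ i = k := by
  by_contra! h
  have := hs i j k h.1 h.2.1 h.2.2
  have hx : torusProj x ∈ (H i).carrier ∩ (H j).carrier ∩ (H k).carrier :=
    ⟨⟨H.mem_carrier_iff.2 hi, H.mem_carrier_iff.2 hj⟩, H.mem_carrier_iff.2 hk⟩
  rw [this] at hx
  exact hx

theorem tangent_ne_zero (H : Arrangement I) (i : I) :
    0 < (H i).tangent.1 ^ 2 + (H i).tangent.2 ^ 2 := by
  have := (H i).primitive
  by_contra! h
  have h1 : (H i).tangent.1 = 0 := by nlinarith [sq_nonneg (H i).tangent.1, sq_nonneg (H i).tangent.2]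
  have h2 : (H i).tangent.2 = 0 := by nlinarith [sq_nonneg (H i).tangent.1, sq_nonneg (H i).tangent.2]
  simp only [TorusLine.tangent, Int.cast_eq_zero] at h1 h2
  rw [h1, h2] at this
  exact not_isCoprime_zero_zero this

theorem exists_cross_ne_zero (hG : H.IsGeneric) (i : I) :
    ∃ k, cross (H i).tangent (H k).tangent ≠ 0 := by
  obtain ⟨a, b, hab⟩ := hG.spans
  by_contra! h
  have h0 := tangent_ne_zero H i
  have ha := h a
  have hb := h b
  apply hab
  simp only [cross] at *
  generalize (H i).tangent = u at *
  generalize (H a).tangent = v at *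
  generalize (H b).tangent = w at *
  have h1 : u.1 * (v.1 * w.2 - v.2 * w.1) = 0 := by linear_combination v.1 * hb - w.1 * ha
  have h2 : u.2 * (v.1 * w.2 - v.2 * w.1) = 0 := by linear_combination v.2 * hb - w.2 * ha
  rcases mul_eq_zero.1 h1 with h1 | h1
  · rcases mul_eq_zero.1 h2 with h2 | h2
    · rw [h1, h2] at h0; norm_num at h0
    · exact h2
  · exact h1

theorem cross_self (u : ℝ × ℝ) : cross u u = 0 := by simp [cross]; ring

theorem cross_swap (u v : ℝ × ℝ) : cross v u = -cross u v := by simp [cross]; ring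

theorem cross_ne_zero_of_on (hG : H.IsGeneric) {i j : I} (hij : i ≠ j) {x : ℝ × ℝ}
    (hi : H.On i x) (hj : H.On j x) : cross (H i).tangent (H j).tangent ≠ 0 := by
  intro h
  obtain ⟨k, hk⟩ := exists_cross_ne_zero hG i
  have hki : k ≠ i := by rintro rfl; exact hk (cross_self _)
  have hkj : k ≠ j := by rintro rfl; exact hk h
  have hs : H.slope k (H i).tangent ≠ 0 := by
    rw [Ne, slope_eq_zero_iff, cross_swap]; simpa using hk
  let y := x + (-H.height k x / H.slope k (H i).tangent) • (H i).tangent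
  have h1 : H.On k y := ⟨0, by
    simp only [y, height_add, slope_smul]; field_simp; simp⟩
  have h2 : H.On i y := by
    obtain ⟨m, hm⟩ := hi
    refine ⟨m, ?_⟩
    simp only [y, height_add, slope_smul]
    rw [(H.slope_eq_zero_iff (i := i)).2 (cross_self _), hm]; simp
  have h3 : H.On j y := by
    obtain ⟨m, hm⟩ := hj
    refine ⟨m, ?_⟩
    simp only [y, height_add, slope_smul]
    rw [(H.slope_eq_zero_iff (i := j)).2 (by rw [cross_swap, h, neg_zero]), hm]; simp
  rcases eq_of_on_three hG.simple h1 h2 h3 with h | h | h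
  · exact hki h
  · exact hij h
  · exact hkj h

theorem exists_slope_eq_pair {i j : I} (h : cross (H i).tangent (H j).tangent ≠ 0) (a b : ℝ) :
    ∃ u, H.slope i u = a ∧ H.slope j u = b := by
  refine ⟨((2 * Real.pi) / cross (H i).tangent (H j).tangent) •
    (b • (- (H i).tangent) + a • (H j).tangent), ?_, ?_⟩
  all_goals
    have := Real.pi_pos.ne'
    simp only [slope_smul, slope_add, slope_neg]
    simp only [slope, cross_self, cross_swap (H i).tangent (H j).tangent]
    field_simp; simp

theorem eq_zero_of_slope_eq_zero {i j : I} (h : cross (H i).tangent (H j).tangent ≠ 0) {v : ℝ × ℝ}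
    (hi : H.slope i v = 0) (hj : H.slope j v = 0) : v = 0 := by
  rw [slope_eq_zero_iff] at hi hj
  simp only [cross] at *
  generalize (H i).tangent = u at *
  generalize (H j).tangent = w at *
  ext
  · refine (mul_eq_zero.1 ?_).resolve_left h
    linear_combination w.1 * hi - u.1 * hj
  · refine (mul_eq_zero.1 ?_).resolve_left h
    linear_combination w.2 * hi - u.2 * hj

/-- Directions with prescribed slopes with respect to the lines through a point. -/
theorem exists_slope_eq (hG : H.IsGeneric) (x : ℝ × ℝ) (ε : I → ℝ) :
    ∃ u, ∀ i, H.On i x → H.slope i u = ε i := by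
  by_cases h : ∃ i, H.On i x
  · obtain ⟨i, hi⟩ := h
    by_cases h' : ∃ j, j ≠ i ∧ H.On j x
    · obtain ⟨j, hji, hj⟩ := h'
      obtain ⟨u, hu1, hu2⟩ := exists_slope_eq_pair (cross_ne_zero_of_on hG hji hj hi) (ε j) (ε i)
      refine ⟨u, fun k hk => ?_⟩
      rcases eq_of_on_three hG.simple hj hi hk with h | h | h
      · exact absurd h hji
      · rw [← h, hu2]
      · rw [← h, hu1]
    · push Not at h'
      obtain ⟨k, hk⟩ := exists_cross_ne_zero hG i
      obtain ⟨u, hu1, -⟩ := exists_slope_eq_pair hk (ε i) 0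
      refine ⟨u, fun j hj => ?_⟩
      by_cases hji : j = i
      · rw [hji, hu1]
      · exact absurd hj (h' j hji)
  · push Not at h
    exact ⟨0, fun i hi => absurd hi (h i)⟩

variable (H)

/-- The vector of the cell that is entered when one leaves the point `x` in the direction `u`. -/
noncomputable def secVec (x u : ℝ × ℝ) (i : I) : ℤ :=
  if 0 < H.slope i u then ⌊H.height i x⌋ else ⌈H.height i x⌉ - 1

theorem eventually_mem_openCell [Finite I] {x u : ℝ × ℝ} (h : ∀ i, H.On i x → H.slope i u ≠ 0) :
    ∀ᶠ t : ℝ in 𝓝[>] 0, x + t • u ∈ H.OpenCell (H.secVec x u) := by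
  simp only [OpenCell, Set.mem_ofPred_eq]
  rw [eventually_all]
  intro i
  simp only [height_add, slope_smul]
  have hc : Tendsto (fun t : ℝ => H.height i x + t * H.slope i u) (𝓝[>] 0) (𝓝 (H.height i x)) := by
    have : Continuous (fun t : ℝ => H.height i x + t * H.slope i u) := by fun_prop
    have := this.tendsto 0
    simp only [zero_mul, add_zero] at this
    exact this.mono_left nhdsWithin_le_nhds
  have hp : ∀ᶠ t : ℝ in 𝓝[>] 0, 0 < t := eventually_mem_nhdsWithin
  have hfl : ∀ᶠ t : ℝ in 𝓝[>] 0, H.height i x + t * H.slope i u < ⌊H.height i x⌋ + 1 :=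
    hc.eventually_lt_const (Int.lt_floor_add_one _)
  have hce : ∀ᶠ t : ℝ in 𝓝[>] 0, (⌈H.height i x⌉ : ℝ) - 1 < H.height i x + t * H.slope i u :=
    hc.eventually_const_lt (by linarith [Int.ceil_lt_add_one (H.height i x)])
  by_cases hu : 0 < H.slope i u
  · simp only [secVec, if_pos hu]
    filter_upwards [hp, hfl] with t ht h1
    exact ⟨by nlinarith [Int.floor_le (H.height i x), mul_pos ht hu], h1⟩
  · simp only [secVec, if_neg hu]
    push_cast
    by_cases ho : H.On i x
    · have hu' : H.slope i u < 0 := lt_of_le_of_ne (not_lt.1 hu) (h i ho)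
      filter_upwards [hp, hce] with t ht h1
      exact ⟨h1, by nlinarith [Int.le_ceil (H.height i x), mul_pos_of_neg_of_neg (neg_neg_of_pos ht) hu']⟩
    · have hlt : H.height i x < ⌈H.height i x⌉ :=
        lt_of_le_of_ne (Int.le_ceil _) fun h => ho ⟨_, h⟩
      filter_upwards [hce, hc.eventually_lt_const hlt] with t h1 h2
      exact ⟨h1, by linarith⟩

variable {H}

theorem exists_secVec_eq (hG : H.IsGeneric) {n : I → ℤ} {x : ℝ × ℝ} (hx : x ∈ H.ClosedCell n) :
    ∃ u, (∀ i, H.On i x → H.slope i u ≠ 0) ∧ H.secVec x u = n := by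
  classical
  obtain ⟨u, hu⟩ := exists_slope_eq hG x (fun i => if H.height i x = n i then 1 else -1)
  refine ⟨u, fun i hi => ?_, ?_⟩
  · rw [hu i hi]; split_ifs <;> norm_num
  · funext i
    have h1 := hx i
    by_cases ho : H.On i x
    · have h2 := hu i ho
      obtain ⟨b, hb⟩ := H.exists_gap_eq_zero hx ho
      cases b
      · have hb : H.height i x = n i := by simp [gap] at hb; linarith
        rw [if_pos hb] at h2
        simp [secVec, h2, hb]
      · have hb : H.height i x = (n i + 1 : ℤ) := by simp [gap] at hb; push_cast; linarith
        rw [if_neg (by rw [hb]; simp)] at h2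
        simp only [secVec, h2, hb, Int.ceil_intCast]; norm_num
    · have h2 : H.height i x ≠ n i := fun h => ho ⟨_, h⟩
      have h3 : H.height i x ≠ n i + 1 := fun h => ho ⟨n i + 1, by rw [h]; push_cast; rfl⟩
      have h4 := lt_of_le_of_ne h1.1 h2.symm
      have h5 := lt_of_le_of_ne h1.2 h3
      have h6 : ⌊H.height i x⌋ = n i := Int.floor_eq_iff.2 ⟨h1.1, h5⟩
      have h7 : ⌈H.height i x⌉ = n i + 1 := Int.ceil_eq_iff.2 ⟨by push_cast; linarith, by push_cast; linarith⟩
      simp [secVec, h6, h7]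

theorem isCellVec_of_mem_closedCell [Finite I] (hG : H.IsGeneric) {n : I → ℤ} {x : ℝ × ℝ}
    (hx : x ∈ H.ClosedCell n) : H.IsCellVec n := by
  obtain ⟨u, h1, rfl⟩ := exists_secVec_eq hG hx
  obtain ⟨t, ht⟩ := (H.eventually_mem_openCell h1).exists
  exact ⟨_, ht⟩

theorem mem_closedCell_secVec (H : Arrangement I) (x u : ℝ × ℝ) : x ∈ H.ClosedCell (H.secVec x u) := by
  intro i
  unfold secVec
  split_ifs
  · exact ⟨Int.floor_le _, (Int.lt_floor_add_one _).le⟩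
  · push_cast
    exact ⟨by linarith [Int.ceil_lt_add_one (H.height i x)], by linarith [Int.le_ceil (H.height i x)]⟩

end Arrangement

namespace Arrangement

variable {I : Type*} (H : Arrangement I)

/-! ### Cells as connected components -/

theorem eq_of_mem_openCell {H : Arrangement I} {n m : I → ℤ} {x : ℝ × ℝ} (hn : x ∈ H.OpenCell n)
    (hm : x ∈ H.ClosedCell m) : n = m := by
  funext i
  obtain ⟨h1, h2⟩ := hn i
  obtain ⟨h3, h4⟩ := hm i
  have h5 : (n i : ℝ) < m i + 1 := by linarith
  have h6 : (m i : ℝ) < n i + 1 := by linarith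
  have h7 : n i < m i + 1 := by exact_mod_cast h5
  have h8 : m i < n i + 1 := by exact_mod_cast h6
  omega

theorem openCell_subset_liftCompl (n : I → ℤ) : H.OpenCell n ⊆ H.liftCompl := by
  intro x hx
  rw [mem_liftCompl_iff]
  rintro i ⟨m, hm⟩
  obtain ⟨h1, h2⟩ := hx i
  rw [hm] at h1 h2
  have h3 : n i < m := by exact_mod_cast h1
  have h4 : m < n i + 1 := by exact_mod_cast h2
  omega

theorem not_on_of_mem_openCell {H : Arrangement I} {n : I → ℤ} {x : ℝ × ℝ} (hx : x ∈ H.OpenCell n) (i : I) :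
    ¬ H.On i x := H.mem_liftCompl_iff.1 (H.openCell_subset_liftCompl n hx) i

/-- The integer parts of the heights of a point. -/
noncomputable def low (x : ℝ × ℝ) (i : I) : ℤ := ⌊H.height i x⌋

theorem mem_closedCell_low (x : ℝ × ℝ) : x ∈ H.ClosedCell (H.low x) := fun _ =>
  ⟨Int.floor_le _, (Int.lt_floor_add_one _).le⟩

theorem mem_openCell_low {x : ℝ × ℝ} (hx : x ∈ H.liftCompl) : x ∈ H.OpenCell (H.low x) := by
  rw [mem_liftCompl_iff] at hx
  exact fun i => ⟨lt_of_le_of_ne (Int.floor_le _) fun h => hx i ⟨_, h.symm⟩, Int.lt_floor_add_one _⟩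

variable {H}

theorem connectedComponentIn_liftCompl [Finite I] {n : I → ℤ} {x : ℝ × ℝ} (hx : x ∈ H.OpenCell n) :
    connectedComponentIn H.liftCompl x = H.OpenCell n := by
  apply Set.Subset.antisymm
  · refine isPreconnected_connectedComponentIn.subset_left_of_subset_union (H.isOpen_openCell n)
      (v := ⋃ m : {m // m ≠ n}, H.OpenCell m.1) (isOpen_iUnion fun m => H.isOpen_openCell _) ?_ ?_ ?_
    · rw [Set.disjoint_left]
      intro y hy hy'
      obtain ⟨⟨m, hm⟩, h⟩ := Set.mem_iUnion.1 hy'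
      exact hm (eq_of_mem_openCell h (H.openCell_subset_closedCell _ hy))
    · intro y hy
      have := H.mem_openCell_low (connectedComponentIn_subset _ _ hy)
      by_cases h : H.low y = n
      · rw [h] at this; exact Or.inl this
      · exact Or.inr (Set.mem_iUnion.2 ⟨⟨_, h⟩, this⟩)
    · exact ⟨x, mem_connectedComponentIn (H.openCell_subset_liftCompl n hx), hx⟩
  · exact (H.convex_openCell n).isPreconnected.subset_connectedComponentIn hx
      (H.openCell_subset_liftCompl n)

theorem connectedComponentIn_compl [Finite I] {n : I → ℤ} {x : ℝ × ℝ} (hx : x ∈ H.OpenCell n) :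
    connectedComponentIn H.compl (torusProj x) = torusProj '' H.OpenCell n := by
  have hsub : torusProj '' H.OpenCell n ⊆ H.compl := by
    rintro _ ⟨y, hy, rfl⟩
    exact H.openCell_subset_liftCompl n hy
  have ho : ∀ m, IsOpen (torusProj '' H.OpenCell m) := fun m =>
    isOpenQuotientMap_torusProj.isOpenMap _ (H.isOpen_openCell m)
  apply Set.Subset.antisymm
  · refine isPreconnected_connectedComponentIn.subset_left_of_subset_union (ho n)
      (v := ⋃ m : {m // ∀ d, m ≠ n + H.deck d}, torusProj '' H.OpenCell m.1)
      (isOpen_iUnion fun m => ho _) ?_ ?_ ?_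
    · rw [Set.disjoint_left]
      rintro _ ⟨y, hy, rfl⟩ hy'
      obtain ⟨⟨m, hm⟩, z, hz, h⟩ := Set.mem_iUnion.1 hy'
      obtain ⟨d, rfl⟩ := torusProj_eq_iff.1 h.symm
      exact hm d (eq_of_mem_openCell hz (H.openCell_subset_closedCell _
        (H.mem_openCell_add_deckVec.2 hy)))
    · intro p hp
      obtain ⟨y, rfl⟩ := torusProj_surjective p
      have hy := H.mem_openCell_low (show y ∈ H.liftCompl from connectedComponentIn_subset H.compl _ hp)
      by_cases h : ∀ d, H.low y ≠ n + H.deck d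
      · exact Or.inr (Set.mem_iUnion.2 ⟨⟨_, h⟩, y, hy, rfl⟩)
      · push Not at h
        obtain ⟨d, hd⟩ := h
        rw [hd, openCell_add_deck] at hy
        obtain ⟨z, hz, rfl⟩ := hy
        exact Or.inl ⟨z, hz, (torusProj_add_deckVec z d).symm⟩
    · exact ⟨torusProj x, mem_connectedComponentIn (hsub ⟨x, hx, rfl⟩), x, hx, rfl⟩
  · exact ((H.convex_openCell n).isPreconnected.image _
      continuous_torusProj.continuousOn).subset_connectedComponentIn ⟨x, hx, rfl⟩ hsub

variable (H)

/-- The cell with vector `n` in the plane lies over the cell `P` of the torus. -/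
def Over (n : I → ℤ) (P : H.Cell) : Prop := H.IsCellVec n ∧ P.1 = torusProj '' H.OpenCell n

variable {H}

theorem Over.add_deck {n : I → ℤ} {P : H.Cell} (h : H.Over n P) (d : ℤ × ℤ) :
    H.Over (n + H.deck d) P := by
  refine ⟨h.1.add_deck d, ?_⟩
  rw [h.2, openCell_add_deck, Set.image_image]
  simp

theorem Over.eq {n : I → ℤ} {P Q : H.Cell} (h : H.Over n P) (h' : H.Over n Q) : P = Q :=
  Subtype.ext (h.2.trans h'.2.symm)

theorem Over.exists_deck {n m : I → ℤ} {P : H.Cell} (h : H.Over n P) (h' : H.Over m P) :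
    ∃ d, m = n + H.deck d := by
  obtain ⟨x, hx⟩ := h'.1
  have : torusProj x ∈ torusProj '' H.OpenCell n := by
    rw [← h.2, h'.2]; exact ⟨x, hx, rfl⟩
  obtain ⟨y, hy, hyx⟩ := this
  obtain ⟨d, rfl⟩ := torusProj_eq_iff.1 hyx
  exact ⟨d, eq_of_mem_openCell hx (H.openCell_subset_closedCell _ (H.mem_openCell_add_deckVec.2 hy))⟩

theorem exists_over [Finite I] (P : H.Cell) : ∃ n, H.Over n P := by
  obtain ⟨P, θ, hθ, rfl⟩ := P
  obtain ⟨x, rfl⟩ := torusProj_surjective θ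
  have hx := H.mem_openCell_low (x := x) hθ
  exact ⟨H.low x, ⟨x, hx⟩, connectedComponentIn_compl hx⟩

theorem exists_cell_over [Finite I] {n : I → ℤ} (h : H.IsCellVec n) : ∃ P, H.Over n P := by
  obtain ⟨x, hx⟩ := h
  exact ⟨⟨torusProj '' H.OpenCell n, torusProj x, H.openCell_subset_liftCompl n hx,
    (connectedComponentIn_compl hx).symm⟩, ⟨x, hx⟩, rfl⟩

theorem isLiftOf_iff [Finite I] {R : Set (ℝ × ℝ)} {P : H.Cell} :
    H.IsLiftOf R P ↔ ∃ n, H.Over n P ∧ R = H.OpenCell n := by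
  constructor
  · rintro ⟨⟨x, hx, rfl⟩, h⟩
    have hx := H.mem_openCell_low hx
    rw [connectedComponentIn_liftCompl hx] at h ⊢
    exact ⟨_, ⟨⟨x, hx⟩, h.symm⟩, rfl⟩
  · rintro ⟨n, ⟨⟨x, hx⟩, h⟩, rfl⟩
    exact ⟨⟨x, H.openCell_subset_liftCompl n hx, (connectedComponentIn_liftCompl hx).symm⟩, h.symm⟩

theorem openCell_injective {n m : I → ℤ} (h : H.IsCellVec n) (h' : H.OpenCell n = H.OpenCell m) :
    n = m := by
  obtain ⟨x, hx⟩ := h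
  exact eq_of_mem_openCell hx (H.openCell_subset_closedCell _ (h' ▸ hx))

theorem sector_eq [Finite I] {x u : ℝ × ℝ} (h : ∀ i, H.On i x → H.slope i u ≠ 0) :
    H.sector (torusProj x) u = torusProj '' H.OpenCell (H.secVec x u) := by
  ext q
  have : ∀ᶠ t : ℝ in 𝓝[>] 0, (q ∈ connectedComponentIn H.compl (torusProj x + torusProj (t • u)) ↔
      q ∈ torusProj '' H.OpenCell (H.secVec x u)) := by
    filter_upwards [H.eventually_mem_openCell h] with t ht
    rw [← torusProj_add, connectedComponentIn_compl ht]
  rw [sector, Set.mem_ofPred_eq, eventually_congr this, eventually_const]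

theorem liftSector_eq [Finite I] {x u : ℝ × ℝ} (h : ∀ i, H.On i x → H.slope i u ≠ 0) :
    H.liftSector x u = H.OpenCell (H.secVec x u) := by
  ext q
  have : ∀ᶠ t : ℝ in 𝓝[>] 0, (q ∈ connectedComponentIn H.liftCompl (x + t • u) ↔
      q ∈ H.OpenCell (H.secVec x u)) := by
    filter_upwards [H.eventually_mem_openCell h] with t ht
    rw [connectedComponentIn_liftCompl ht]
  rw [liftSector, Set.mem_ofPred_eq, eventually_congr this, eventually_const]

theorem over_secVec [Finite I] (hG : H.IsGeneric) {x u : ℝ × ℝ}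
    (h : ∀ i, H.On i x → H.slope i u ≠ 0) {P : H.Cell} :
    P.1 = H.sector (torusProj x) u ↔ H.Over (H.secVec x u) P := by
  rw [sector_eq h, Over, and_iff_right (isCellVec_of_mem_closedCell hG (H.mem_closedCell_secVec x u))]

/-! ### The index of a cell in the plane -/

variable (H) in
open Classical in
/-- The index of a cell in the plane. -/
noncomputable def idx [Finite I] (ι : H.Cell → ℤ) (n : I → ℤ) : ℤ :=
  if h : H.IsCellVec n then ι (exists_cell_over h).choose else 0

theorem Over.idx_eq [Finite I] {ι : H.Cell → ℤ} {n : I → ℤ} {P : H.Cell} (h : H.Over n P) :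
    H.idx ι n = ι P := by
  rw [idx, dif_pos h.1, (exists_cell_over h.1).choose_spec.eq h]

theorem isCellVec_of_idx_ne_zero [Finite I] {ι : H.Cell → ℤ} {n : I → ℤ} (h : H.idx ι n ≠ 0) :
    H.IsCellVec n := by
  by_contra h'
  exact h (dif_neg h')

theorem isCellVec_add_deck_iff {n : I → ℤ} {d : ℤ × ℤ} :
    H.IsCellVec (n + H.deck d) ↔ H.IsCellVec n := by
  rw [IsCellVec, openCell_add_deck, Set.image_nonempty, IsCellVec]

theorem idx_add_deck [Finite I] (ι : H.Cell → ℤ) (n : I → ℤ) (d : ℤ × ℤ) :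
    H.idx ι (n + H.deck d) = H.idx ι n := by
  by_cases h : H.IsCellVec n
  · obtain ⟨P, hP⟩ := exists_cell_over h
    rw [hP.idx_eq, (hP.add_deck d).idx_eq]
  · rw [idx, idx, dif_neg h, dif_neg (by rwa [isCellVec_add_deck_iff])]

variable (H) in
/-- The point at which the segment from `y` to `z` crosses the line through a side of a cell. -/
noncomputable def crossPt (n : I → ℤ) (k : I × Bool) (y z : ℝ × ℝ) : ℝ × ℝ :=
  y + (H.gap n k y / (H.gap n k y - H.gap n k z)) • (z - y)

theorem gap_neg_of_mem_step {n : I → ℤ} {k : I × Bool} {z : ℝ × ℝ}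
    (hz : z ∈ H.OpenCell (step n k)) : H.gap n k z < 0 := by
  have := H.mem_openCell_iff.1 hz (rev k)
  rw [gap_step_rev] at this
  linarith

theorem gap_crossPt {n : I → ℤ} {k : I × Bool} {y z : ℝ × ℝ} (hy : y ∈ H.OpenCell n)
    (hz : z ∈ H.OpenCell (step n k)) : H.gap n k (H.crossPt n k y z) = 0 := by
  have h1 := H.mem_openCell_iff.1 hy k
  have h2 := gap_neg_of_mem_step hz
  rw [crossPt, gap_add_smul_sub]
  have : H.gap n k y - H.gap n k z ≠ 0 := by linarith
  field_simp; ring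

theorem gap_crossPt_pos {n : I → ℤ} {k : I × Bool} {y z : ℝ × ℝ} (hy : y ∈ H.OpenCell n)
    (hz : z ∈ H.OpenCell (step n k)) {k' : I × Bool} (hk : k' ≠ k) :
    0 < H.gap n k' (H.crossPt n k y z) := by
  by_cases h : k'.1 = k.1
  · have : k' = rev k := by
      rcases k with ⟨i, b⟩; rcases k' with ⟨j, c⟩
      simp only at h; subst h
      cases b <;> cases c <;> simp_all [rev]
    have h1 := H.gap_add_gap_rev n k (H.crossPt n k y z)
    rw [gap_crossPt hy hz, zero_add] at h1
    rw [this, h1]; norm_num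
  · have h1 := H.mem_openCell_iff.1 hy k
    have h2 := gap_neg_of_mem_step hz
    have h3 := H.mem_openCell_iff.1 hy k'
    have h4 := H.mem_openCell_iff.1 hz k'
    rw [gap_step_of_ne _ _ h] at h4
    have h5 : 0 < H.gap n k y - H.gap n k z := by linarith
    rw [crossPt, gap_add_smul_sub]
    have : H.gap n k' y + H.gap n k y / (H.gap n k y - H.gap n k z) * (H.gap n k' z - H.gap n k' y)
      = (H.gap n k y * H.gap n k' z + (- H.gap n k z) * H.gap n k' y) /
        (H.gap n k y - H.gap n k z) := by
      field_simp; ring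
    rw [this]
    have : 0 < -H.gap n k z := by linarith
    positivity

theorem idx_step [Finite I] (hG : H.IsGeneric) {ι : H.Cell → ℤ} (hι : H.IsIndexMap ι) {n : I → ℤ}
    {k : I × Bool} (hn : H.IsCellVec n) (hk : H.IsCellVec (step n k)) :
    H.idx ι (step n k) = H.idx ι n - sg k.2 := by
  obtain ⟨y, hy⟩ := hn
  obtain ⟨z, hz⟩ := hk
  set m := H.crossPt n k y z with hm
  have hm0 : H.gap n k m = 0 := gap_crossPt hy hz
  have hm1 : ∀ k', k' ≠ k → 0 < H.gap n k' m := fun k' h => gap_crossPt_pos hy hz h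
  have hmem : m ∈ H.ClosedCell n := by
    rw [mem_closedCell_iff]
    intro k'
    by_cases h : k' = k
    · rw [h, hm0]
    · exact (hm1 k' h).le
  have hon : ∀ j, j ≠ k.1 → ¬ H.On j m := by
    intro j hj hoj
    obtain ⟨b, hb⟩ := H.exists_gap_eq_zero hmem hoj
    exact (hm1 (j, b) (by rintro rfl; exact hj rfl)).ne' hb
  have hon' : H.On k.1 m := H.on_of_gap_eq_zero hm0
  obtain ⟨ℓ, hℓ⟩ := exists_slope_eq hG m (fun _ => -1)
  have hℓ1 : H.slope k.1 ℓ = -1 := hℓ _ hon'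
  have hℓ2 : H.slope k.1 (-ℓ) = 1 := by rw [slope_neg, hℓ1]; norm_num
  have ht : ∀ i, H.On i m → H.slope i ℓ ≠ 0 := fun i hi => by rw [hℓ i hi]; norm_num
  have ht' : ∀ i, H.On i m → H.slope i (-ℓ) ≠ 0 := fun i hi => by
    rw [slope_neg, hℓ i hi]; norm_num
  have hc : 0 < cross ℓ (H k.1).tangent := by
    rw [cross_swap, neg_pos, ← slope_neg_iff, hℓ1]; norm_num
  obtain ⟨P, hP⟩ := exists_cell_over (isCellVec_of_mem_closedCell hG (H.mem_closedCell_secVec m (-ℓ)))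
  obtain ⟨Q, hQ⟩ := exists_cell_over (isCellVec_of_mem_closedCell hG (H.mem_closedCell_secVec m ℓ))
  have hcr := hι k.1 (torusProj m) (H.mem_carrier_iff.2 hon')
    (fun j hj h => hon j hj (H.mem_carrier_iff.1 h)) ℓ hc P Q ((over_secVec hG ht').2 hP)
    ((over_secVec hG ht).2 hQ)
  rw [← hP.idx_eq (ι := ι), ← hQ.idx_eq (ι := ι)] at hcr
  have hoff : ∀ (u : ℝ × ℝ) j, j ≠ k.1 → H.secVec m u j = n j := by
    intro u j hj
    have h1 := hm1 (j, true) (by rintro rfl; exact hj rfl)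
    have h2 := hm1 (j, false) (by rintro rfl; exact hj rfl)
    simp only [gap, if_true, Bool.false_eq_true, if_false] at h1 h2
    have h6 : ⌊H.height j m⌋ = n j := Int.floor_eq_iff.2 ⟨by linarith, by linarith⟩
    have h7 : ⌈H.height j m⌉ = n j + 1 :=
      Int.ceil_eq_iff.2 ⟨by push_cast; linarith, by push_cast; linarith⟩
    simp [secVec, h6, h7]
  have hsame : ∀ u : ℝ × ℝ, (H.secVec m u k.1 = n k.1 → H.secVec m u = n) ∧
      (H.secVec m u k.1 = n k.1 + sg k.2 → H.secVec m u = step n k) := by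
    intro u
    constructor
    · intro h
      funext j
      by_cases hj : j = k.1
      · rw [hj, h]
      · exact hoff u j hj
    · intro h
      funext j
      by_cases hj : j = k.1
      · rw [hj, h, step_same]
      · rw [hoff u j hj, step_of_ne _ _ hj]
  rcases k with ⟨i, b⟩
  cases b
  · have hh : H.height i m = n i := by simp [gap] at hm0; linarith
    have e1 := (hsame (-ℓ)).1 (by simp only [secVec]; rw [if_pos (by rw [hℓ2]; norm_num), hh]; simp)
    have e2 := (hsame ℓ).2 (by
      simp only [secVec]; rw [if_neg (by rw [hℓ1]; norm_num), hh]; simp [sg]; ring)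
    rw [e1, e2] at hcr
    rw [hcr]; simp [sg]
  · have hh : H.height i m = (n i + 1 : ℤ) := by simp [gap] at hm0; push_cast; linarith
    have e1 := (hsame (-ℓ)).2 (by
      simp only [secVec]; rw [if_pos (by rw [hℓ2]; norm_num), hh]; simp [sg])
    have e2 := (hsame ℓ).1 (by
      simp only [secVec]; rw [if_neg (by rw [hℓ1]; norm_num), hh, Int.ceil_intCast]; ring)
    rw [e1, e2] at hcr
    simp [sg]; omega

/-- Two closed cells with a common point are equal, adjacent, or opposite at a crossing. -/
theorem closedCell_cases (hG : H.IsGeneric) {n m : I → ℤ} {x : ℝ × ℝ} (hn : x ∈ H.ClosedCell n)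
    (hm : x ∈ H.ClosedCell m) : n = m ∨ (∃ k, m = step n k ∧ H.gap n k x = 0) ∨
      ∃ k k', k.1 ≠ k'.1 ∧ H.gap n k x = 0 ∧ H.gap n k' x = 0 ∧ m = step (step n k) k' := by
  have hd : ∀ i, n i ≠ m i → ∃ b, H.gap n (i, b) x = 0 ∧ m i = n i + sg b := by
    intro i hi
    obtain ⟨h1, h2⟩ := hn i
    obtain ⟨h3, h4⟩ := hm i
    have h5 : (n i : ℝ) ≤ m i + 1 := by linarith
    have h6 : (m i : ℝ) ≤ n i + 1 := by linarith
    have h7 : n i ≤ m i + 1 := by exact_mod_cast h5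
    have h8 : m i ≤ n i + 1 := by exact_mod_cast h6
    rcases lt_or_gt_of_ne hi with h | h
    · have e : m i = n i + 1 := by omega
      refine ⟨true, ?_, by simp [sg, e]⟩
      rw [e] at h3; push_cast at h3
      simp only [gap, if_true]; linarith
    · have e : m i = n i - 1 := by omega
      refine ⟨false, ?_, by simp [sg, e]; ring⟩
      rw [e] at h4; push_cast at h4
      simp [gap]; linarith
  by_cases h0 : n = m
  · exact Or.inl h0
  right
  obtain ⟨i, hi⟩ := Function.ne_iff.1 h0
  obtain ⟨b, hb, hbm⟩ := hd i hi
  by_cases h1 : ∀ j, j ≠ i → n j = m j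
  · refine Or.inl ⟨(i, b), ?_, hb⟩
    funext j
    by_cases hj : j = i
    · subst hj; rw [hbm]; exact (step_same n (j, b)).symm
    · rw [step_of_ne n (i, b) hj, h1 j hj]
  · push Not at h1
    obtain ⟨j, hji, hj⟩ := h1
    obtain ⟨c, hc, hcm⟩ := hd j hj
    refine Or.inr ⟨(i, b), (j, c), hji.symm, hb, hc, ?_⟩
    funext l
    by_cases hl : l = j
    · subst hl
      rw [step_same (step n (i, b)) (l, c), step_of_ne n (i, b) hji, hcm]
    rw [step_of_ne _ (j, c) hl]
    by_cases hl' : l = i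
    · subst hl'; rw [hbm]; exact (step_same n (l, b)).symm
    rw [step_of_ne n (i, b) hl']
    by_contra h
    obtain ⟨d, hd, -⟩ := hd l (Ne.symm h)
    rcases eq_of_on_three hG.simple (H.on_of_gap_eq_zero hb) (H.on_of_gap_eq_zero hc)
      (H.on_of_gap_eq_zero hd) with h | h | h
    · exact hji h.symm
    · exact hl h.symm
    · exact hl' h.symm

variable (H) in
/-- A generic arrangement with an index map with values between `-2` and `2`. -/
structure IsTame (ι : H.Cell → ℤ) : Prop where
  gen : H.IsGeneric
  index : H.IsIndexMap ι
  abs_le : ∀ P, |ι P| ≤ 2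

section Tame

variable [Finite I] {ι : H.Cell → ℤ} (hT : H.IsTame ι)
include hT

theorem IsTame.abs_idx_le (n : I → ℤ) : |H.idx ι n| ≤ 2 := by
  by_cases h : H.IsCellVec n
  · obtain ⟨P, hP⟩ := exists_cell_over h
    rw [hP.idx_eq]; exact hT.abs_le P
  · rw [idx, dif_neg h]; norm_num

theorem IsTame.isCellVec {n : I → ℤ} {x : ℝ × ℝ} (hx : x ∈ H.ClosedCell n) : H.IsCellVec n :=
  isCellVec_of_mem_closedCell hT.gen hx

theorem IsTame.idx_step {n : I → ℤ} {x : ℝ × ℝ} {k : I × Bool} (hx : x ∈ H.ClosedCell n)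
    (h : H.gap n k x = 0) : H.idx ι (step n k) = H.idx ι n - sg k.2 :=
  Arrangement.idx_step hT.gen hT.index (hT.isCellVec hx) (hT.isCellVec (H.mem_closedCell_step hx h))

theorem IsTame.idx_step_step {n : I → ℤ} {x : ℝ × ℝ} {k k' : I × Bool} (hkk : k.1 ≠ k'.1)
    (hx : x ∈ H.ClosedCell n) (h : H.gap n k x = 0) (h' : H.gap n k' x = 0) :
    H.idx ι (step (step n k) k') = H.idx ι n - sg k.2 - sg k'.2 := by
  rw [hT.idx_step (H.mem_closedCell_step hx h) (by rwa [gap_step_of_ne _ _ hkk.symm]),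
    hT.idx_step hx h]

end Tame

theorem sg_eq (b : Bool) : sg b = 1 ∨ sg b = -1 := by cases b <;> simp [sg]

theorem abs_cases_of_le_two {a : ℤ} (h : |a| ≤ 2) : a = -2 ∨ a = -1 ∨ a = 0 ∨ a = 1 ∨ a = 2 := by
  rw [abs_le] at h; omega

section Tame

variable [Finite I] {ι : H.Cell → ℤ} (hT : H.IsTame ι)
include hT

/-- A closed cell of index `±1` and one of index `±2` with a common point are adjacent. -/
theorem IsTame.adjacent_of_one_two {n m : I → ℤ} {x : ℝ × ℝ} (hn : x ∈ H.ClosedCell n)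
    (hm : x ∈ H.ClosedCell m) (h1 : |H.idx ι n| = 1) (h2 : |H.idx ι m| = 2) :
    ∃ k, m = step n k ∧ H.gap n k x = 0 := by
  rcases closedCell_cases hT.gen hn hm with rfl | h | ⟨k, k', hkk, hk, hk', rfl⟩
  · omega
  · exact h
  · rw [hT.idx_step_step hkk hn hk hk'] at h2
    rcases sg_eq k.2 with h | h <;> rcases sg_eq k'.2 with h' | h' <;> rw [h, h'] at h2 <;>
      rw [abs_eq (by norm_num)] at h1 h2 <;> omega

theorem IsTame.opposite_of_one_one {n m : I → ℤ} {x : ℝ × ℝ} (hn : x ∈ H.ClosedCell n)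
    (hm : x ∈ H.ClosedCell m) (h1 : |H.idx ι n| = 1) (h2 : |H.idx ι m| = 1) (hne : n ≠ m) :
    ∃ k k', k.1 ≠ k'.1 ∧ H.gap n k x = 0 ∧ H.gap n k' x = 0 ∧ m = step (step n k) k' := by
  rcases closedCell_cases hT.gen hn hm with h | ⟨k, rfl, hk⟩ | h
  · exact absurd h hne
  · rw [hT.idx_step hn hk] at h2
    rcases sg_eq k.2 with h | h <;> rw [h] at h2 <;>
      rw [abs_eq (by norm_num)] at h1 h2 <;> omega
  · exact h

theorem IsTame.eq_of_two_two {n m : I → ℤ} {x : ℝ × ℝ} (hn : x ∈ H.ClosedCell n)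
    (hm : x ∈ H.ClosedCell m) (h1 : |H.idx ι n| = 2) (h2 : |H.idx ι m| = 2) : n = m := by
  rcases closedCell_cases hT.gen hn hm with h | ⟨k, rfl, hk⟩ | ⟨k, k', hkk, hk, hk', rfl⟩
  · exact h
  · rw [hT.idx_step hn hk] at h2
    rcases sg_eq k.2 with h | h <;> rw [h] at h2 <;>
      rw [abs_eq (by norm_num)] at h1 h2 <;> omega
  · have h3 := hT.abs_idx_le (step n k)
    have h4 := hT.abs_idx_le (step n k')
    rw [hT.idx_step_step hkk hn hk hk'] at h2
    rw [hT.idx_step hn hk, _root_.abs_le] at h3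
    rw [hT.idx_step hn hk', _root_.abs_le] at h4
    rcases sg_eq k.2 with h | h <;> rcases sg_eq k'.2 with h' | h' <;> rw [h, h'] at h2 <;>
      rw [h] at h3 <;> rw [h'] at h4 <;> rw [abs_eq (by norm_num)] at h1 h2 <;> omega

/-- Two sides of a cell of index `±1` which border cells of index `±2` do not meet. -/
theorem IsTame.eq_of_two_sides {n : I → ℤ} {x : ℝ × ℝ} {k k' : I × Bool} (hn : x ∈ H.ClosedCell n)
    (h1 : |H.idx ι n| = 1) (hk : H.gap n k x = 0) (hk' : H.gap n k' x = 0)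
    (h2 : |H.idx ι (step n k)| = 2) (h2' : |H.idx ι (step n k')| = 2) : k = k' := by
  by_contra hne
  have hkk : k.1 ≠ k'.1 := by
    intro h
    have : k' = rev k := by
      rcases k with ⟨i, b⟩; rcases k' with ⟨j, c⟩
      simp only at h; subst h
      cases b <;> cases c <;> simp_all [rev]
    have h3 := H.gap_add_gap_rev n k x
    rw [← this, hk, hk'] at h3; norm_num at h3
  have h3 := hT.abs_idx_le (step (step n k) k')
  rw [hT.idx_step_step hkk hn hk hk', _root_.abs_le] at h3
  rw [hT.idx_step hn hk] at h2
  rw [hT.idx_step hn hk'] at h2'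
  rcases sg_eq k.2 with h | h <;> rcases sg_eq k'.2 with h' | h' <;> rw [h, h'] at h3 <;>
    rw [h] at h2 <;> rw [h'] at h2' <;> rw [abs_eq (by norm_num)] at h1 h2 h2' <;> omega

/-- A neighbor of a cell of index `±1` has index `0` or `±2`. -/
theorem IsTame.idx_step_zero_or_two {n : I → ℤ} {x : ℝ × ℝ} {k : I × Bool}
    (hn : x ∈ H.ClosedCell n) (h1 : |H.idx ι n| = 1) (hk : H.gap n k x = 0) :
    H.idx ι (step n k) = 0 ∨ |H.idx ι (step n k)| = 2 := by
  rw [hT.idx_step hn hk]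
  rcases sg_eq k.2 with h | h <;> rw [h] <;> rw [abs_eq (by norm_num)] at * <;> omega

/-- All neighbors of a cell of index `±2` have index `±1`. -/
theorem IsTame.abs_idx_step_two {n : I → ℤ} {k : I × Bool} {x : ℝ × ℝ}
    (hn : x ∈ H.ClosedCell n) (h2 : |H.idx ι n| = 2) (hk : H.gap n k x = 0) :
    |H.idx ι (step n k)| = 1 ∧ H.idx ι n = 2 * sg k.2 := by
  have h3 := hT.abs_idx_le (step n k)
  rw [hT.idx_step hn hk, _root_.abs_le] at h3
  rw [hT.idx_step hn hk]
  rcases sg_eq k.2 with h | h <;> rw [h] at h3 ⊢ <;> rw [abs_eq (by norm_num)] at * <;> omega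

end Tame

end Arrangement

namespace Arrangement

variable {I : Type*} {H : Arrangement I}

/-! ### Closed cells are compact convex polygons -/

theorem isCompact_closedCell (hG : H.IsGeneric) (n : I → ℤ) : IsCompact (H.ClosedCell n) := by
  obtain ⟨i, j, hij⟩ := hG.spans
  obtain ⟨o, ho1, ho2⟩ := exists_slope_eq_pair hij (-H.height i 0) (-H.height j 0)
  obtain ⟨u, hu1, hu2⟩ := exists_slope_eq_pair hij 1 0
  obtain ⟨v, hv1, hv2⟩ := exists_slope_eq_pair hij 0 1
  have key : ∀ x, x = o + (H.height i x • u + H.height j x • v) := by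
    intro x
    rw [← sub_eq_zero]
    apply eq_zero_of_slope_eq_zero hij
    · have := H.slope_vsub i x 0
      simp only [slope_sub, slope_add, slope_smul, ho1, hu1, hv1] at *
      have h0 : H.slope i 0 = 0 := by simp [slope, cross]
      linarith
    · have := H.slope_vsub j x 0
      simp only [slope_sub, slope_add, slope_smul, ho2, hu2, hv2] at *
      have h0 : H.slope j 0 = 0 := by simp [slope, cross]
      linarith
  have hc : Continuous fun z : ℝ × ℝ => o + (z.1 • u + z.2 • v) := by fun_prop
  refine ((isCompact_Icc (a := (n i : ℝ)) (b := n i + 1)).prod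
    (isCompact_Icc (a := (n j : ℝ)) (b := n j + 1))).image hc |>.of_isClosed_subset
    (H.isClosed_closedCell n) ?_
  intro x hx
  exact ⟨(H.height i x, H.height j x), ⟨hx i, hx j⟩, (key x).symm⟩

theorem closure_openCell {n : I → ℤ} (hn : H.IsCellVec n) :
    closure (H.OpenCell n) = H.ClosedCell n := by
  apply Set.Subset.antisymm
  · exact closure_minimal (H.openCell_subset_closedCell n) (H.isClosed_closedCell n)
  · intro x hx
    obtain ⟨y, hy⟩ := hn
    have hc : Tendsto (fun t : ℝ => x + t • (y - x)) (𝓝[>] 0) (𝓝 x) := by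
      have : Continuous (fun t : ℝ => x + t • (y - x)) := by fun_prop
      have := this.tendsto 0
      simp only [zero_smul, add_zero] at this
      exact this.mono_left nhdsWithin_le_nhds
    refine mem_closure_of_tendsto hc ?_
    have : Set.Ioo (0 : ℝ) 1 ∈ 𝓝[>] (0 : ℝ) := Ioo_mem_nhdsGT one_pos
    filter_upwards [this] with t ht
    rw [mem_openCell_iff] at *
    rw [mem_closedCell_iff] at hx
    intro k
    rw [gap_add_smul_sub]
    nlinarith [hx k, hy k, ht.1, ht.2, mul_pos ht.1 (hy k), mul_nonneg (sub_nonneg.2 ht.2.le) (hx k)]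

/-! ### Centers of mass -/

variable (H) in
/-- The center of mass of a cell in the plane. -/
noncomputable def ctr (n : I → ℤ) : ℝ × ℝ := centerOfMass (H.OpenCell n)

section Center

theorem integrableOn_openCell (hG : H.IsGeneric) (n : I → ℤ) {E : Type*} [NormedAddCommGroup E]
    {f : ℝ × ℝ → E} (hf : Continuous f) :
    IntegrableOn f (H.OpenCell n) :=
  (hf.continuousOn.integrableOn_compact (isCompact_closedCell hG n)).mono_set
    (H.openCell_subset_closedCell n)

theorem volume_openCell_ne_top (hG : H.IsGeneric) (n : I → ℤ) : volume (H.OpenCell n) ≠ ⊤ :=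
  ((measure_mono (H.openCell_subset_closedCell n)).trans_lt
    (isCompact_closedCell hG n).measure_lt_top).ne

variable [Finite I]

theorem volume_openCell_ne_zero {n : I → ℤ} (hn : H.IsCellVec n) : volume (H.OpenCell n) ≠ 0 :=
  ((H.isOpen_openCell n).measure_pos volume hn).ne'

omit [Finite I] in
theorem slope_ctr (hG : H.IsGeneric) (n : I → ℤ) (i : I) :
    H.slope i (H.ctr n) = ⨍ x in H.OpenCell n, H.slope i x := by
  let L : ℝ × ℝ →L[ℝ] ℝ := (1 / (2 * Real.pi)) •
    ((H i).tangent.1 • ContinuousLinearMap.snd ℝ ℝ ℝ - (H i).tangent.2 • ContinuousLinearMap.fst ℝ ℝ ℝ)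
  have hL : ∀ x, H.slope i x = L x := by
    intro x
    simp [L, slope, cross]; ring
  simp only [hL, ctr, centerOfMass, setAverage_eq]
  rw [map_smul, ← L.integral_comp_comm (φ := fun x => x)
    (integrableOn_openCell hG n continuous_id)]

theorem ctr_mem (hG : H.IsGeneric) {n : I → ℤ} (hn : H.IsCellVec n) : H.ctr n ∈ H.OpenCell n := by
  intro i
  have h0 := volume_openCell_ne_zero hn
  have h1 := volume_openCell_ne_top hG n
  have h2 := integrableOn_openCell hG n (H.continuous_slope i)
  obtain ⟨x, hx, hx'⟩ := exists_le_setAverage h0 h1 h2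
  obtain ⟨y, hy, hy'⟩ := exists_setAverage_le h0 h1 h2
  rw [← slope_ctr hG] at hx' hy'
  have hx := (hx i).1
  have hy := (hy i).2
  simp only [height] at *
  constructor <;> linarith

theorem ctr_add_deck (hG : H.IsGeneric) {n : I → ℤ} (hn : H.IsCellVec n) (d : ℤ × ℤ) :
    H.ctr (n + H.deck d) = H.ctr n + deckVec d := by
  have h0 := volume_openCell_ne_zero hn
  have h1 := volume_openCell_ne_top hG n
  have hmp := measurePreserving_add_right (volume : Measure (ℝ × ℝ)) (deckVec d)
  have hme := (MeasurableEquiv.addRight (deckVec d)).measurableEmbedding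
  have hv : volume ((· + deckVec d) '' H.OpenCell n) = volume (H.OpenCell n) := by
    have := hmp.measure_preimage_emb hme ((· + deckVec d) '' H.OpenCell n)
    rw [← this, Set.preimage_image_eq _ (add_left_injective _)]
  have hi := hmp.setIntegral_image_emb hme (fun x => x) (H.OpenCell n)
  rw [ctr, ctr, centerOfMass, centerOfMass, openCell_add_deck, setAverage_eq, setAverage_eq,
    hi, Measure.real, Measure.real, hv, integral_add (f := fun x => x) (integrableOn_openCell hG n continuous_id)
    (integrableOn_openCell hG n continuous_const), setIntegral_const, smul_add, smul_smul,
    Measure.real, inv_mul_cancel₀ (ENNReal.toReal_ne_zero.2 ⟨h0, h1⟩), one_smul]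

end Center

/-! ### Gates and normalized gaps -/

section Gate
variable (H)

/-- The point at which the segment between the centers of mass of two adjacent cells crosses their
common side. -/
noncomputable def gate (n : I → ℤ) (k : I × Bool) : ℝ × ℝ :=
  H.crossPt n k (H.ctr n) (H.ctr (step n k))

/-- The gap normalized to be one at the center of mass. -/
noncomputable def ngap (n : I → ℤ) (k : I × Bool) (x : ℝ × ℝ) : ℝ :=
  H.gap n k x / H.gap n k (H.ctr n)

open Classical in
/-- The function supported on the cone over a side of a cell that is linear on rays from the center of
mass and whose restriction to the side is linear on both sides of the gate, where it is one. -/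
noncomputable def bump [Fintype I] (n : I → ℤ) (k : I × Bool) (x : ℝ × ℝ) : ℝ :=
  max 0 ((Finset.univ.erase k).inf' ⟨rev k, by simp [rev_ne]⟩ fun k' =>
    (H.ngap n k' x - H.ngap n k x) / H.ngap n k' (H.gate n k))

variable {H}

theorem bump_nonneg [Fintype I] (n : I → ℤ) (k : I × Bool) (x : ℝ × ℝ) : 0 ≤ H.bump n k x :=
  le_max_left _ _

theorem continuous_ngap (n : I → ℤ) (k : I × Bool) : Continuous (H.ngap n k) :=
  (H.continuous_gap n k).div_const _

theorem continuous_bump [Fintype I] (n : I → ℤ) (k : I × Bool) : Continuous (H.bump n k) := by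
  unfold bump
  refine continuous_const.max (Continuous.finset_inf'_apply _ fun k' _ => ?_)
  exact ((continuous_ngap n k').sub (continuous_ngap n k)).div_const _

theorem ngap_add_smul_sub (n : I → ℤ) (k : I × Bool) (x y z : ℝ × ℝ) (t : ℝ) :
    H.ngap n k (x + t • (y - z)) = H.ngap n k x + t * (H.ngap n k y - H.ngap n k z) := by
  rw [ngap, gap_add_smul_sub, ngap, ngap, ngap]; ring

theorem isCellVec_step_add_deck {n : I → ℤ} {k : I × Bool} {d : ℤ × ℤ}
    (hk : H.IsCellVec (step n k)) : H.IsCellVec (step (n + H.deck d) k) := by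
  rw [step_add]; exact hk.add_deck d

variable [Finite I] (hG : H.IsGeneric)
include hG

theorem gap_ctr_pos {n : I → ℤ} (hn : H.IsCellVec n) (k : I × Bool) : 0 < H.gap n k (H.ctr n) :=
  H.mem_openCell_iff.1 (ctr_mem hG hn) k

theorem ngap_ctr {n : I → ℤ} (hn : H.IsCellVec n) (k : I × Bool) : H.ngap n k (H.ctr n) = 1 :=
  div_self (gap_ctr_pos hG hn k).ne'

theorem ngap_nonneg_iff {n : I → ℤ} (hn : H.IsCellVec n) {k : I × Bool} {x : ℝ × ℝ} :
    0 ≤ H.ngap n k x ↔ 0 ≤ H.gap n k x := by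
  rw [ngap, le_div_iff₀ (gap_ctr_pos hG hn k), zero_mul]

theorem ngap_pos_iff {n : I → ℤ} (hn : H.IsCellVec n) {k : I × Bool} {x : ℝ × ℝ} :
    0 < H.ngap n k x ↔ 0 < H.gap n k x := by
  rw [ngap, lt_div_iff₀ (gap_ctr_pos hG hn k), zero_mul]

theorem ngap_eq_zero_iff {n : I → ℤ} (hn : H.IsCellVec n) {k : I × Bool} {x : ℝ × ℝ} :
    H.ngap n k x = 0 ↔ H.gap n k x = 0 := by
  rw [ngap, div_eq_zero_iff, or_iff_left (gap_ctr_pos hG hn k).ne']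

theorem mem_closedCell_iff_ngap {n : I → ℤ} (hn : H.IsCellVec n) {x : ℝ × ℝ} :
    x ∈ H.ClosedCell n ↔ ∀ k, 0 ≤ H.ngap n k x := by
  simp only [mem_closedCell_iff, ngap_nonneg_iff hG hn]

theorem gap_gate {n : I → ℤ} {k : I × Bool} (hn : H.IsCellVec n) (hk : H.IsCellVec (step n k)) :
    H.gap n k (H.gate n k) = 0 := gap_crossPt (ctr_mem hG hn) (ctr_mem hG hk)

theorem gap_gate_pos {n : I → ℤ} {k k' : I × Bool} (hn : H.IsCellVec n)
    (hk : H.IsCellVec (step n k)) (h : k' ≠ k) : 0 < H.gap n k' (H.gate n k) :=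
  gap_crossPt_pos (ctr_mem hG hn) (ctr_mem hG hk) h

theorem gate_mem {n : I → ℤ} {k : I × Bool} (hn : H.IsCellVec n) (hk : H.IsCellVec (step n k)) :
    H.gate n k ∈ H.ClosedCell n := by
  rw [mem_closedCell_iff]
  intro k'
  by_cases h : k' = k
  · rw [h, gap_gate hG hn hk]
  · exact (gap_gate_pos hG hn hk h).le

theorem on_gate_iff {n : I → ℤ} {k : I × Bool} (hn : H.IsCellVec n) (hk : H.IsCellVec (step n k))
    {i : I} : H.On i (H.gate n k) ↔ i = k.1 := by
  constructor
  · intro h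
    by_contra hi
    obtain ⟨b, hb⟩ := H.exists_gap_eq_zero (gate_mem hG hn hk) h
    exact (gap_gate_pos hG hn hk (k' := (i, b)) (by rintro rfl; exact hi rfl)).ne' hb
  · rintro rfl
    exact H.on_of_gap_eq_zero (gap_gate hG hn hk)

theorem gap_ctr_step_neg {n : I → ℤ} {k : I × Bool} (hk : H.IsCellVec (step n k)) :
    H.gap n k (H.ctr (step n k)) < 0 := gap_neg_of_mem_step (ctr_mem hG hk)

theorem gate_step_rev {n : I → ℤ} {k : I × Bool} (hn : H.IsCellVec n)
    (hk : H.IsCellVec (step n k)) : H.gate (step n k) (rev k) = H.gate n k := by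
  have h1 := gap_ctr_pos hG hn k
  have h2 := gap_ctr_step_neg hG hk
  simp only [gate, crossPt, step_step_rev, gap_step_rev]
  have h3 : H.gap n k (H.ctr n) - H.gap n k (H.ctr (step n k)) ≠ 0 := by linarith
  have h4 : -H.gap n k (H.ctr (step n k)) / (-H.gap n k (H.ctr (step n k)) - -H.gap n k (H.ctr n))
    = 1 - H.gap n k (H.ctr n) / (H.gap n k (H.ctr n) - H.gap n k (H.ctr (step n k))) := by
    have h5 : -H.gap n k (H.ctr (step n k)) - -H.gap n k (H.ctr n) ≠ 0 := by linarith
    field_simp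
    ring
  rw [h4]
  module

theorem gate_mem_segment {n : I → ℤ} {k : I × Bool} (hn : H.IsCellVec n)
    (hk : H.IsCellVec (step n k)) :
    H.gate n k ∈ segment ℝ (H.ctr n) (H.ctr (step n k)) := by
  have h1 := gap_ctr_pos hG hn k
  have h2 := gap_ctr_step_neg hG hk
  rw [segment_eq_image']
  refine ⟨_, ⟨?_, ?_⟩, rfl⟩
  · apply div_nonneg <;> linarith
  · rw [div_le_one] <;> linarith

theorem gate_add_deck {n : I → ℤ} {k : I × Bool} (hn : H.IsCellVec n)
    (hk : H.IsCellVec (step n k)) (d : ℤ × ℤ) :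
    H.gate (n + H.deck d) k = H.gate n k + deckVec d := by
  simp only [gate, crossPt, step_add, ctr_add_deck hG hn, ctr_add_deck hG hk, gap_add_deckVec]
  module

theorem ngap_add_deck {n : I → ℤ} (hn : H.IsCellVec n) (k : I × Bool) (x : ℝ × ℝ) (d : ℤ × ℤ) :
    H.ngap (n + H.deck d) k (x + deckVec d) = H.ngap n k x := by
  simp only [ngap, ctr_add_deck hG hn, gap_add_deckVec]

theorem ngap_gate {n : I → ℤ} {k : I × Bool} (hn : H.IsCellVec n) (hk : H.IsCellVec (step n k)) :
    H.ngap n k (H.gate n k) = 0 := (ngap_eq_zero_iff hG hn).2 (gap_gate hG hn hk)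

theorem ngap_gate_pos {n : I → ℤ} {k k' : I × Bool} (hn : H.IsCellVec n)
    (hk : H.IsCellVec (step n k)) (h : k' ≠ k) : 0 < H.ngap n k' (H.gate n k) :=
  (ngap_pos_iff hG hn).2 (gap_gate_pos hG hn hk h)

/-- Radial projection from the center of mass to the boundary of a cell. -/
theorem exists_radial {n : I → ℤ} (hn : H.IsCellVec n) {x : ℝ × ℝ}
    (hne : x ≠ H.ctr n) {k : I × Bool} (hk : ∀ j, H.ngap n k x ≤ H.ngap n j x) :
    H.ngap n k x < 1 ∧ ∃ y ∈ H.ClosedCell n, H.gap n k y = 0 ∧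
      x = H.ctr n + (1 - H.ngap n k x) • (y - H.ctr n) ∧
      ∀ j, H.ngap n j x = H.ngap n k x → H.gap n j y = 0 := by
  have hlt : H.ngap n k x < 1 := by
    by_contra! h
    apply hne
    obtain ⟨i, j, hij⟩ := hG.spans
    have hge : ∀ l, H.gap n l (H.ctr n) ≤ H.gap n l x := by
      intro l
      have h1 := h.trans (hk l)
      rwa [ngap, le_div_iff₀ (gap_ctr_pos hG hn l), one_mul] at h1
    have hsl : ∀ l, H.slope l (x - H.ctr n) = 0 := by
      intro l
      have h1 := hge (l, true)
      have h2 := hge (l, false)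
      simp only [gap, if_true, Bool.false_eq_true, if_false] at h1 h2
      rw [slope_vsub]; linarith
    exact sub_eq_zero.1 (eq_zero_of_slope_eq_zero hij (hsl i) (hsl j))
  refine ⟨hlt, ?_⟩
  set w := H.ngap n k x
  have hw : 0 < 1 - w := by linarith
  have hy : ∀ j, H.ngap n j (H.ctr n + (1 - w)⁻¹ • (x - H.ctr n)) = (H.ngap n j x - w) / (1 - w) := by
    intro j
    rw [ngap_add_smul_sub, ngap_ctr hG hn]
    field_simp; ring
  refine ⟨H.ctr n + (1 - w)⁻¹ • (x - H.ctr n), ?_, ?_, ?_, ?_⟩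
  · rw [mem_closedCell_iff_ngap hG hn]
    intro j
    rw [hy]
    have := hk j
    exact div_nonneg (by linarith) hw.le
  · rw [← ngap_eq_zero_iff hG hn, hy, sub_self, zero_div]
  · rw [add_sub_cancel_left, smul_smul, mul_inv_cancel₀ hw.ne', one_smul]; abel
  · intro j hj
    rw [← ngap_eq_zero_iff hG hn, hy, hj, sub_self, zero_div]

theorem ngap_rev_sub {n : I → ℤ} {k : I × Bool} (hn : H.IsCellVec n) (hk : H.IsCellVec (step n k))
    (x : ℝ × ℝ) : H.ngap n (rev k) x - H.ngap n k x =
      (1 - H.ngap n k x) * H.ngap n (rev k) (H.gate n k) := by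
  have h1 := gap_ctr_pos hG hn k
  have h2 := gap_ctr_pos hG hn (rev k)
  have h3 := H.gap_add_gap_rev n k (H.ctr n)
  have h4 := H.gap_add_gap_rev n k x
  have h5 := H.gap_add_gap_rev n k (H.gate n k)
  rw [gap_gate hG hn hk] at h5
  have h6 : H.gap n (rev k) (H.gate n k) = 1 := by linarith
  have h7 : H.gap n (rev k) x = 1 - H.gap n k x := by linarith
  simp only [ngap, h6, h7]
  have h9 : H.gap n (rev k) (H.ctr n) = 1 - H.gap n k (H.ctr n) := by linarith
  rw [h9] at h2 ⊢
  have := h1.ne'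
  have := h2.ne'
  field_simp
  ring

theorem ngap_le_one {n : I → ℤ} {k : I × Bool} (hn : H.IsCellVec n) {x : ℝ × ℝ}
    (hk : ∀ j, H.ngap n k x ≤ H.ngap n j x) : H.ngap n k x ≤ 1 := by
  by_cases h : x = H.ctr n
  · rw [h, ngap_ctr hG hn]
  · exact (exists_radial hG hn h hk).1.le

omit [Finite I] in
theorem bump_add_deck [Fintype I] {n : I → ℤ} {k : I × Bool} (hn : H.IsCellVec n)
    (hk : H.IsCellVec (step n k)) (x : ℝ × ℝ) (d : ℤ × ℤ) :
    H.bump (n + H.deck d) k (x + deckVec d) = H.bump n k x := by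
  simp only [bump, gate_add_deck hG hn hk, ngap_add_deck hG hn]

variable [Fintype I]
omit [Finite I]

theorem bump_eq_zero {n : I → ℤ} {k k' : I × Bool} (hn : H.IsCellVec n) (hk : H.IsCellVec (step n k))
    (hne : k' ≠ k) {x : ℝ × ℝ} (h : H.ngap n k' x ≤ H.ngap n k x) : H.bump n k x = 0 := by
  classical
  refine max_eq_left ((Finset.inf'_le _ (Finset.mem_erase.2 ⟨hne, Finset.mem_univ _⟩)).trans ?_)
  exact div_nonpos_of_nonpos_of_nonneg (by linarith) (ngap_gate_pos hG hn hk hne).le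

theorem le_of_bump_pos {n : I → ℤ} {k k' : I × Bool} (hn : H.IsCellVec n)
    (hk : H.IsCellVec (step n k)) {x : ℝ × ℝ} (h : 0 < H.bump n k x) (hne : k' ≠ k) :
    H.bump n k x * H.ngap n k' (H.gate n k) ≤ H.ngap n k' x - H.ngap n k x := by
  classical
  rw [← le_div_iff₀ (ngap_gate_pos hG hn hk hne)]
  have h1 := (lt_max_iff.1 h).resolve_left (lt_irrefl _)
  rw [bump, max_eq_right h1.le]
  exact Finset.inf'_le (fun k' => (H.ngap n k' x - H.ngap n k x) / H.ngap n k' (H.gate n k))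
    (Finset.mem_erase.2 ⟨hne, Finset.mem_univ _⟩)

theorem exists_eq_of_bump_pos {n : I → ℤ} {k : I × Bool} (hn : H.IsCellVec n)
    (hk : H.IsCellVec (step n k)) {x : ℝ × ℝ} (h : 0 < H.bump n k x) :
    ∃ k', k' ≠ k ∧
      H.bump n k x * H.ngap n k' (H.gate n k) = H.ngap n k' x - H.ngap n k x := by
  classical
  have h1 := (lt_max_iff.1 h).resolve_left (lt_irrefl _)
  obtain ⟨k', hk', he⟩ := Finset.exists_mem_eq_inf' (s := Finset.univ.erase k) ⟨rev k, by simp [rev_ne]⟩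
    (fun k' => (H.ngap n k' x - H.ngap n k x) / H.ngap n k' (H.gate n k))
  refine ⟨k', Finset.ne_of_mem_erase hk', ?_⟩
  rw [bump, max_eq_right h1.le, he,
    div_mul_cancel₀ _ (ngap_gate_pos hG hn hk (Finset.ne_of_mem_erase hk')).ne']

theorem lt_of_bump_pos {n : I → ℤ} {k k' : I × Bool} (hn : H.IsCellVec n)
    (hk : H.IsCellVec (step n k)) {x : ℝ × ℝ} (h : 0 < H.bump n k x) (hne : k' ≠ k) :
    H.ngap n k x < H.ngap n k' x := by
  have := le_of_bump_pos hG hn hk h hne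
  have := mul_pos h (ngap_gate_pos hG hn hk hne)
  linarith

theorem le_bump {n : I → ℤ} {k : I × Bool} (hn : H.IsCellVec n) (hk : H.IsCellVec (step n k))
    {x : ℝ × ℝ} {c : ℝ}
    (h : ∀ k', k' ≠ k → c * H.ngap n k' (H.gate n k) ≤ H.ngap n k' x - H.ngap n k x) :
    c ≤ H.bump n k x := by
  classical
  refine le_max_of_le_right (Finset.le_inf' _ _ fun k' hk' => ?_)
  have hne := Finset.ne_of_mem_erase hk'
  rw [le_div_iff₀ (ngap_gate_pos hG hn hk hne)]
  exact h k' hne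

theorem bump_le_one_sub {n : I → ℤ} {k : I × Bool} (hn : H.IsCellVec n)
    (hk : H.IsCellVec (step n k)) {x : ℝ × ℝ} (hm : ∀ j, H.ngap n k x ≤ H.ngap n j x) :
    H.bump n k x ≤ 1 - H.ngap n k x := by
  rcases (bump_nonneg n k x).eq_or_lt with h | h
  · rw [← h, sub_nonneg]; exact ngap_le_one hG hn hm
  · have h1 := le_of_bump_pos hG hn hk h (rev_ne k)
    rw [ngap_rev_sub hG hn hk] at h1
    exact le_of_mul_le_mul_right h1 (ngap_gate_pos hG hn hk (rev_ne k))

/-- The values of the bump function on the ray through the gate. -/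
theorem bump_ray {n : I → ℤ} {k : I × Bool} (hn : H.IsCellVec n) (hk : H.IsCellVec (step n k))
    {ρ : ℝ} (hρ : 0 ≤ ρ) : H.bump n k (H.ctr n + ρ • (H.gate n k - H.ctr n)) = ρ := by
  have hng : ∀ j, H.ngap n j (H.ctr n + ρ • (H.gate n k - H.ctr n)) =
      1 + ρ * (H.ngap n j (H.gate n k) - 1) := fun j => by
    rw [ngap_add_smul_sub, ngap_ctr hG hn]
  apply le_antisymm
  · rcases (bump_nonneg n k (H.ctr n + ρ • (H.gate n k - H.ctr n))).eq_or_lt with h | h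
    · rwa [← h]
    · have h1 := le_of_bump_pos hG hn hk h (rev_ne k)
      rw [hng, hng, ngap_gate hG hn hk] at h1
      refine le_of_mul_le_mul_right (h1.trans_eq ?_) (ngap_gate_pos hG hn hk (rev_ne k))
      ring
  · refine le_bump hG hn hk fun k' _ => ?_
    rw [hng, hng, ngap_gate hG hn hk]
    apply le_of_eq; ring

/-- On the common side of two cells, the bump functions of both agree. -/
theorem bump_step_rev {n : I → ℤ} {k : I × Bool} (hn : H.IsCellVec n)
    (hk : H.IsCellVec (step n k)) {x : ℝ × ℝ} (hx : H.gap n k x = 0) :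
    H.bump (step n k) (rev k) x = H.bump n k x := by
  have main : ∀ {n : I → ℤ} {k : I × Bool}, H.IsCellVec n → H.IsCellVec (step n k) →
      H.gap n k x = 0 → H.bump n k x ≤ H.bump (step n k) (rev k) x := by
    intro n k hn hk hx
    rcases (bump_nonneg n k x).eq_or_lt with h | h
    · rw [← h]; exact bump_nonneg _ _ _
    have ratio : ∀ {n : I → ℤ} {k : I × Bool}, H.IsCellVec n → H.IsCellVec (step n k) →
      H.gap n k x = 0 → ∀ k' c, (c * H.ngap n k' (H.gate n k) ≤ H.ngap n k' x - H.ngap n k x ↔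
        c * H.gap n k' (H.gate n k) ≤ H.gap n k' x) := by
      intro n k hn hk hx k' c
      rw [(ngap_eq_zero_iff hG hn).2 hx, sub_zero, ngap, ngap, mul_div,
        div_le_div_iff_of_pos_right (gap_ctr_pos hG hn k')]
    have hk' : H.IsCellVec (step (step n k) (rev k)) := by rwa [step_step_rev]
    refine le_bump hG hk hk' fun k' hne => ?_
    rw [ratio hk hk' (by rw [gap_step_rev, hx, neg_zero]), gate_step_rev hG hn hk]
    by_cases h1 : k' = k
    · have h2 := le_of_bump_pos hG hn hk h (rev_ne k)
      have h3 := H.gap_add_gap_rev n k x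
      have h4 := H.gap_add_gap_rev n k (H.gate n k)
      rw [ratio hn hk hx] at h2
      rw [h1, gap_step_same, gap_step_same, gap_gate hG hn hk, hx]
      rw [gap_gate hG hn hk] at h4
      rw [hx] at h3
      rw [zero_add] at h3 h4
      rw [h3, h4] at h2
      simpa using h2
    · have h2 := le_of_bump_pos hG hn hk h h1
      rw [ratio hn hk hx] at h2
      have h3 : k'.1 ≠ k.1 := by
        intro h
        rcases k with ⟨i, b⟩; rcases k' with ⟨j, c⟩
        simp only at h; subst h
        cases b <;> cases c <;> simp_all [rev]
      rwa [gap_step_of_ne _ _ h3, gap_step_of_ne _ _ h3]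
  refine le_antisymm ?_ (main hn hk hx)
  have := main (n := step n k) (k := rev k) hk (by rwa [step_step_rev])
    (by rw [gap_step_rev, hx, neg_zero])
  rwa [step_step_rev, rev_rev] at this

/-- Pushing a point of the cone over a side away from the gate moves it to the boundary of the
cone. -/
theorem push_mem {n : I → ℤ} {k : I × Bool} (hn : H.IsCellVec n) (hk : H.IsCellVec (step n k))
    {x : ℝ × ℝ} (hx : x ∈ H.ClosedCell n) (h : 0 < H.bump n k x) :
    x + H.bump n k x • (H.ctr n - H.gate n k) ∈ H.ClosedCell n ∧
    (∀ j, H.ngap n k (x + H.bump n k x • (H.ctr n - H.gate n k)) ≤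
      H.ngap n j (x + H.bump n k x • (H.ctr n - H.gate n k))) ∧
    ∃ k', k' ≠ k ∧ H.ngap n k' (x + H.bump n k x • (H.ctr n - H.gate n k)) =
      H.ngap n k (x + H.bump n k x • (H.ctr n - H.gate n k)) := by
  have hng : ∀ j, H.ngap n j (x + H.bump n k x • (H.ctr n - H.gate n k)) =
      H.ngap n j x + H.bump n k x * (1 - H.ngap n j (H.gate n k)) := fun j => by
    rw [ngap_add_smul_sub, ngap_ctr hG hn]
  have hmin : ∀ j, H.ngap n k (x + H.bump n k x • (H.ctr n - H.gate n k)) ≤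
      H.ngap n j (x + H.bump n k x • (H.ctr n - H.gate n k)) := by
    intro j
    by_cases hj : j = k
    · rw [hj]
    · rw [hng, hng, ngap_gate hG hn hk]
      linarith [le_of_bump_pos hG hn hk h hj]
  refine ⟨?_, hmin, ?_⟩
  · rw [mem_closedCell_iff_ngap hG hn] at *
    intro j
    refine le_trans ?_ (hmin j)
    rw [hng, ngap_gate hG hn hk]
    have := hx k
    linarith
  · obtain ⟨k', hk', he⟩ := exists_eq_of_bump_pos hG hn hk h
    refine ⟨k', hk', ?_⟩
    rw [hng, hng, ngap_gate hG hn hk]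
    linarith

end Gate

end Arrangement

namespace Arrangement

variable {I : Type*} {H : Arrangement I}

/-! ### Triangular cells -/

theorem fin_three_add (i : Fin 3) : i + 1 + 1 = i + 2 ∧ i + 1 + 2 = i ∧ i + 2 + 1 = i ∧
    i + 2 + 2 = i + 1 := by
  revert i; decide

theorem fin_three_cases (i j : Fin 3) : j = i ∨ j = i + 1 ∨ j = i + 2 := by
  revert i j; decide

theorem fin_three_ne (i : Fin 3) : i + 1 ≠ i ∧ i + 2 ≠ i ∧ i + 1 ≠ i + 2 := by
  revert i; decide

theorem sum_fin_three {M : Type*} [AddCommMonoid M] (f : Fin 3 → M) (i : Fin 3) :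
    ∑ j, f j = f i + f (i + 1) + f (i + 2) := by
  rw [Fin.sum_univ_three]
  fin_cases i
  · rfl
  · change f 0 + f 1 + f 2 = f 1 + f 2 + f 0; abel
  · change f 0 + f 1 + f 2 = f 2 + f 0 + f 1; abel

/-- The points `p i` are the vertices of the closed cell with vector `n`, in such a way that
`Δ` is twice the oriented area. -/
structure IsTriangulated (K : Set (ℝ × ℝ)) (p : Fin 3 → ℝ × ℝ) (Δ : ℝ) : Prop where
  mem : ∀ i, p i ∈ K
  weights : ∀ x ∈ K, ∃ w : Fin 3 → ℝ, (∀ i, 0 ≤ w i) ∧ ∑ i, w i = 1 ∧ x = ∑ i, w i • p i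
  area : ∀ i, cross (p (i + 1) - p i) (p (i + 2) - p i) = Δ
  area_ne : Δ ≠ 0

theorem IsTriangulated.swap {K : Set (ℝ × ℝ)} {p : Fin 3 → ℝ × ℝ} {Δ : ℝ}
    (h : IsTriangulated K p Δ) : IsTriangulated K (fun i => p (-i)) (-Δ) where
  mem i := h.mem _
  weights x hx := by
    obtain ⟨w, h0, h1, h2⟩ := h.weights x hx
    refine ⟨fun i => w (-i), fun i => h0 _, ?_, ?_⟩
    · rw [← h1]; exact Equiv.sum_comp (Equiv.neg (Fin 3)) w
    · rw [h2]; exact (Equiv.sum_comp (Equiv.neg (Fin 3)) fun i => w i • p i).symm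
  area i := by
    rw [← h.area (-i), cross_swap]
    have h1 : -(i + 1) = -i + 2 := by revert i; decide
    have h2 : -(i + 2) = -i + 1 := by revert i; decide
    rw [h1, h2]
  area_ne := neg_ne_zero.2 h.area_ne

theorem cross_sub_right (u v w : ℝ × ℝ) : cross u (v - w) = cross u v - cross u w := by
  simp [cross]; ring

theorem cross_add_right (u v w : ℝ × ℝ) : cross u (v + w) = cross u v + cross u w := by
  simp [cross]; ring

theorem cross_smul_right (u v : ℝ × ℝ) (t : ℝ) : cross u (t • v) = t * cross u v := by
  simp [cross]; ring

theorem cross_smul_left (u v : ℝ × ℝ) (t : ℝ) : cross (t • u) v = t * cross u v := by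
  simp [cross]; ring

theorem cross_sub_weights {p : Fin 3 → ℝ × ℝ} {Δ : ℝ}
    (ha : ∀ i, cross (p (i + 1) - p i) (p (i + 2) - p i) = Δ)
    {w : Fin 3 → ℝ} (h1 : ∑ i, w i = 1) (i : Fin 3) :
    cross (p (i + 2) - p (i + 1)) (∑ j, w j • p j - p (i + 1)) = w i * Δ := by
  have ha' := ha (i + 1)
  rw [(fin_three_add i).1, (fin_three_add i).2.1] at ha'
  rw [sum_fin_three w i] at h1
  rw [sum_fin_three _ i, ← ha']
  have : w i • p i + w (i + 1) • p (i + 1) + w (i + 2) • p (i + 2) - p (i + 1) =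
      w i • (p i - p (i + 1)) + w (i + 2) • (p (i + 2) - p (i + 1)) := by
    have : w (i + 1) = 1 - w i - w (i + 2) := by linarith
    rw [this]; module
  rw [this, cross_add_right, cross_smul_right, cross_smul_right, cross_self]
  ring

theorem IsTriangulated.extreme {K : Set (ℝ × ℝ)} {p : Fin 3 → ℝ × ℝ} {Δ : ℝ}
    (h : IsTriangulated K p Δ) {i : Fin 3} {v : ℝ × ℝ} (h1 : p i + v ∈ K) (h2 : p i - v ∈ K) :
    v = 0 := by
  obtain ⟨w, hw0, hw1, hw⟩ := h.weights _ h1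
  obtain ⟨w', hw0', hw1', hw'⟩ := h.weights _ h2
  have e1 := cross_sub_weights h.area hw1 i
  have e2 := cross_sub_weights h.area hw1' i
  have e3 := h.area (i + 1)
  rw [(fin_three_add i).1, (fin_three_add i).2.1] at e3
  rw [← hw] at e1
  rw [← hw'] at e2
  have e4 : (w i + w' i) * Δ = 2 * Δ := by
    rw [add_mul, ← e1, ← e2, ← e3]
    simp only [cross_sub_right, cross_add_right]; ring
  have e5 := mul_right_cancel₀ h.area_ne e4
  rw [sum_fin_three w i] at hw1
  rw [sum_fin_three w' i] at hw1'
  have a1 := hw0 (i + 1); have a2 := hw0 (i + 2)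
  have b1 := hw0' (i + 1); have b2 := hw0' (i + 2)
  have c0 : w i = 1 := by linarith
  have c1 : w (i + 1) = 0 := by linarith
  have c2 : w (i + 2) = 0 := by linarith
  rw [sum_fin_three _ i, c0, c1, c2] at hw
  simpa using hw

theorem IsTriangulated.ne {K : Set (ℝ × ℝ)} {p : Fin 3 → ℝ × ℝ} {Δ : ℝ}
    (h : IsTriangulated K p Δ) {i j : Fin 3} (hij : i ≠ j) : p i ≠ p j := by
  intro he
  have := h.area i
  rcases fin_three_cases i j with rfl | rfl | rfl
  · exact hij rfl
  · rw [← he, sub_self] at this; exact h.area_ne (by rw [← this]; simp [cross])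
  · rw [← he, sub_self] at this; exact h.area_ne (by rw [← this]; simp [cross])

theorem exists_weights_of_mem_convexHull {a b c x : ℝ × ℝ} (h : x ∈ convexHull ℝ {a, b, c}) :
    ∃ w : Fin 3 → ℝ, (∀ i, 0 ≤ w i) ∧ ∑ i, w i = 1 ∧ x = ∑ i, w i • ![a, b, c] i := by
  rw [convexHull_insert (by simp), convexHull_pair, mem_convexJoin] at h
  obtain ⟨a', ha', y, ⟨u, v, hu, hv, huv, rfl⟩, s, t, hs, ht, hst, rfl⟩ := h
  rw [Set.mem_singleton_iff.1 ha']
  refine ⟨![s, t * u, t * v], ?_, ?_, ?_⟩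
  · intro i; fin_cases i
    · exact hs
    · exact mul_nonneg ht hu
    · exact mul_nonneg ht hv
  · rw [Fin.sum_univ_three]
    change s + t * u + t * v = 1
    rw [add_assoc, ← mul_add, huv, mul_one, hst]
  · rw [Fin.sum_univ_three]
    change s • a + t • (u • b + v • c) = s • a + (t * u) • b + (t * v) • c
    module

theorem exists_isTriangulated [Finite I] {n : I → ℤ} {P : H.Cell}
    (hn : H.Over n P) (hP : H.IsTriangle P) :
    ∃ p Δ, IsTriangulated (H.ClosedCell n) p Δ := by
  obtain ⟨a, b, c, -, hab⟩ := hP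
  obtain ⟨m, hm, hO⟩ := isLiftOf_iff.1 hab
  obtain ⟨d, rfl⟩ := hm.exists_deck hn
  have hK : H.ClosedCell m = convexHull ℝ {a, b, c} := by
    rw [← closure_openCell hm.1, ← hO, Convex.closure_interior_eq_closure_of_nonempty_interior
      (convex_convexHull ℝ _) (by rw [hO]; exact hm.1)]
    exact (Set.Finite.isClosed_convexHull ℝ (by simp)).closure_eq
  set q : Fin 3 → ℝ × ℝ := ![a, b, c] with hq
  have hw : ∀ x ∈ H.ClosedCell m, ∃ w : Fin 3 → ℝ, (∀ i, 0 ≤ w i) ∧ ∑ i, w i = 1 ∧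
      x = ∑ i, w i • q i := fun x hx => exists_weights_of_mem_convexHull (hK ▸ hx)
  set Δ := cross (q 1 - q 0) (q 2 - q 0) with hΔ
  have harea : ∀ i, cross (q (i + 1) - q i) (q (i + 2) - q i) = Δ := by
    intro i
    fin_cases i
    · rfl
    · change cross (q 2 - q 1) (q 0 - q 1) = cross (q 1 - q 0) (q 2 - q 0)
      simp [cross]; ring
    · change cross (q 0 - q 2) (q 1 - q 2) = cross (q 1 - q 0) (q 2 - q 0)
      simp [cross]; ring
  have hne : Δ ≠ 0 := by
    intro h0
    obtain ⟨y, hy⟩ := hm.1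
    have hcr : ∀ x ∈ H.ClosedCell m, ∀ i, cross (q (i + 2) - q (i + 1)) (x - q (i + 1)) = 0 := by
      intro x hx i
      obtain ⟨w, -, h1, rfl⟩ := hw x hx
      rw [cross_sub_weights harea h1, h0, mul_zero]
    have hnear : ∀ v : ℝ × ℝ, ∃ t : ℝ, 0 < t ∧ y + t • v ∈ H.ClosedCell m := by
      intro v
      have hc : Continuous fun t : ℝ => y + t • v := by fun_prop
      have h2 : ∀ᶠ t : ℝ in 𝓝 0, y + t • v ∈ H.OpenCell m :=
        (hc.tendsto 0).eventually ((H.isOpen_openCell m).mem_nhds (by simpa using hy))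
      obtain ⟨t, ht, ht'⟩ := ((h2.filter_mono nhdsWithin_le_nhds).and
        (eventually_mem_nhdsWithin (a := (0 : ℝ)) (s := Set.Ioi 0))).exists
      exact ⟨t, ht', H.openCell_subset_closedCell _ ht⟩
    have hv : ∀ (v : ℝ × ℝ) i, cross (q (i + 2) - q (i + 1)) v = 0 := by
      intro v i
      obtain ⟨t, ht, hmem⟩ := hnear v
      have e1 := hcr _ hmem i
      have e2 := hcr _ (H.openCell_subset_closedCell _ hy) i
      rw [cross_sub_right, cross_add_right, cross_smul_right] at e1
      rw [cross_sub_right] at e2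
      have e3 : t * cross (q (i + 2) - q (i + 1)) v = 0 := by linarith
      exact (mul_eq_zero.1 e3).resolve_left ht.ne'
    have hz : ∀ u : ℝ × ℝ, (∀ v, cross u v = 0) → u = 0 := by
      intro u hu
      have e1 := hu (1, 0); have e2 := hu (0, 1)
      simp [cross] at e1 e2
      exact Prod.ext e2 e1
    have e1 : q 0 = q 2 := sub_eq_zero.1 (hz _ fun v => hv v 1)
    have e2 : q 1 = q 0 := sub_eq_zero.1 (hz _ fun v => hv v 2)
    have hall : ∀ x ∈ H.ClosedCell m, x = q 0 := by
      intro x hx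
      obtain ⟨w, -, h1, rfl⟩ := hw x hx
      rw [Fin.sum_univ_three] at h1 ⊢
      rw [← e1, e2, ← add_smul, ← add_smul, h1, one_smul]
    obtain ⟨t, ht, hmem⟩ := hnear (1, 0)
    have e3 := (hall _ hmem).trans (hall _ (H.openCell_subset_closedCell _ hy)).symm
    have e4 := congrArg Prod.fst e3
    simp at e4
    exact ht.ne' e4
  refine ⟨fun i => q i + deckVec d, Δ, ?_, ?_, ?_, hne⟩
  · intro i
    rw [mem_closedCell_add_deckVec, hK]
    apply subset_convexHull
    fin_cases i <;> simp [hq]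
  · intro x hx
    have hx' : x - deckVec d ∈ H.ClosedCell m := by
      rwa [← mem_closedCell_add_deckVec (d := d), sub_add_cancel]
    obtain ⟨w, h0, h1, h2⟩ := hw _ hx'
    refine ⟨w, h0, h1, ?_⟩
    simp only [smul_add, Finset.sum_add_distrib, ← Finset.sum_smul, h1, one_smul, ← h2,
      sub_add_cancel]
  · intro i
    simp only [add_sub_add_right_eq_sub]
    exact harea i

/-- The closed cell with vector `n` is the triangle with vertices `p i`, and the line `lam i` contains
the side opposite to `p i`. -/
structure IsTri (H : Arrangement I) (n : I → ℤ) (b : Bool) (p : Fin 3 → ℝ × ℝ) (lam : Fin 3 → I) :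
    Prop where
  mem : ∀ i, p i ∈ H.ClosedCell n
  gap_iff : ∀ i j, H.gap n (lam j, b) (p i) = 0 ↔ j ≠ i
  side : ∀ x ∈ H.ClosedCell n, ∀ k, H.gap n k x = 0 → ∃ j, k = (lam j, b)
  orient : ∀ i, 0 < sg b * cross (H (lam (i + 2))).tangent (H (lam (i + 1))).tangent

theorem gap_weights (H : Arrangement I) (n : I → ℤ) (k : I × Bool) {w : Fin 3 → ℝ}
    (h1 : ∑ i, w i = 1) (p : Fin 3 → ℝ × ℝ) :
    H.gap n k (∑ i, w i • p i) = ∑ i, w i * H.gap n k (p i) := by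
  rw [Fin.sum_univ_three] at *
  have : w 0 • p 0 + w 1 • p 1 + w 2 • p 2 = p 0 + w 1 • (p 1 - p 0) + w 2 • (p 2 - p 0) := by
    have : w 0 = 1 - w 1 - w 2 := by linarith
    rw [this]; module
  rw [this, gap_add_smul_sub, gap_add_smul_sub, Fin.sum_univ_three]
  have : w 0 = 1 - w 1 - w 2 := by linarith
  rw [this]; ring

theorem eq_of_on_two (hG : H.IsGeneric) {i j : I} {x y : ℝ × ℝ} (hxy : x ≠ y) {n : I → ℤ} {b c : Bool}
    (h1 : H.gap n (i, b) x = 0) (h2 : H.gap n (i, b) y = 0) (h3 : H.gap n (j, c) x = 0)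
    (h4 : H.gap n (j, c) y = 0) : i = j := by
  by_contra hij
  have hc := cross_ne_zero_of_on hG hij (H.on_of_gap_eq_zero (k := (i, b)) h1)
    (H.on_of_gap_eq_zero (k := (j, c)) h3)
  have hs : ∀ (l : I) (e : Bool), H.gap n (l, e) x = 0 → H.gap n (l, e) y = 0 → H.slope l (x - y) = 0 := by
    intro l e h h'
    have := H.sg_slope_sub n (l, e) x y
    rw [h, h', sub_zero] at this
    refine (mul_eq_zero.1 this).resolve_left ?_
    cases e <;> simp [sg]
  exact hxy (sub_eq_zero.1 (eq_zero_of_slope_eq_zero hc (hs i b h1 h2) (hs j c h3 h4)))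

theorem IsTriangulated.exists_two_lines [Finite I] {n : I → ℤ} {p : Fin 3 → ℝ × ℝ}
    {Δ : ℝ} (h : IsTriangulated (H.ClosedCell n) p Δ) (i : Fin 3) :
    ∃ k k', k.1 ≠ k'.1 ∧ H.gap n k (p i) = 0 ∧ H.gap n k' (p i) = 0 := by
  by_contra! hcon
  obtain ⟨v, hv, hv0⟩ : ∃ v, (∀ k, H.gap n k (p i) = 0 → H.slope k.1 v = 0) ∧ v ≠ 0 := by
    by_cases hk : ∃ k, H.gap n k (p i) = 0
    · obtain ⟨k, hk⟩ := hk
      refine ⟨(H k.1).tangent, fun k' hk' => ?_, fun h0 => ?_⟩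
      · have : k'.1 = k.1 := by
          by_contra hne
          exact hcon k' k hne hk' hk
        rw [this, slope_eq_zero_iff, cross_self]
      · have := tangent_ne_zero H k.1
        rw [h0] at this; simp at this
    · push Not at hk
      exact ⟨(1, 0), fun k h => absurd h (hk k), by simp⟩
  have hmem := H.mem_closedCell_iff.1 (h.mem i)
  have hev : ∀ v : ℝ × ℝ, (∀ k, H.gap n k (p i) = 0 → H.slope k.1 v = 0) →
      ∀ᶠ t : ℝ in 𝓝[>] 0, p i + t • v ∈ H.ClosedCell n := by
    intro v hv
    simp only [mem_closedCell_iff]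
    rw [eventually_all]
    intro k
    simp only [gap_add, slope_smul]
    rcases (hmem k).eq_or_lt with h0 | h0
    · rw [hv k h0.symm, ← h0]; simp
    · have hc : Continuous fun t : ℝ => H.gap n k (p i) - sg k.2 * (t * H.slope k.1 v) := by fun_prop
      have := (hc.tendsto 0).eventually_const_lt (u := 0) (by simpa using h0)
      exact (this.mono fun t ht => ht.le).filter_mono nhdsWithin_le_nhds
  obtain ⟨t, ⟨h1, h2⟩, ht⟩ := (((hev v hv).and (hev (-v) fun k hk => by
    rw [slope_neg, hv k hk, neg_zero])).and
    (eventually_mem_nhdsWithin (a := (0 : ℝ)) (s := Set.Ioi 0))).exists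
  have := h.extreme h1 (by simpa [sub_eq_add_neg] using h2)
  rcases smul_eq_zero.1 this with h | h
  · exact (ne_of_gt ht) h
  · exact hv0 h

theorem exists_smul_of_cross_eq_zero {u e : ℝ × ℝ} (he : e ≠ 0) (h : cross u e = 0) :
    ∃ t : ℝ, u = t • e := by
  have h0 : e.1 * e.1 + e.2 * e.2 ≠ 0 := by
    intro h0
    apply he
    have : e.1 = 0 := by nlinarith [mul_self_nonneg e.1, mul_self_nonneg e.2]
    have : e.2 = 0 := by nlinarith [mul_self_nonneg e.1, mul_self_nonneg e.2]
    ext <;> assumption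
  simp only [cross] at h
  refine ⟨(u.1 * e.1 + u.2 * e.2) / (e.1 * e.1 + e.2 * e.2), ?_⟩
  ext
  · simp only [Prod.smul_fst, smul_eq_mul]
    rw [div_mul_eq_mul_div, eq_div_iff h0]; linear_combination e.2 * h
  · simp only [Prod.smul_snd, smul_eq_mul]
    rw [div_mul_eq_mul_div, eq_div_iff h0]; linear_combination (-e.1) * h

theorem IsTame.exists_isTri [Finite I] {ι : H.Cell → ℤ} (hT : H.IsTame ι)
    (htri : ∀ P, |ι P| = 2 → H.IsTriangle P) {n : I → ℤ} (h2 : |H.idx ι n| = 2) :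
    ∃ b p lam, H.IsTri n b p lam ∧ H.idx ι n = 2 * sg b := by
  have hG := hT.gen
  have hn : H.IsCellVec n := isCellVec_of_idx_ne_zero (ι := ι) (by intro h; rw [h] at h2; simp at h2)
  obtain ⟨P, hP⟩ := exists_cell_over hn
  obtain ⟨b, hb⟩ : ∃ b, H.idx ι n = 2 * sg b := by
    rw [abs_eq (by norm_num)] at h2
    rcases h2 with h | h
    · exact ⟨true, h⟩
    · exact ⟨false, h⟩
  obtain ⟨p, Δ, hp, hΔ⟩ : ∃ p Δ, IsTriangulated (H.ClosedCell n) p Δ ∧ sg b * Δ < 0 := by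
    obtain ⟨p, Δ, hp⟩ := exists_isTriangulated hP (htri P (by rwa [← hP.idx_eq (ι := ι)]))
    have h0 : (sg b : ℝ) * Δ ≠ 0 := mul_ne_zero (by cases b <;> simp [sg]) hp.area_ne
    rcases h0.lt_or_gt with h | h
    · exact ⟨p, Δ, hp, h⟩
    · exact ⟨_, _, hp.swap, by linarith⟩
  have hactive : ∀ x ∈ H.ClosedCell n, ∀ k, H.gap n k x = 0 →
      k.2 = b ∧ H.IsCellVec (step n k) := by
    intro x hx k hk
    have := (hT.abs_idx_step_two hx h2 hk).2
    refine ⟨sg_injective ?_, hT.isCellVec (H.mem_closedCell_step hx hk)⟩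
    omega
  -- every side omits exactly one vertex
  have hside : ∀ x ∈ H.ClosedCell n, ∀ k, H.gap n k x = 0 →
      ∃ j, ∀ i, H.gap n k (p i) = 0 ↔ i ≠ j := by
    intro x hx k hk
    have hks := (hactive x hx k hk).2
    obtain ⟨w, hw0, hw1, hw⟩ := hp.weights _ (gate_mem hG hn hks)
    have hz := gap_gate hG hn hks
    rw [hw, H.gap_weights n k hw1, Finset.sum_eq_zero_iff_of_nonneg
      (fun i _ => mul_nonneg (hw0 i) (H.mem_closedCell_iff.1 (hp.mem i) k))] at hz
    have hgp : ∀ i, H.gate n k ≠ p i := by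
      intro i he
      obtain ⟨l, l', hll, hl, hl'⟩ := hp.exists_two_lines i
      rw [← he] at hl hl'
      exact hll (((on_gate_iff hG hn hks).1 (H.on_of_gap_eq_zero hl)).trans
        ((on_gate_iff hG hn hks).1 (H.on_of_gap_eq_zero hl')).symm)
    obtain ⟨j, hj⟩ : ∃ j, H.gap n k (p j) ≠ 0 := by
      by_contra! hall
      obtain ⟨w, hw0, hw1, hw⟩ := hp.weights _ (H.openCell_subset_closedCell _ (ctr_mem hG hn))
      have := gap_ctr_pos hG hn k
      rw [hw, H.gap_weights n k hw1] at this
      simp [hall] at this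
    refine ⟨j, fun i => ⟨?_, fun hij => ?_⟩⟩
    · rintro h0 rfl; exact hj h0
    · by_contra hi
      have wi : w i = 0 := (mul_eq_zero.1 (hz i (Finset.mem_univ _))).resolve_right hi
      have wj : w j = 0 := (mul_eq_zero.1 (hz j (Finset.mem_univ _))).resolve_right hj
      obtain ⟨l, hl⟩ : ∃ l : Fin 3, ∀ m, m ≠ i → m ≠ j → m = l := by
        clear * - hij
        revert i j; decide
      have hwz : ∀ m, m ≠ l → w m = 0 := by
        intro m hm
        by_cases h1 : m = i
        · rw [h1, wi]
        · by_cases h2 : m = j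
          · rw [h2, wj]
          · exact absurd (hl m h1 h2) hm
      rw [Finset.sum_eq_single l (fun m _ hm => hwz m hm) (by simp)] at hw1
      rw [Finset.sum_eq_single l (fun m _ hm => by rw [hwz m hm, zero_smul]) (by simp), hw1,
        one_smul] at hw
      exact hgp l hw
  have huniq : ∀ {k k' : I × Bool} {j : Fin 3}, (∀ i, H.gap n k (p i) = 0 ↔ i ≠ j) →
      (∀ i, H.gap n k' (p i) = 0 ↔ i ≠ j) → k.1 = k'.1 := by
    intro k k' j h h'
    have n1 := (fin_three_ne j).1
    have n2 := (fin_three_ne j).2.1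
    exact eq_of_on_two hG (hp.ne (fin_three_ne j).2.2) ((h _).2 n1) ((h _).2 n2) ((h' _).2 n1)
      ((h' _).2 n2)
  have hex : ∀ j, ∃ l : I, ∀ i, H.gap n (l, b) (p i) = 0 ↔ j ≠ i := by
    intro j
    obtain ⟨k, k', hkk, hk, hk'⟩ := hp.exists_two_lines (j + 1)
    obtain ⟨l, hl⟩ := hside _ (hp.mem _) k hk
    obtain ⟨l', hl'⟩ := hside _ (hp.mem _) k' hk'
    have hll : l ≠ l' := by rintro rfl; exact hkk (huniq hl hl')
    have h1 := (hl _).1 hk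
    have h2 := (hl' _).1 hk'
    have h3 : l = j ∨ l' = j := by
      clear * - hll h1 h2
      revert j l l'; decide
    have e1 := (hactive _ (hp.mem _) k hk).1
    have e2 := (hactive _ (hp.mem _) k' hk').1
    rcases h3 with rfl | rfl
    · exact ⟨k.1, fun i => by rw [← e1, ne_comm]; exact hl i⟩
    · exact ⟨k'.1, fun i => by rw [← e2, ne_comm]; exact hl' i⟩
  choose lam hlam using hex
  refine ⟨b, p, lam, ⟨hp.mem, fun i j => hlam j i, ?_, ?_⟩, hb⟩
  · intro x hx k hk
    obtain ⟨j, hj⟩ := hside x hx k hk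
    refine ⟨j, Prod.ext (huniq hj (k' := (lam j, b)) fun i => ?_) (hactive x hx k hk).1⟩
    rw [hlam, ne_comm]
  · have ht : ∀ j, ∃ t : ℝ, 0 < t ∧ (H (lam j)).tangent = t • (p (j + 2) - p (j + 1)) := by
      intro j
      obtain ⟨n1, n2, n3⟩ := fin_three_ne j
      have z1 := (hlam j (j + 1)).2 n1.symm
      have z2 := (hlam j (j + 2)).2 n2.symm
      have z0 : 0 < H.gap n (lam j, b) (p j) :=
        lt_of_le_of_ne (H.mem_closedCell_iff.1 (hp.mem j) _) fun h => (hlam j j).1 h.symm rfl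
      have c1 : cross (H (lam j)).tangent (p (j + 2) - p (j + 1)) = 0 := by
        have := H.sg_slope_sub n (lam j, b) (p (j + 2)) (p (j + 1))
        rw [z1, z2, sub_zero] at this
        rw [← slope_eq_zero_iff]
        refine (mul_eq_zero.1 this).resolve_left ?_
        cases b <;> simp [sg]
      obtain ⟨t, ht⟩ := exists_smul_of_cross_eq_zero (sub_ne_zero.2 (hp.ne n3.symm)) c1
      refine ⟨t, ?_, ht⟩
      have c2 := H.sg_slope_sub n (lam j, b) (p j) (p (j + 1))
      rw [z1, zero_sub, slope, ht, cross_smul_left] at c2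
      have c3 := hp.area (j + 1)
      rw [(fin_three_add j).1, (fin_three_add j).2.1] at c3
      rw [c3] at c2
      have c4 : t * (-(sg b * Δ)) = H.gap n (lam j, b) (p j) * (2 * Real.pi) := by
        have := Real.pi_pos.ne'
        field_simp at c2
        linear_combination -c2
      have c5 : 0 < t * (-(sg b * Δ)) := by
        rw [c4]; exact mul_pos z0 Real.two_pi_pos
      exact pos_of_mul_pos_left c5 (by linarith)
    intro i
    obtain ⟨s, hs0, hs⟩ := ht (i + 1)
    obtain ⟨t, ht0, ht⟩ := ht (i + 2)
    obtain ⟨a1, a2, a3, a4⟩ := fin_three_add i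
    rw [a3, a4] at ht
    rw [a1, a2] at hs
    rw [ht, hs, cross_smul_left, cross_smul_right]
    have c3 := hp.area i
    have c4 : cross (p (i + 1) - p i) (p i - p (i + 2)) = -Δ := by
      rw [← c3, ← neg_sub (p (i + 2)), ← neg_one_smul ℝ, cross_smul_right]; ring
    rw [c4]
    have : sg b * (t * (s * -Δ)) = (t * s) * -(sg b * Δ) := by ring
    rw [this]
    exact mul_pos (mul_pos ht0 hs0) (by linarith)

end Arrangement

namespace Arrangement

variable {I : Type*} {H : Arrangement I}

/-! ### Crossings and edges in the plane -/

theorem eq_of_gap_eq_zero {n : I → ℤ} {x : ℝ × ℝ} {k k' : I × Bool} (hkk : k.1 = k'.1)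
    (hk : H.gap n k x = 0) (hk' : H.gap n k' x = 0) : k = k' := by
  by_contra hne
  have : k' = rev k := by
    rcases k with ⟨i, b⟩; rcases k' with ⟨j, c⟩
    simp only at hkk; subst hkk
    cases b <;> cases c <;> simp_all [rev]
  have h3 := H.gap_add_gap_rev n k x
  rw [← this, hk, hk'] at h3; norm_num at h3

theorem sides_eq (hG : H.IsGeneric) {n : I → ℤ} {x : ℝ × ℝ} {k k' a : I × Bool}
    (hkk : k.1 ≠ k'.1) (hk : H.gap n k x = 0) (hk' : H.gap n k' x = 0) (ha : H.gap n a x = 0) :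
    a = k ∨ a = k' := by
  rcases eq_of_on_three hG.simple (H.on_of_gap_eq_zero hk) (H.on_of_gap_eq_zero hk')
    (H.on_of_gap_eq_zero ha) with h | h | h
  · exact absurd h hkk
  · exact Or.inr (eq_of_gap_eq_zero h.symm ha hk')
  · exact Or.inl (eq_of_gap_eq_zero h.symm ha hk)

theorem step_comm (n : I → ℤ) {k k' : I × Bool} (h : k.1 ≠ k'.1) :
    step (step n k) k' = step (step n k') k := by
  funext i
  by_cases h1 : i = k.1
  · subst h1; rw [step_of_ne _ _ h, step_same, step_same, step_of_ne _ _ h]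
  · by_cases h2 : i = k'.1
    · subst h2; rw [step_of_ne _ k h1, step_same, step_same, step_of_ne _ k h1]
    · rw [step_of_ne _ _ h2, step_of_ne _ _ h1, step_of_ne _ _ h1, step_of_ne _ _ h2]

variable (H) in
/-- Two distinct lines meet at the point `x`. -/
def Crosses (x : ℝ × ℝ) : Prop := ∃ i j, i ≠ j ∧ H.On i x ∧ H.On j x

theorem Crosses.exists_sides {n : I → ℤ} {x : ℝ × ℝ} (h : H.Crosses x) (hx : x ∈ H.ClosedCell n) :
    ∃ k k', k.1 ≠ k'.1 ∧ H.gap n k x = 0 ∧ H.gap n k' x = 0 := by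
  obtain ⟨i, j, hij, hi, hj⟩ := h
  obtain ⟨b, hb⟩ := H.exists_gap_eq_zero hx hi
  obtain ⟨c, hc⟩ := H.exists_gap_eq_zero hx hj
  exact ⟨(i, b), (j, c), hij, hb, hc⟩

theorem crosses_of_sides {n : I → ℤ} {x : ℝ × ℝ} {k k' : I × Bool} (hkk : k.1 ≠ k'.1)
    (hk : H.gap n k x = 0) (hk' : H.gap n k' x = 0) : H.Crosses x :=
  ⟨_, _, hkk, H.on_of_gap_eq_zero hk, H.on_of_gap_eq_zero hk'⟩

theorem Crosses.add_deckVec {x : ℝ × ℝ} (h : H.Crosses x) (d : ℤ × ℤ) :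
    H.Crosses (x + deckVec d) := by
  obtain ⟨i, j, hij, hi, hj⟩ := h
  exact ⟨i, j, hij, hi.add_deckVec d, hj.add_deckVec d⟩

theorem IsTri.exists_eq_vertex {n : I → ℤ} {b : Bool} {p : Fin 3 → ℝ × ℝ} {lam : Fin 3 → I}
    (h : H.IsTri n b p lam) (hG : H.IsGeneric) {x : ℝ × ℝ} (hx : x ∈ H.ClosedCell n)
    (hc : H.Crosses x) : ∃ l, x = p l := by
  obtain ⟨k, k', hkk, hk, hk'⟩ := hc.exists_sides hx
  obtain ⟨a, rfl⟩ := h.side x hx k hk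
  obtain ⟨c, rfl⟩ := h.side x hx k' hk'
  have hac : a ≠ c := by rintro rfl; exact hkk rfl
  obtain ⟨l, hl, hl'⟩ : ∃ l : Fin 3, a ≠ l ∧ c ≠ l := by
    clear * -; revert a c; decide
  refine ⟨l, ?_⟩
  by_contra hne
  exact hkk (eq_of_on_two hG hne hk ((h.gap_iff _ _).2 hl) hk' ((h.gap_iff _ _).2 hl'))

theorem IsTri.crosses {n : I → ℤ} {b : Bool} {p : Fin 3 → ℝ × ℝ} {lam : Fin 3 → I}
    (h : H.IsTri n b p lam) (l : Fin 3) : H.Crosses (p l) := by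
  obtain ⟨n1, n2, n3⟩ := fin_three_ne l
  have z1 := (h.gap_iff l (l + 1)).2 n1
  have z2 := (h.gap_iff l (l + 2)).2 n2
  refine crosses_of_sides ?_ z1 z2
  intro he
  have he : lam (l + 1) = lam (l + 2) := he
  have z3 := (h.gap_iff (l + 1) (l + 1)).1
  rw [he] at z3
  exact z3 ((h.gap_iff _ _).2 n3.symm) rfl

theorem IsTri.lam_injective {n : I → ℤ} {b : Bool} {p : Fin 3 → ℝ × ℝ} {lam : Fin 3 → I}
    (h : H.IsTri n b p lam) : Function.Injective lam := by
  intro i j hij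
  by_contra hne
  have z3 := (h.gap_iff i i).1
  rw [hij] at z3
  exact z3 ((h.gap_iff _ _).2 (Ne.symm hne)) rfl

variable (H) in
/-- The edges of the dimer model in the plane: the edge at the crossing `x` goes from the center of
mass of the cell with vector `n` through the point `w` to the center of mass of the cell with
vector `m`. -/
inductive IsEdge [Finite I] (ι : H.Cell → ℤ) : ℝ × ℝ → (I → ℤ) → (I → ℤ) → ℝ × ℝ → Prop
  | point {x n m} : x ∈ H.ClosedCell n → x ∈ H.ClosedCell m → H.idx ι n = -1 → H.idx ι m = 1 →
      IsEdge ι x n m x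
  | star {x n k} : H.Crosses x → x ∈ H.ClosedCell n → |H.idx ι n| = 2 → H.IsCellVec (step n k) →
      H.gap n k x ≠ 0 → IsEdge ι x n (step n k) (H.gate n k)

variable [Finite I] {ι : H.Cell → ℤ}

theorem isCellVec_of_abs {n : I → ℤ} {a : ℤ} (ha : 0 < a) (h : |H.idx ι n| = a) : H.IsCellVec n :=
  isCellVec_of_idx_ne_zero (ι := ι) (by rw [← abs_pos, h]; exact ha)

theorem IsEdge.add_deck (hG : H.IsGeneric) {x w : ℝ × ℝ} {n m : I → ℤ} (h : H.IsEdge ι x n m w)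
    (d : ℤ × ℤ) : H.IsEdge ι (x + deckVec d) (n + H.deck d) (m + H.deck d) (w + deckVec d) := by
  cases h with
  | point h1 h2 h3 h4 =>
    exact .point (H.mem_closedCell_add_deckVec.2 h1) (H.mem_closedCell_add_deckVec.2 h2)
      (by rwa [idx_add_deck]) (by rwa [idx_add_deck])
  | star h1 h2 h3 h4 h5 =>
    rw [← step_add, ← gate_add_deck hG (isCellVec_of_abs two_pos h3) h4]
    exact .star (h1.add_deckVec d) (H.mem_closedCell_add_deckVec.2 h2) (by rwa [idx_add_deck])
      (isCellVec_step_add_deck h4) (by rwa [gap_add_deckVec])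

theorem IsTame.opposite_unique (hT : H.IsTame ι) {n m m' : I → ℤ} {x : ℝ × ℝ}
    (hn : x ∈ H.ClosedCell n) (hm : x ∈ H.ClosedCell m) (hm' : x ∈ H.ClosedCell m')
    (h1 : |H.idx ι n| = 1) (h2 : |H.idx ι m| = 1) (h3 : |H.idx ι m'| = 1) (hne : n ≠ m)
    (hne' : n ≠ m') : m = m' := by
  obtain ⟨k, k', hkk, hk, hk', rfl⟩ := hT.opposite_of_one_one hn hm h1 h2 hne
  obtain ⟨a, a', haa, ha, ha', rfl⟩ := hT.opposite_of_one_one hn hm' h1 h3 hne'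
  rcases sides_eq hT.gen hkk hk hk' ha with rfl | rfl <;>
    rcases sides_eq hT.gen hkk hk hk' ha' with rfl | rfl
  · exact absurd rfl haa
  · rfl
  · exact step_comm _ hkk
  · exact absurd rfl haa

/-- The two lines at a crossing, and the index of the four cells there. -/
theorem IsTame.crossing_cases (hT : H.IsTame ι) {x : ℝ × ℝ} (hx : H.Crosses x) :
    (∃ n m, x ∈ H.ClosedCell n ∧ x ∈ H.ClosedCell m ∧ H.idx ι n = -1 ∧ H.idx ι m = 1) ∨
      ∃ n, x ∈ H.ClosedCell n ∧ |H.idx ι n| = 2 := by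
  obtain ⟨i, j, hij, hi, hj⟩ := hx
  have hl := H.mem_closedCell_low x
  have hz : ∀ l, H.On l x → H.gap (H.low x) (l, false) x = 0 := by
    rintro l ⟨m, hm⟩
    simp [gap, low, hm]
  have e1 := hT.idx_step hl (hz i hi)
  have m1 := H.mem_closedCell_step hl (hz i hi)
  have z2 : H.gap (step (H.low x) (i, false)) (j, false) x = 0 := by
    rw [gap_step_of_ne _ _ hij.symm]; exact hz j hj
  have e2 := hT.idx_step m1 z2
  have m2 := H.mem_closedCell_step m1 z2
  have b0 := _root_.abs_le.1 (hT.abs_idx_le (H.low x))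
  have b2 := _root_.abs_le.1 (hT.abs_idx_le (step (step (H.low x) (i, false)) (j, false)))
  simp only [sg, Bool.false_eq_true, if_false] at e1 e2
  rcases (by omega : H.idx ι (H.low x) = -1 ∨ H.idx ι (H.low x) = 0 ∨ H.idx ι (H.low x) = -2)
    with h | h | h
  · exact Or.inl ⟨_, _, hl, m2, h, by omega⟩
  · exact Or.inr ⟨_, m2, by rw [e2, e1, h]; norm_num⟩
  · exact Or.inr ⟨_, hl, by rw [h]; norm_num⟩

variable (hT : H.IsTame ι) (htri : ∀ P, |ι P| = 2 → H.IsTriangle P)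
include hT htri

theorem IsTame.exists_isEdge {x : ℝ × ℝ} (hx : H.Crosses x) : ∃ n m w, H.IsEdge ι x n m w := by
  rcases hT.crossing_cases hx with ⟨n, m, h1, h2, h3, h4⟩ | ⟨n, h1, h2⟩
  · exact ⟨n, m, x, .point h1 h2 h3 h4⟩
  · obtain ⟨b, p, lam, h, -⟩ := hT.exists_isTri htri h2
    obtain ⟨l, rfl⟩ := h.exists_eq_vertex hT.gen h1 hx
    exact ⟨n, _, _, .star (k := (lam l, b)) hx h1 h2
      (hT.isCellVec (H.mem_closedCell_step (h.mem (l + 1)) ((h.gap_iff _ _).2 (fin_three_ne l).1.symm)))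
      fun h0 => (h.gap_iff _ _).1 h0 rfl⟩

/-- The side of a triangular cell that does not contain a given vertex is unique. -/
theorem IsTame.opposite_side_unique {n : I → ℤ} (h2 : |H.idx ι n| = 2) {x : ℝ × ℝ}
    (hx : x ∈ H.ClosedCell n) (hc : H.Crosses x) {k k' : I × Bool} (hk : H.IsCellVec (step n k))
    (hk' : H.IsCellVec (step n k')) (h : H.gap n k x ≠ 0) (h' : H.gap n k' x ≠ 0) : k = k' := by
  have hn := isCellVec_of_abs two_pos h2
  obtain ⟨b, p, lam, ht, -⟩ := hT.exists_isTri htri h2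
  obtain ⟨l, rfl⟩ := ht.exists_eq_vertex hT.gen hx hc
  obtain ⟨a, rfl⟩ := ht.side _ (gate_mem hT.gen hn hk) k (gap_gate hT.gen hn hk)
  obtain ⟨c, rfl⟩ := ht.side _ (gate_mem hT.gen hn hk') k' (gap_gate hT.gen hn hk')
  rw [Ne, ht.gap_iff, not_not] at h h'
  rw [h, h']

/-- The vertex of a triangular cell opposite to a given side is unique. -/
theorem IsTame.opposite_vertex_unique {n : I → ℤ} (h2 : |H.idx ι n| = 2) {x x' : ℝ × ℝ}
    (hx : x ∈ H.ClosedCell n) (hc : H.Crosses x) (hx' : x' ∈ H.ClosedCell n) (hc' : H.Crosses x')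
    {k : I × Bool} (hk : H.IsCellVec (step n k)) (h : H.gap n k x ≠ 0) (h' : H.gap n k x' ≠ 0) :
    x = x' := by
  have hn := isCellVec_of_abs two_pos h2
  obtain ⟨b, p, lam, ht, -⟩ := hT.exists_isTri htri h2
  obtain ⟨l, rfl⟩ := ht.exists_eq_vertex hT.gen hx hc
  obtain ⟨l', rfl⟩ := ht.exists_eq_vertex hT.gen hx' hc'
  obtain ⟨a, rfl⟩ := ht.side _ (gate_mem hT.gen hn hk) k (gap_gate hT.gen hn hk)
  rw [Ne, ht.gap_iff, not_not] at h h'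
  rw [← h, ← h']

theorem IsTame.isEdge_unique {x w w' : ℝ × ℝ} {n m n' m' : I → ℤ} (h : H.IsEdge ι x n m w)
    (h' : H.IsEdge ι x n' m' w') : n = n' ∧ m = m' ∧ w = w' := by
  have mixed : ∀ {n m R : I → ℤ}, x ∈ H.ClosedCell n → x ∈ H.ClosedCell m → x ∈ H.ClosedCell R →
      H.idx ι n = -1 → H.idx ι m = 1 → |H.idx ι R| = 2 → False := by
    intro n m R hn hm hR h1 h2 h3
    obtain ⟨a, rfl, ha⟩ := hT.adjacent_of_one_two hn hR (by rw [h1]; rfl) h3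
    obtain ⟨c, hc, hc'⟩ := hT.adjacent_of_one_two hm hR (by rw [h2]; rfl) h3
    have e1 := hT.idx_step hn ha
    have e2 := hT.idx_step hm hc'
    rw [← hc] at e2
    rw [abs_eq (by norm_num)] at h3
    rcases sg_eq a.2 with h | h <;> rcases sg_eq c.2 with h' | h' <;> omega
  cases h with
  | point h1 h2 h3 h4 =>
    cases h' with
    | point h1' h2' h3' h4' =>
      have a3 : |H.idx ι n| = 1 := by rw [h3]; rfl
      have a3' : |H.idx ι n'| = 1 := by rw [h3']; rfl
      have a4 : |H.idx ι m| = 1 := by rw [h4]; rfl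
      have a4' : |H.idx ι m'| = 1 := by rw [h4']; rfl
      have nm : n ≠ m := by rintro rfl; omega
      have nm' : n ≠ m' := by rintro rfl; omega
      have nn : n = n' := by
        by_contra hne
        have := hT.opposite_unique h1 h2 h1' a3 a4 a3' nm hne
        rw [this] at h4; omega
      exact ⟨nn, hT.opposite_unique h1 h2 h2' a3 a4 a4' nm nm', rfl⟩
    | star h1' h2' h3' h4' h5' => exact (mixed h1 h2 h2' h3 h4 h3').elim
  | star h1 h2 h3 h4 h5 =>
    cases h' with
    | point h1' h2' h3' h4' => exact (mixed h1' h2' h2 h3' h4' h3).elim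
    | star h1' h2' h3' h4' h5' =>
      have := hT.eq_of_two_two h2 h2' h3 h3'
      subst this
      have := hT.opposite_side_unique htri h3 h2 h1 h4 h4' h5 h5'
      subst this
      exact ⟨rfl, rfl, rfl⟩

omit htri in
theorem IsEdge.spec {x w : ℝ × ℝ} {n m : I → ℤ} (h : H.IsEdge ι x n m w) :
    H.IsCellVec n ∧ H.IsCellVec m ∧ w ∈ H.ClosedCell n ∧ w ∈ H.ClosedCell m ∧
      (∃ i, H.On i w) ∧ n ≠ m ∧ H.Crosses x := by
  cases h with
  | point h1 h2 h3 h4 =>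
    have nm : n ≠ m := by rintro rfl; omega
    obtain ⟨k, k', hkk, hk, hk', -⟩ := hT.opposite_of_one_one h1 h2 (by rw [h3]; rfl)
      (by rw [h4]; rfl) nm
    exact ⟨hT.isCellVec h1, hT.isCellVec h2, h1, h2, ⟨_, H.on_of_gap_eq_zero hk⟩, nm,
      crosses_of_sides hkk hk hk'⟩
  | star h1 h2 h3 h4 h5 =>
    have hn := isCellVec_of_abs two_pos h3
    have h0 := gap_gate hT.gen hn h4
    have hm := gate_mem hT.gen hn h4
    exact ⟨hn, h4, hm, H.mem_closedCell_step hm h0, ⟨_, H.on_of_gap_eq_zero h0⟩,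
      (step_ne _ _).symm, h1⟩

theorem IsTame.eq_of_isEdge_same {x x' w : ℝ × ℝ} {n m n' m' : I → ℤ} (h : H.IsEdge ι x n m w)
    (h' : H.IsEdge ι x' n' m' w) : x = x' := by
  have mixed : ∀ {n : I → ℤ} {k : I × Bool}, H.IsCellVec n → H.IsCellVec (step n k) →
      ¬ H.Crosses (H.gate n k) := by
    rintro n k hn hk ⟨i, j, hij, hi, hj⟩
    rw [on_gate_iff hT.gen hn hk] at hi hj
    exact hij (hi.trans hj.symm)
  have hcx := (h.spec hT).2.2.2.2.2.2
  have hcx' := (h'.spec hT).2.2.2.2.2.2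
  generalize hw : w = w' at h'
  cases h with
  | point h1 h2 h3 h4 =>
    cases h' with
    | point => exact hw
    | star h1' h2' h3' h4' h5' =>
      rw [hw] at hcx
      exact (mixed (isCellVec_of_abs two_pos h3') h4' hcx).elim
  | @star k h1 h2 h3 h4 h5 =>
    have hn := isCellVec_of_abs two_pos h3
    cases h' with
    | point h1' h2' h3' h4' =>
      rw [← hw] at hcx'
      exact (mixed hn h4 hcx').elim
    | @star k' h1' h2' h3' h4' h5' =>
      have hn' := isCellVec_of_abs two_pos h3'
      have g1 := gate_mem hT.gen hn h4
      have g2 := gate_mem hT.gen hn' h4'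
      rw [← hw] at g2
      have := hT.eq_of_two_two g1 g2 h3 h3'
      subst this
      have z1 := gap_gate hT.gen hn h4
      have z2 := gap_gate hT.gen hn h4'
      rw [← hw] at z2
      have e : k = k' := eq_of_gap_eq_zero (((on_gate_iff hT.gen hn h4).1
        (H.on_of_gap_eq_zero z2)).symm) z1 z2
      subst e
      exact hT.opposite_vertex_unique htri h3 h2 h1 h2' h1' h4 h5 h5'

omit hT htri

/-! ### The curves of the edges -/

variable (H) in
/-- The broken line from the center of mass of a cell through the point `w` to the center of mass of
another cell. -/
noncomputable def edgePath (n m : I → ℤ) (w : ℝ × ℝ) (t : ℝ) : ℝ × ℝ :=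
  w + max (1 - 2 * t) 0 • (H.ctr n - w) + max (2 * t - 1) 0 • (H.ctr m - w)

omit [Finite I] in
theorem continuous_edgePath (n m : I → ℤ) (w : ℝ × ℝ) : Continuous (H.edgePath n m w) := by
  unfold edgePath; fun_prop

omit [Finite I] in
theorem edgePath_of_le {n m : I → ℤ} {w : ℝ × ℝ} {t : ℝ} (ht : t ≤ 1 / 2) :
    H.edgePath n m w t = w + (1 - 2 * t) • (H.ctr n - w) := by
  rw [edgePath, max_eq_left (by linarith), max_eq_right (by linarith), zero_smul, add_zero]

omit [Finite I] in
theorem edgePath_of_ge {n m : I → ℤ} {w : ℝ × ℝ} {t : ℝ} (ht : 1 / 2 ≤ t) :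
    H.edgePath n m w t = w + (2 * t - 1) • (H.ctr m - w) := by
  rw [edgePath, max_eq_right (by linarith), max_eq_left (by linarith), zero_smul, add_zero]

omit [Finite I] in
theorem edgePath_zero (n m : I → ℤ) (w : ℝ × ℝ) : H.edgePath n m w 0 = H.ctr n := by
  rw [edgePath_of_le (by norm_num)]; simp

omit [Finite I] in
theorem edgePath_one (n m : I → ℤ) (w : ℝ × ℝ) : H.edgePath n m w 1 = H.ctr m := by
  rw [edgePath_of_ge (by norm_num)]; norm_num

omit [Finite I] in
theorem image_edgePath (n m : I → ℤ) (w : ℝ × ℝ) :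
    H.edgePath n m w '' Set.Icc 0 1 = segment ℝ (H.ctr n) w ∪ segment ℝ w (H.ctr m) := by
  rw [segment_symm ℝ (H.ctr n) w, segment_eq_image', segment_eq_image']
  ext z
  constructor
  · rintro ⟨t, ht, rfl⟩
    rcases le_total t (1 / 2) with h | h
    · exact Or.inl ⟨1 - 2 * t, ⟨by linarith, by linarith [ht.1]⟩, (edgePath_of_le h).symm⟩
    · exact Or.inr ⟨2 * t - 1, ⟨by linarith, by linarith [ht.2]⟩, (edgePath_of_ge h).symm⟩
  · rintro (⟨s, hs, rfl⟩ | ⟨s, hs, rfl⟩)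
    · refine ⟨(1 - s) / 2, ⟨by linarith [hs.2], by linarith [hs.1]⟩, ?_⟩
      rw [edgePath_of_le (by linarith [hs.1])]; ring_nf
    · refine ⟨(1 + s) / 2, ⟨by linarith [hs.1], by linarith [hs.2]⟩, ?_⟩
      rw [edgePath_of_ge (by linarith [hs.1])]; ring_nf

theorem edgePath_add_deck (hG : H.IsGeneric) {n m : I → ℤ} (hn : H.IsCellVec n)
    (hm : H.IsCellVec m) (w : ℝ × ℝ) (d : ℤ × ℤ) (t : ℝ) :
    H.edgePath (n + H.deck d) (m + H.deck d) (w + deckVec d) t = H.edgePath n m w t + deckVec d := by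
  simp only [edgePath, ctr_add_deck hG hn, ctr_add_deck hG hm, add_sub_add_right_eq_sub]
  abel

omit [Finite I] in
theorem mem_openCell_of_segment {n : I → ℤ} {c w : ℝ × ℝ} (hc : c ∈ H.OpenCell n)
    (hw : w ∈ H.ClosedCell n) {a : ℝ} (ha : 0 < a) (ha1 : a ≤ 1) :
    w + a • (c - w) ∈ H.OpenCell n := by
  rw [mem_openCell_iff] at *
  rw [mem_closedCell_iff] at hw
  intro k
  rw [gap_add_smul_sub]
  nlinarith [hw k, hc k, mul_pos ha (hc k), mul_nonneg (sub_nonneg.2 ha1) (hw k)]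

omit [Finite I] in
theorem not_on_of_segment {n : I → ℤ} {c w : ℝ × ℝ} (hc : c ∈ H.OpenCell n)
    (hw : w ∈ H.ClosedCell n) {a : ℝ} (ha : 0 < a) (ha1 : a ≤ 1) (i : I) :
    ¬ H.On i (w + a • (c - w)) := not_on_of_mem_openCell (mem_openCell_of_segment hc hw ha ha1) i

/-- Segments from centers of mass to boundary points meet only if they are equal. -/
theorem halfEdge_unique (hG : H.IsGeneric) {n n' : I → ℤ} (hn : H.IsCellVec n)
    (hn' : H.IsCellVec n') {w w' : ℝ × ℝ} (hw : w ∈ H.ClosedCell n) (hw' : w' ∈ H.ClosedCell n')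
    (ho : ∃ i, H.On i w) (ho' : ∃ i, H.On i w') {a a' : ℝ} (ha : 0 < a) (ha1 : a < 1) (ha' : 0 < a')
    (ha1' : a' ≤ 1) (h : w + a • (H.ctr n - w) = w' + a' • (H.ctr n' - w')) :
    n = n' ∧ w = w' ∧ a = a' := by
  have m1 := mem_openCell_of_segment (ctr_mem hG hn) hw ha ha1.le
  have m2 := mem_openCell_of_segment (ctr_mem hG hn') hw' ha' ha1'
  rw [h] at m1
  have := eq_of_mem_openCell m1 (H.openCell_subset_closedCell _ m2)
  subst this
  obtain ⟨i, hi⟩ := ho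
  obtain ⟨j, hj⟩ := ho'
  obtain ⟨b, hb⟩ := H.exists_gap_eq_zero hw hi
  obtain ⟨c, hc⟩ := H.exists_gap_eq_zero hw' hj
  have key : ∀ k, (1 - a) * (1 - H.ngap n k w) = (1 - a') * (1 - H.ngap n k w') := by
    intro k
    have := congrArg (H.ngap n k) h
    rw [ngap_add_smul_sub, ngap_add_smul_sub, ngap_ctr hG hn] at this
    linarith
  have k1 := key (i, b)
  have k2 := key (j, c)
  rw [(ngap_eq_zero_iff hG hn).2 hb] at k1
  rw [(ngap_eq_zero_iff hG hn).2 hc] at k2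
  have n1 := (mem_closedCell_iff_ngap hG hn).1 hw (j, c)
  have n2 := (mem_closedCell_iff_ngap hG hn).1 hw' (i, b)
  have e : a = a' := by nlinarith
  subst e
  refine ⟨rfl, ?_, rfl⟩
  have h2 : (1 - a) • (w - w') = 0 := by
    have h3 : w + a • (H.ctr n - w) - (w' + a • (H.ctr n - w')) = 0 := sub_eq_zero.2 h
    rw [← h3]; module
  rcases smul_eq_zero.1 h2 with h2 | h2
  · linarith
  · exact sub_eq_zero.1 h2

section
include hT htri

theorem IsTame.edgePath_injective {x x' w w' : ℝ × ℝ} {n m n' m' : I → ℤ}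
    (h : H.IsEdge ι x n m w) (h' : H.IsEdge ι x' n' m' w') {s t : ℝ} (hs : s ∈ Set.Ioo (0 : ℝ) 1)
    (ht : t ∈ Set.Icc (0 : ℝ) 1) (he : H.edgePath n m w s = H.edgePath n' m' w' t) :
    x = x' ∧ s = t := by
  have hG := hT.gen
  obtain ⟨c1, c2, c3, c4, c5, c6, -⟩ := h.spec hT
  obtain ⟨c1', c2', c3', c4', c5', c6', -⟩ := h'.spec hT
  have fin : w = w' → x = x' ∧ n = n' ∧ m = m' := by
    rintro rfl
    have := hT.eq_of_isEdge_same htri h h'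
    subst this
    obtain ⟨e1, e2, -⟩ := hT.isEdge_unique htri h h'
    exact ⟨rfl, e1, e2⟩
  rcases lt_trichotomy s (1 / 2) with hs2 | hs2 | hs2
  · rw [edgePath_of_le hs2.le] at he
    rcases lt_trichotomy t (1 / 2) with ht2 | ht2 | ht2
    · rw [edgePath_of_le ht2.le] at he
      obtain ⟨-, e2, e3⟩ := halfEdge_unique hG c1 c1' c3 c3' c5 c5' (by linarith) (by linarith [hs.1])
        (by linarith) (by linarith [ht.1]) he
      exact ⟨(fin e2).1, by linarith⟩
    · rw [edgePath_of_le ht2.le, ht2] at he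
      norm_num at he
      obtain ⟨i, hi⟩ := c5'
      rw [← he] at hi
      exact absurd hi (not_on_of_segment (ctr_mem hG c1) c3 (by linarith) (by linarith [hs.1]) i)
    · rw [edgePath_of_ge ht2.le] at he
      obtain ⟨e1, e2, e3⟩ := halfEdge_unique hG c1 c2' c3 c4' c5 c5' (by linarith)
        (by linarith [hs.1]) (by linarith) (by linarith [ht.2]) he
      exact absurd ((fin e2).2.1.symm.trans e1) c6'
  · have hz : H.edgePath n m w s = w := by rw [edgePath_of_le hs2.le, hs2]; norm_num
    rw [hz] at he
    obtain ⟨i, hi⟩ := c5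
    rw [he] at hi
    rcases lt_trichotomy t (1 / 2) with ht2 | ht2 | ht2
    · rw [edgePath_of_le ht2.le] at hi
      exact absurd hi (not_on_of_segment (ctr_mem hG c1') c3' (by linarith) (by linarith [ht.1]) i)
    · rw [edgePath_of_le ht2.le, ht2] at he
      norm_num at he
      exact ⟨(fin he).1, hs2.trans ht2.symm⟩
    · rw [edgePath_of_ge ht2.le] at hi
      exact absurd hi (not_on_of_segment (ctr_mem hG c2') c4' (by linarith) (by linarith [ht.2]) i)
  · rw [edgePath_of_ge hs2.le] at he
    rcases lt_trichotomy t (1 / 2) with ht2 | ht2 | ht2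
    · rw [edgePath_of_le ht2.le] at he
      obtain ⟨e1, e2, e3⟩ := halfEdge_unique hG c2 c1' c4 c3' c5 c5' (by linarith)
        (by linarith [hs.2]) (by linarith) (by linarith [ht.1]) he
      exact absurd (e1.symm.trans (fin e2).2.2) c6'
    · rw [edgePath_of_le ht2.le, ht2] at he
      norm_num at he
      obtain ⟨i, hi⟩ := c5'
      rw [← he] at hi
      exact absurd hi (not_on_of_segment (ctr_mem hG c2) c4 (by linarith) (by linarith [hs.2]) i)
    · rw [edgePath_of_ge ht2.le] at he
      obtain ⟨-, e2, e3⟩ := halfEdge_unique hG c2 c2' c4 c4' c5 c5' (by linarith) (by linarith [hs.2])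
        (by linarith) (by linarith [ht.2]) he
      exact ⟨(fin e2).1, by linarith⟩

omit htri in
theorem IsTame.edgePath_ne_ctr {x w : ℝ × ℝ} {n m c : I → ℤ} (h : H.IsEdge ι x n m w)
    (hc : H.IsCellVec c) {s : ℝ} (hs : s ∈ Set.Ioo (0 : ℝ) 1) : H.edgePath n m w s ≠ H.ctr c := by
  have hG := hT.gen
  obtain ⟨c1, c2, c3, c4, c5, c6, -⟩ := h.spec hT
  intro he
  have key : ∀ {n : I → ℤ} {a : ℝ}, H.IsCellVec n → w ∈ H.ClosedCell n → 0 < a → a < 1 →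
      w + a • (H.ctr n - w) ≠ H.ctr c := by
    intro n a hn hw ha ha1 he
    have m1 := mem_openCell_of_segment (ctr_mem hG hn) hw ha ha1.le
    rw [he] at m1
    have := eq_of_mem_openCell m1 (H.openCell_subset_closedCell _ (ctr_mem hG hc))
    subst this
    have h2 : (1 - a) • (w - H.ctr n) = 0 := by
      rw [← sub_eq_zero.2 he]; module
    rcases smul_eq_zero.1 h2 with h2 | h2
    · linarith
    · obtain ⟨i, hi⟩ := c5
      rw [sub_eq_zero.1 h2] at hi
      exact not_on_of_mem_openCell (ctr_mem hG hc) i hi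
  rcases lt_trichotomy s (1 / 2) with hs2 | hs2 | hs2
  · rw [edgePath_of_le hs2.le] at he
    exact key c1 c3 (by linarith) (by linarith [hs.1]) he
  · rw [edgePath_of_le hs2.le, hs2] at he
    norm_num at he
    obtain ⟨i, hi⟩ := c5
    rw [he] at hi
    exact not_on_of_mem_openCell (ctr_mem hG hc) i hi
  · rw [edgePath_of_ge hs2.le] at he
    exact key c2 c4 (by linarith) (by linarith [hs.2]) he

end

end Arrangement

namespace Arrangement

variable {I : Type*} {H : Arrangement I}

/-! ### The retraction in the plane -/

section Defs
variable (H) [Finite I] (ι : H.Cell → ℤ)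

/-- The preimage of the combinatorial coamoeba in the plane. -/
def planeCoamoeba : Set (ℝ × ℝ) := {x | ∃ n, H.idx ι n ≠ 0 ∧ x ∈ H.ClosedCell n}

/-- The preimage of the embedded dimer model in the plane. -/
def planeGraph : Set (ℝ × ℝ) :=
  {z | (∃ n, H.idx ι n ≠ 0 ∧ z = H.ctr n) ∨
    ∃ x n m w, H.IsEdge ι x n m w ∧ z ∈ segment ℝ (H.ctr n) w ∪ segment ℝ w (H.ctr m)}

/-- The side `k` of a cell borders a cell of index zero. -/
def IsFree (n : I → ℤ) (k : I × Bool) : Prop := H.IsCellVec (step n k) ∧ H.idx ι (step n k) = 0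

end Defs

section Collapse
variable (H) [Fintype I] (ι : H.Cell → ℤ)

open Classical in
/-- Collapse of a cell of index `±1` from its free sides; the identity on the other cells. -/
noncomputable def collapse (n : I → ℤ) (x : ℝ × ℝ) : ℝ × ℝ :=
  if |H.idx ι n| = 1 then
    x + ∑ k, (if H.IsFree ι n k then H.bump n k x else 0) • (H.ctr n - H.gate n k)
  else x

/-- The union of the center of mass of a cell and of the segments to the corners at which two free
sides meet. -/
def freeSpokes (n : I → ℤ) : Set (ℝ × ℝ) :=
  {x | x ∈ H.ClosedCell n ∧ (x = H.ctr n ∨ ∃ k k', k ≠ k' ∧ H.IsFree ι n k ∧ H.IsFree ι n k' ∧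
    H.ngap n k x = H.ngap n k' x ∧ ∀ j, H.ngap n k x ≤ H.ngap n j x)}

/-- The cone from the center of mass over a side of a cell. -/
def cone (n : I → ℤ) (k : I × Bool) : Set (ℝ × ℝ) :=
  {x | x ∈ H.ClosedCell n ∧ ∀ j, H.ngap n k x ≤ H.ngap n j x}

open Classical in
/-- The retraction of a triangular cell to a tripod. -/
noncomputable def tripodMap (n : I → ℤ) (x : ℝ × ℝ) : ℝ × ℝ :=
  H.ctr n + ∑ k, (if H.IsCellVec (step n k) then H.bump n k x else 0) • (H.gate n k - H.ctr n)

/-- The retraction of the cone over a side to the segment between centers of mass, which moves the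
endpoints of the side to the center of mass of the adjacent cell. -/
noncomputable def coneMap (n : I → ℤ) (k : I × Bool) (x : ℝ × ℝ) : ℝ × ℝ :=
  H.ngap n k x • H.ctr n + H.bump n k x • H.gate n k +
    (1 - H.ngap n k x - H.bump n k x) • H.ctr (step n k)

/-- The graph of the second stage of the retraction. -/
inductive Folds : ℝ × ℝ → ℝ × ℝ → Prop
  | tripod {n x} : |H.idx ι n| = 2 → x ∈ H.ClosedCell n → Folds x (H.tripodMap n x)
  | cone {n k x} : |H.idx ι n| = 1 → |H.idx ι (step n k)| = 2 → x ∈ H.cone n k →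
      Folds x (H.coneMap n k x)
  | spoke {n x} : |H.idx ι n| = 1 → x ∈ H.freeSpokes ι n → Folds x x

end Collapse

variable [Fintype I] {ι : H.Cell → ℤ}

theorem continuous_collapse (n : I → ℤ) : Continuous (H.collapse ι n) := by
  unfold collapse
  split_ifs
  · refine continuous_id.add (continuous_finsetSum _ fun k _ => ?_)
    split_ifs
    · exact (continuous_bump n k).smul continuous_const
    · simp only [zero_smul]; exact continuous_const
  · exact continuous_id

theorem continuous_tripodMap (n : I → ℤ) : Continuous (H.tripodMap n) := by
  unfold tripodMap
  refine continuous_const.add (continuous_finsetSum _ fun k _ => ?_)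
  split_ifs
  · exact (continuous_bump n k).smul continuous_const
  · simp only [zero_smul]; exact continuous_const

theorem continuous_coneMap (n : I → ℤ) (k : I × Bool) : Continuous (H.coneMap n k) := by
  unfold coneMap
  have := continuous_bump (H := H) n k
  have := continuous_ngap (H := H) n k
  fun_prop

omit [Fintype I] in
theorem isClosed_cone (n : I → ℤ) (k : I × Bool) : IsClosed (H.cone n k) := by
  unfold cone
  simp only [Set.ofPred_and, Set.ofPred_forall]
  exact (H.isClosed_closedCell n).inter
    (isClosed_iInter fun j => isClosed_le (continuous_ngap n k) (continuous_ngap n j))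

theorem isClosed_freeSpokes (n : I → ℤ) : IsClosed (H.freeSpokes ι n) := by
  have : H.freeSpokes ι n = H.ClosedCell n ∩ ({H.ctr n} ∪
      ⋃ k, ⋃ k', ⋃ _ : k ≠ k' ∧ H.IsFree ι n k ∧ H.IsFree ι n k',
        {x | H.ngap n k x = H.ngap n k' x ∧ ∀ j, H.ngap n k x ≤ H.ngap n j x}) := by
    ext x
    simp only [freeSpokes, Set.mem_ofPred_eq, Set.mem_inter_iff, Set.mem_union,
      Set.mem_singleton_iff, Set.mem_iUnion, exists_prop, and_assoc]
  rw [this]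
  refine (H.isClosed_closedCell n).inter (isClosed_singleton.union (isClosed_iUnion_of_finite fun k =>
    isClosed_iUnion_of_finite fun k' => isClosed_iUnion_of_finite fun _ => ?_))
  simp only [Set.ofPred_and, Set.ofPred_forall]
  exact (isClosed_eq (continuous_ngap n k) (continuous_ngap n k')).inter
    (isClosed_iInter fun j => isClosed_le (continuous_ngap n k) (continuous_ngap n j))

theorem bump_ctr (hG : H.IsGeneric) {n : I → ℤ} {k : I × Bool} (hn : H.IsCellVec n)
    (hk : H.IsCellVec (step n k)) : H.bump n k (H.ctr n) = 0 := by
  have := bump_ray hG hn hk (le_refl 0)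
  rwa [zero_smul, add_zero] at this

theorem coneMap_ctr (hG : H.IsGeneric) {n : I → ℤ} {k : I × Bool} (hn : H.IsCellVec n)
    (hk : H.IsCellVec (step n k)) : H.coneMap n k (H.ctr n) = H.ctr n := by
  rw [coneMap, ngap_ctr hG hn, bump_ctr hG hn hk]; simp

/-- The collapse fixes the points at which no free side is a strict minimizer of the normalized
gaps. -/
theorem collapse_eq_self {n : I → ℤ} {x : ℝ × ℝ}
    (h : ∀ k, H.IsFree ι n k → H.bump n k x = 0) : H.collapse ι n x = x := by
  unfold collapse
  split_ifs
  · rw [Finset.sum_eq_zero, add_zero]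
    intro k _
    split_ifs with hk
    · rw [h k hk, zero_smul]
    · rw [zero_smul]
  · rfl

theorem collapse_of_ne {n : I → ℤ} (h : |H.idx ι n| ≠ 1) (x : ℝ × ℝ) : H.collapse ι n x = x :=
  if_neg h

theorem tripodMap_eq_single (hG : H.IsGeneric) {n : I → ℤ} {x : ℝ × ℝ} {k : I × Bool}
    (hn : H.IsCellVec n) (hk : H.IsCellVec (step n k))
    (h : ∀ j, H.ngap n k x ≤ H.ngap n j x) :
    H.tripodMap n x = H.ctr n + H.bump n k x • (H.gate n k - H.ctr n) := by
  unfold tripodMap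
  rw [Finset.sum_eq_single k, if_pos hk]
  · intro j _ hj
    split_ifs with hjs
    · rw [bump_eq_zero hG hn hjs hj.symm (h j), zero_smul]
    · rw [zero_smul]
  · simp

theorem collapse_spec (hG : H.IsGeneric) {n : I → ℤ} (h1 : |H.idx ι n| = 1) {x : ℝ × ℝ}
    (hx : x ∈ H.ClosedCell n) : H.collapse ι n x ∈ H.ClosedCell n ∧
      ∀ k, H.IsFree ι n k → H.bump n k (H.collapse ι n x) = 0 := by
  have hn := isCellVec_of_abs one_pos h1
  by_cases h : ∃ k, H.IsFree ι n k ∧ 0 < H.bump n k x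
  · obtain ⟨k, hk, hpos⟩ := h
    have hs : H.collapse ι n x = x + H.bump n k x • (H.ctr n - H.gate n k) := by
      rw [collapse, if_pos h1, Finset.sum_eq_single k, if_pos hk]
      · intro j _ hj
        split_ifs with hjs
        · rw [bump_eq_zero hG hn hjs.1 hj.symm (lt_of_bump_pos hG hn hk.1 hpos hj).le, zero_smul]
        · rw [zero_smul]
      · simp
    obtain ⟨h2, h3, k', hk', h4⟩ := push_mem hG hn hk.1 hx hpos
    rw [hs]
    refine ⟨h2, fun j hj => ?_⟩
    by_cases hjk : j = k
    · rw [hjk]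
      exact bump_eq_zero hG hn hk.1 hk' h4.le
    · exact bump_eq_zero hG hn hj.1 (Ne.symm hjk) (h3 j)
  · push Not at h
    have h0 : ∀ k, H.IsFree ι n k → H.bump n k x = 0 := fun k hk =>
      le_antisymm (h k hk) (bump_nonneg n k x)
    rw [collapse_eq_self h0]
    exact ⟨hx, h0⟩

theorem exists_le_of_bump_eq_zero (hG : H.IsGeneric) {n : I → ℤ} {k : I × Bool} {x : ℝ × ℝ}
    (hn : H.IsCellVec n) (hk : H.IsCellVec (step n k)) (h : H.bump n k x = 0) :
    ∃ k', k' ≠ k ∧ H.ngap n k' x ≤ H.ngap n k x := by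
  classical
  obtain ⟨k', hk', he⟩ := Finset.exists_mem_eq_inf' (s := Finset.univ.erase k) ⟨rev k, by simp [rev_ne]⟩
    (fun k' => (H.ngap n k' x - H.ngap n k x) / H.ngap n k' (H.gate n k))
  have hne := Finset.ne_of_mem_erase hk'
  refine ⟨k', hne, ?_⟩
  have := max_eq_left_iff.1 h
  rw [he, div_le_iff₀ (ngap_gate_pos hG hn hk hne), zero_mul] at this
  linarith

section Tame
variable (hT : H.IsTame ι)
include hT

/-- At a point of a second closed cell of nonzero index, the collapse is the identity. -/
theorem IsTame.collapse_fix {n m : I → ℤ} {x : ℝ × ℝ} (hn : x ∈ H.ClosedCell n)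
    (hm : x ∈ H.ClosedCell m) (hne : n ≠ m) (h1 : |H.idx ι n| = 1)
    (hm1 : |H.idx ι m| = 1 ∨ |H.idx ι m| = 2) : H.collapse ι n x = x := by
  have hc := isCellVec_of_abs one_pos h1
  have hpos := (mem_closedCell_iff_ngap hT.gen hc).1 hn
  have hz : ∀ {k}, H.gap n k x = 0 → H.ngap n k x = 0 := fun h => (ngap_eq_zero_iff hT.gen hc).2 h
  refine collapse_eq_self fun j hj => ?_
  rcases hm1 with h2 | h2
  · obtain ⟨k, k', hkk, hk, hk', -⟩ := hT.opposite_of_one_one hn hm h1 h2 hne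
    have hkk' : k ≠ k' := fun h => hkk (by rw [h])
    by_cases hjk : k = j
    · exact bump_eq_zero hT.gen hc hj.1 (k' := k') (by rw [← hjk]; exact hkk'.symm)
        (by rw [hz hk']; exact hpos j)
    · exact bump_eq_zero hT.gen hc hj.1 hjk (by rw [hz hk]; exact hpos j)
  · obtain ⟨k, rfl, hk⟩ := hT.adjacent_of_one_two hn hm h1 h2
    refine bump_eq_zero hT.gen hc hj.1 (k' := k) ?_ (by rw [hz hk]; exact hpos j)
    rintro rfl
    rw [hj.2] at h2; norm_num at h2

theorem IsTame.one_or_two {n : I → ℤ} (h : H.idx ι n ≠ 0) : |H.idx ι n| = 1 ∨ |H.idx ι n| = 2 := by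
  have := abs_cases_of_le_two (hT.abs_idx_le n)
  rcases this with h' | h' | h' | h' | h' <;> rw [h'] <;> simp_all

theorem IsTame.collapse_agree {n m : I → ℤ} {x : ℝ × ℝ} (hn : x ∈ H.ClosedCell n)
    (hm : x ∈ H.ClosedCell m) (h1 : H.idx ι n ≠ 0) (h2 : H.idx ι m ≠ 0) :
    H.collapse ι n x = H.collapse ι m x := by
  by_cases hne : n = m
  · rw [hne]
  have key : ∀ {n m : I → ℤ}, x ∈ H.ClosedCell n → x ∈ H.ClosedCell m → n ≠ m → H.idx ι n ≠ 0 →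
      H.idx ι m ≠ 0 → H.collapse ι n x = x := by
    intro n m hn hm hne h1 h2
    rcases hT.one_or_two h1 with h | h
    · exact hT.collapse_fix hn hm hne h (hT.one_or_two h2)
    · exact collapse_of_ne (by rw [h]; norm_num) x
  rw [key hn hm hne h1 h2, key hm hn (Ne.symm hne) h2 h1]

/-- The image of the collapse is the domain of the second stage. -/
theorem IsTame.mem_cone_or_freeSpokes {n : I → ℤ} (h1 : |H.idx ι n| = 1) {x : ℝ × ℝ}
    (hx : x ∈ H.ClosedCell n) (h : ∀ k, H.IsFree ι n k → H.bump n k x = 0) :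
    x ∈ H.freeSpokes ι n ∨ ∃ k, |H.idx ι (step n k)| = 2 ∧ x ∈ H.cone n k := by
  have hG := hT.gen
  have hn := isCellVec_of_abs one_pos h1
  by_cases hxc : x = H.ctr n
  · exact Or.inl ⟨hx, Or.inl hxc⟩
  obtain ⟨i, -⟩ := hG.spans
  obtain ⟨k, -, hk⟩ := Finset.exists_min_image Finset.univ (fun k => H.ngap n k x)
    ⟨(i, true), Finset.mem_univ _⟩
  replace hk : ∀ j, H.ngap n k x ≤ H.ngap n j x := fun j => hk j (Finset.mem_univ _)
  obtain ⟨-, y, hy, hy0, -, hyj⟩ := exists_radial hG hn hxc hk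
  rcases hT.idx_step_zero_or_two hy h1 hy0 with h0 | h0
  · have hf : H.IsFree ι n k := ⟨hT.isCellVec (H.mem_closedCell_step hy hy0), h0⟩
    obtain ⟨k', hk', hle⟩ := exists_le_of_bump_eq_zero hG hn hf.1 (h k hf)
    have he := le_antisymm hle (hk k')
    have hy1 := hyj k' he
    rcases hT.idx_step_zero_or_two hy h1 hy1 with h0' | h0'
    · exact Or.inl ⟨hx, Or.inr ⟨k, k', hk'.symm, hf,
        ⟨hT.isCellVec (H.mem_closedCell_step hy hy1), h0'⟩, he.symm, hk⟩⟩
    · exact Or.inr ⟨k', h0', hx, fun j => he.trans_le (hk j)⟩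
  · exact Or.inr ⟨k, h0, hx, hk⟩

theorem IsTame.not_freeSpokes_of_two {n R : I → ℤ} {x : ℝ × ℝ} (h1 : |H.idx ι n| = 1)
    (hx : x ∈ H.freeSpokes ι n) (h2 : |H.idx ι R| = 2) (hR : x ∈ H.ClosedCell R) : False := by
  have hG := hT.gen
  have hn := isCellVec_of_abs one_pos h1
  obtain ⟨a, rfl, ha⟩ := hT.adjacent_of_one_two hx.1 hR h1 h2
  obtain ⟨hxn, hxc | ⟨k, k', hkk, hk, hk', he, hmin⟩⟩ := hx
  · rw [hxc] at ha
    exact (gap_ctr_pos hG hn a).ne' ha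
  · have h0 : H.ngap n k x = 0 := le_antisymm
      ((hmin a).trans_eq ((ngap_eq_zero_iff hG hn).2 ha)) ((mem_closedCell_iff_ngap hG hn).1 hxn k)
    have g1 := (ngap_eq_zero_iff hG hn).1 h0
    have g2 := (ngap_eq_zero_iff hG hn).1 (he.symm.trans h0)
    have hl : k.1 ≠ k'.1 := fun h => hkk (eq_of_gap_eq_zero h g1 g2)
    rcases sides_eq hG hl g1 g2 ha with rfl | rfl
    · rw [hk.2] at h2; norm_num at h2
    · rw [hk'.2] at h2; norm_num at h2

omit hT in
theorem cone_gap_eq_zero (hG : H.IsGeneric) {n : I → ℤ} {k a : I × Bool} {x : ℝ × ℝ}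
    (hn : H.IsCellVec n) (hx : x ∈ H.cone n k) (ha : H.gap n a x = 0) : H.gap n k x = 0 :=
  (ngap_eq_zero_iff hG hn).1 (le_antisymm
      ((hx.2 a).trans_eq ((ngap_eq_zero_iff hG hn).2 ha))
      ((mem_closedCell_iff_ngap hG hn).1 hx.1 k))

theorem IsTame.coneMap_eq_tripodMap {n R : I → ℤ} {k : I × Bool} {x : ℝ × ℝ} (h1 : |H.idx ι n| = 1)
    (h2 : |H.idx ι (step n k)| = 2) (hx : x ∈ H.cone n k) (h3 : |H.idx ι R| = 2)
    (hR : x ∈ H.ClosedCell R) : H.coneMap n k x = H.tripodMap R x := by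
  have hG := hT.gen
  have hn := isCellVec_of_abs one_pos h1
  obtain ⟨a, rfl, ha⟩ := hT.adjacent_of_one_two hx.1 hR h1 h3
  have g := cone_gap_eq_zero hG hn hx ha
  have := hT.eq_of_two_sides hx.1 h1 g ha h2 h3
  subst this
  have hk := hT.isCellVec hR
  have hk' : H.IsCellVec (step (step n k) (rev k)) := by rwa [step_step_rev]
  rw [tripodMap_eq_single hG hk hk' (k := rev k), bump_step_rev hG hn hk g, gate_step_rev hG hn hk,
    coneMap, (ngap_eq_zero_iff hG hn).2 g]
  · module
  · intro j
    rw [(ngap_eq_zero_iff hG hk).2 (by rw [gap_step_rev, g, neg_zero])]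
    exact (mem_closedCell_iff_ngap hG hk).1 hR j

theorem IsTame.coneMap_eq_coneMap {n m : I → ℤ} {k l : I × Bool} {x : ℝ × ℝ} (h1 : |H.idx ι n| = 1)
    (h2 : |H.idx ι (step n k)| = 2) (hx : x ∈ H.cone n k) (h1' : |H.idx ι m| = 1)
    (h2' : |H.idx ι (step m l)| = 2) (hx' : x ∈ H.cone m l) : H.coneMap n k x = H.coneMap m l x := by
  have hG := hT.gen
  have hn := isCellVec_of_abs one_pos h1
  have hk := isCellVec_of_abs two_pos h2
  have hl := isCellVec_of_abs two_pos h2'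
  by_cases hnm : n = m
  · subst hnm
    by_cases hkl : k = l
    · rw [hkl]
    · have he : H.ngap n l x = H.ngap n k x := le_antisymm (hx'.2 k) (hx.2 l)
      by_cases hxc : x = H.ctr n
      · rw [hxc, coneMap_ctr hG hn hk, coneMap_ctr hG hn hl]
      · obtain ⟨-, y, hy, hy0, -, hyj⟩ := exists_radial hG hn hxc hx.2
        exact absurd (hT.eq_of_two_sides hy h1 hy0 (hyj l he) h2 h2') hkl
  · obtain ⟨a, a', haa, ha, ha', -⟩ := hT.opposite_of_one_one hx.1 hx'.1 h1 h1' hnm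
    have g := cone_gap_eq_zero hG hn hx ha
    have hR := H.mem_closedCell_step hx.1 g
    rw [hT.coneMap_eq_tripodMap h1 h2 hx h2 hR, hT.coneMap_eq_tripodMap h1' h2' hx' h2 hR]

theorem IsTame.coneMap_eq_self {n m : I → ℤ} {k : I × Bool} {x : ℝ × ℝ} (h1 : |H.idx ι n| = 1)
    (h2 : |H.idx ι (step n k)| = 2) (hx : x ∈ H.cone n k) (h1' : |H.idx ι m| = 1)
    (hx' : x ∈ H.freeSpokes ι m) : H.coneMap n k x = x := by
  have hG := hT.gen
  have hn := isCellVec_of_abs one_pos h1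
  have hk := isCellVec_of_abs two_pos h2
  by_cases hnm : n = m
  · subst hnm
    by_cases hxc : x = H.ctr n
    · rw [hxc, coneMap_ctr hG hn hk]
    · obtain ⟨-, hc | ⟨a, a', haa, ha, ha', he, hmin⟩⟩ := hx'
      · exact absurd hc hxc
      exfalso
      obtain ⟨-, y, hy, hy0, -, hyj⟩ := exists_radial hG hn hxc hx.2
      have e1 : H.ngap n a x = H.ngap n k x := le_antisymm (hmin k) (hx.2 a)
      have g1 := hyj a e1
      have g2 := hyj a' (he.symm.trans e1)
      rcases sides_eq hG (fun h => haa (eq_of_gap_eq_zero h g1 g2)) g1 g2 hy0 with rfl | rfl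
      · rw [ha.2] at h2; norm_num at h2
      · rw [ha'.2] at h2; norm_num at h2
  · obtain ⟨a, a', haa, ha, ha', -⟩ := hT.opposite_of_one_one hx.1 hx'.1 h1 h1' hnm
    have g := cone_gap_eq_zero hG hn hx ha
    exact (hT.not_freeSpokes_of_two h1' hx' h2 (H.mem_closedCell_step hx.1 g)).elim

theorem IsTame.folds_unique {x z z' : ℝ × ℝ} (h : H.Folds ι x z) (h' : H.Folds ι x z') : z = z' := by
  cases h with
  | tripod h1 h2 =>
    cases h' with
    | tripod h1' h2' => rw [hT.eq_of_two_two h2 h2' h1 h1']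
    | cone h1' h2' h3' => exact (hT.coneMap_eq_tripodMap h1' h2' h3' h1 h2).symm
    | spoke h1' h2' => exact (hT.not_freeSpokes_of_two h1' h2' h1 h2).elim
  | cone h1 h2 h3 =>
    cases h' with
    | tripod h1' h2' => exact hT.coneMap_eq_tripodMap h1 h2 h3 h1' h2'
    | cone h1' h2' h3' => exact hT.coneMap_eq_coneMap h1 h2 h3 h1' h2' h3'
    | spoke h1' h2' => exact hT.coneMap_eq_self h1 h2 h3 h1' h2'
  | spoke h1 h2 =>
    cases h' with
    | tripod h1' h2' => exact (hT.not_freeSpokes_of_two h1 h2 h1' h2').elim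
    | cone h1' h2' h3' => exact (hT.coneMap_eq_self h1' h2' h3' h1 h2).symm
    | spoke h1' h2' => rfl

end Tame

/-! ### Equivariance -/

theorem IsFree.add_deck_iff {n : I → ℤ} {k : I × Bool} {d : ℤ × ℤ} :
    H.IsFree ι (n + H.deck d) k ↔ H.IsFree ι n k := by
  rw [IsFree, IsFree, step_add, idx_add_deck, isCellVec_add_deck_iff]

theorem collapse_add_deck (hG : H.IsGeneric) (n : I → ℤ) (x : ℝ × ℝ) (d : ℤ × ℤ) :
    H.collapse ι (n + H.deck d) (x + deckVec d) = H.collapse ι n x + deckVec d := by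
  unfold collapse
  rw [idx_add_deck]
  split_ifs with h1
  · have hn := isCellVec_of_abs one_pos h1
    rw [add_right_comm]
    congr 2
    refine Finset.sum_congr rfl fun k _ => ?_
    by_cases hk : H.IsFree ι n k
    · rw [if_pos hk, if_pos (IsFree.add_deck_iff.2 hk), ctr_add_deck hG hn,
        gate_add_deck hG hn hk.1, bump_add_deck hG hn hk.1, add_sub_add_right_eq_sub]
    · rw [if_neg hk, if_neg (by rwa [IsFree.add_deck_iff]), zero_smul, zero_smul]
  · rfl

theorem tripodMap_add_deck (hG : H.IsGeneric) {n : I → ℤ} (hn : H.IsCellVec n) (x : ℝ × ℝ)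
    (d : ℤ × ℤ) : H.tripodMap (n + H.deck d) (x + deckVec d) = H.tripodMap n x + deckVec d := by
  unfold tripodMap
  rw [ctr_add_deck hG hn, add_right_comm]
  congr 2
  refine Finset.sum_congr rfl fun k _ => ?_
  rw [step_add]
  by_cases hk : H.IsCellVec (step n k)
  · rw [if_pos hk, if_pos (hk.add_deck d), gate_add_deck hG hn hk, bump_add_deck hG hn hk,
      add_sub_add_right_eq_sub]
  · rw [if_neg hk, if_neg (by rwa [isCellVec_add_deck_iff]), zero_smul, zero_smul]

theorem coneMap_add_deck (hG : H.IsGeneric) {n : I → ℤ} {k : I × Bool} (hn : H.IsCellVec n)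
    (hk : H.IsCellVec (step n k)) (x : ℝ × ℝ) (d : ℤ × ℤ) :
    H.coneMap (n + H.deck d) k (x + deckVec d) = H.coneMap n k x + deckVec d := by
  unfold coneMap
  rw [step_add, ctr_add_deck hG hn, ctr_add_deck hG hk, gate_add_deck hG hn hk,
    bump_add_deck hG hn hk, ngap_add_deck hG hn]
  module

theorem Folds.add_deckVec (hG : H.IsGeneric) {x z : ℝ × ℝ} (h : H.Folds ι x z) (d : ℤ × ℤ) :
    H.Folds ι (x + deckVec d) (z + deckVec d) := by
  cases h with
  | @tripod n _ h1 h2 =>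
    rw [← tripodMap_add_deck hG (isCellVec_of_abs two_pos h1)]
    exact .tripod (by rwa [idx_add_deck]) (H.mem_closedCell_add_deckVec.2 h2)
  | @cone n k _ h1 h2 h3 =>
    have hn := isCellVec_of_abs one_pos h1
    rw [← coneMap_add_deck hG hn (isCellVec_of_abs two_pos h2)]
    refine .cone (by rwa [idx_add_deck]) (by rwa [step_add, idx_add_deck])
      ⟨H.mem_closedCell_add_deckVec.2 h3.1, fun j => ?_⟩
    rw [ngap_add_deck hG hn, ngap_add_deck hG hn]
    exact h3.2 j
  | @spoke n _ h1 h2 =>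
    have hn := isCellVec_of_abs one_pos h1
    refine .spoke (n := n + H.deck d) (by rwa [idx_add_deck])
      ⟨H.mem_closedCell_add_deckVec.2 h2.1, ?_⟩
    simpa only [ctr_add_deck hG hn, add_left_inj, IsFree.add_deck_iff, ngap_add_deck hG hn]
      using h2.2

end Arrangement

/-! ### Descent of straight line deformations to the torus -/

theorem isStrongDeformationRetract_of_lift {G : Set (ℝ × ℝ)} {X : Set Torus} {r : ℝ × ℝ → ℝ × ℝ}
    (hGX : G ⊆ torusProj ⁻¹' X) (hr : ContinuousOn r (torusProj ⁻¹' X))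
    (heq : ∀ x ∈ torusProj ⁻¹' X, ∀ d, r (x + deckVec d) = r x + deckVec d)
    (hG : ∀ x ∈ torusProj ⁻¹' X, r x ∈ G) (hfix : ∀ x ∈ G, r x = x)
    (hseg : ∀ x ∈ torusProj ⁻¹' X, ∀ t ∈ Set.Icc (0 : ℝ) 1, x + t • (r x - x) ∈ torusProj ⁻¹' X) :
    IsStrongDeformationRetract (torusProj '' G) X := by
  choose σ hσ using torusProj_surjective
  have hσX : ∀ p : X, σ p ∈ torusProj ⁻¹' X := fun p => by
    change torusProj (σ p) ∈ X; rw [hσ]; exact p.2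
  have hind : ∀ x ∈ torusProj ⁻¹' X, ∀ t : ℝ, torusProj (σ (torusProj x) +
      t • (r (σ (torusProj x)) - σ (torusProj x))) = torusProj (x + t • (r x - x)) := by
    intro x hx t
    obtain ⟨d, hd⟩ := torusProj_eq_iff.1 (hσ (torusProj x)).symm
    rw [hd, heq x hx, add_sub_add_right_eq_sub, add_right_comm, torusProj_add_deckVec]
  let F : unitInterval × X → X := fun z =>
    ⟨torusProj (σ z.2 + (z.1 : ℝ) • (r (σ z.2) - σ z.2)), hseg _ (hσX z.2) _ z.1.2⟩
  have hq : IsOpenQuotientMap (X.restrictPreimage torusProj) :=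
    ⟨Set.restrictPreimage_surjective X torusProj_surjective, continuous_torusProj.restrictPreimage,
      isOpenQuotientMap_torusProj.isOpenMap.restrictPreimage X⟩
  have hF : Continuous F := by
    have hcont : Continuous fun z : unitInterval × (torusProj ⁻¹' X) =>
        torusProj ((z.2 : ℝ × ℝ) + (z.1 : ℝ) • (r z.2 - z.2)) := by
      have h1 := continuousOn_iff_continuous_domRestrict.1 hr
      have h2 : Continuous fun z : unitInterval × (torusProj ⁻¹' X) => r z.2 :=
        h1.comp continuous_snd
      refine continuous_torusProj.comp ?_
      have h3 : Continuous fun z : unitInterval × (torusProj ⁻¹' X) => (z.2 : ℝ × ℝ) := by fun_prop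
      have h4 : Continuous fun z : unitInterval × (torusProj ⁻¹' X) => (z.1 : ℝ) := by fun_prop
      exact h3.add (h4.smul (h2.sub h3))
    refine (IsOpenQuotientMap.isQuotientMap (IsOpenQuotientMap.id.prodMap hq)).continuous_iff.2 ?_
    rw [continuous_induced_rng]
    refine hcont.congr fun z => ?_
    exact (hind z.2 z.2.2 z.1).symm
  refine ⟨?_, ⟨fun p => F (1, p), hF.comp (by fun_prop)⟩, fun p => ?_, ⟨⟨⟨⟨F, hF⟩, fun p => ?_,
    fun p => rfl⟩, fun t p hp => ?_⟩⟩⟩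
  · rintro _ ⟨x, hx, rfl⟩
    exact hGX hx
  · refine ⟨r (σ p), hG _ (hσX p), ?_⟩
    simp [F]
  · apply Subtype.ext
    simp [F, hσ]
  · obtain ⟨x, hx, hxp⟩ := hp
    apply Subtype.ext
    change torusProj (σ p + (t : ℝ) • (r (σ p) - σ p)) = p
    rw [← hxp, hind x (hGX hx), hfix x hx]
    simp

namespace Arrangement

variable {I : Type*} {H : Arrangement I}

theorem locallyFinite_of_subset_closedCell [Finite I] {J : Type*} [Finite J]
    {K : (I → ℤ) × J → Set (ℝ × ℝ)} (hK : ∀ j, K j ⊆ H.ClosedCell j.1) : LocallyFinite K := by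
  intro x
  refine ⟨{y | ∀ i, H.height i y ∈ Set.Ioo (H.height i x - 1) (H.height i x + 1)}, ?_, ?_⟩
  · refine IsOpen.mem_nhds ?_ fun i => ⟨by linarith, by linarith⟩
    simp only [Set.ofPred_forall]
    exact isOpen_iInter_of_finite fun i => isOpen_Ioo.preimage (H.continuous_height i)
  · have hfin : {n : I → ℤ | ∀ i, n i ∈ Set.Icc (⌊H.height i x⌋ - 2) (⌈H.height i x⌉ + 1)}.Finite :=
      Set.Finite.pi' fun i => Set.finite_Icc _ _
    refine (hfin.prod (Set.finite_univ (α := J))).subset ?_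
    rintro ⟨n, j⟩ ⟨y, hy, hy'⟩
    refine ⟨fun i => ?_, trivial⟩
    have h1 := hK _ hy i
    have h2 := hy' i
    simp only at h1
    constructor
    · have h3 : (⌊H.height i x⌋ : ℝ) < n i + 2 := by linarith [Int.floor_le (H.height i x), h2.1]
      have h4 : ⌊H.height i x⌋ < n i + 2 := by exact_mod_cast h3
      simp only; omega
    · have h3 : (n i : ℝ) < ⌈H.height i x⌉ + 1 := by linarith [Int.le_ceil (H.height i x), h2.2]
      have h4 : n i < ⌈H.height i x⌉ + 1 := by exact_mod_cast h3
      simp only; omega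

/-- The union of two adjacent closed cells is convex. -/
theorem convex_union_step (H : Arrangement I) (n : I → ℤ) (k : I × Bool) :
    Convex ℝ (H.ClosedCell n ∪ H.ClosedCell (step n k)) := by
  have : H.ClosedCell n ∪ H.ClosedCell (step n k) =
      {x | -1 ≤ H.gap n k x ∧ ∀ k', k' ≠ k → 0 ≤ H.gap n k' x} := by
    ext x
    simp only [Set.mem_union, mem_closedCell_iff, Set.mem_ofPred_eq]
    have hcase : ∀ k', k' = k ∨ k' = rev k ∨ k'.1 ≠ k.1 := by
      intro k'
      by_cases h : k'.1 = k.1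
      · rcases k with ⟨i, b⟩; rcases k' with ⟨j, c⟩
        simp only at h; subst h
        cases b <;> cases c <;> simp [rev]
      · exact Or.inr (Or.inr h)
    have hr := H.gap_add_gap_rev n k x
    constructor
    · rintro (h | h)
      · exact ⟨by linarith [h k], fun k' _ => h k'⟩
      · have h1 := h k
        have h2 := h (rev k)
        rw [gap_step_same] at h1
        rw [gap_step_rev] at h2
        refine ⟨by linarith, fun k' hk' => ?_⟩
        rcases hcase k' with rfl | rfl | hc
        · exact absurd rfl hk'
        · linarith
        · have := h k'; rwa [gap_step_of_ne _ _ hc] at this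
    · rintro ⟨h1, h2⟩
      rcases le_total 0 (H.gap n k x) with h | h
      · left
        intro k'
        by_cases hk : k' = k
        · rwa [hk]
        · exact h2 k' hk
      · right
        intro k'
        rcases hcase k' with rfl | rfl | hc
        · rw [gap_step_same]; linarith
        · rw [gap_step_rev]; linarith
        · rw [gap_step_of_ne _ _ hc]; exact h2 k' fun h => hc (by rw [h])
  rw [this]
  rintro x ⟨hx, hx'⟩ y ⟨hy, hy'⟩ a b ha hb hab
  refine ⟨?_, fun k' hk' => ?_⟩
  · rw [gap_combo _ _ _ _ _ hab]; nlinarith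
  · rw [gap_combo _ _ _ _ _ hab]
    have := hx' k' hk'; have := hy' k' hk'
    positivity

theorem segment_subset_union {E : Type*} [AddCommGroup E] [Module ℝ E] {a b m : E}
    (hm : m ∈ segment ℝ a b) : segment ℝ a b ⊆ segment ℝ a m ∪ segment ℝ m b := by
  rw [segment_eq_image'] at hm
  obtain ⟨τ, ⟨h0, h1⟩, rfl⟩ := hm
  intro z hz
  rw [segment_eq_image'] at hz
  obtain ⟨s, ⟨h2, h3⟩, rfl⟩ := hz
  rcases le_total s τ with h | h
  · left
    rw [segment_eq_image']
    rcases h0.eq_or_lt with h4 | h4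
    · subst h4
      have : s = 0 := le_antisymm h h2
      subst this
      exact ⟨0, ⟨le_rfl, zero_le_one⟩, by simp⟩
    · refine ⟨s / τ, ⟨by positivity, by rw [div_le_one h4]; exact h⟩, ?_⟩
      simp only [add_sub_cancel_left, smul_smul]
      rw [div_mul_cancel₀ _ h4.ne']
  · right
    rw [segment_symm, segment_eq_image']
    rcases h1.eq_or_lt with h4 | h4
    · subst h4
      have : s = 1 := le_antisymm h3 h
      subst this
      exact ⟨0, ⟨le_rfl, zero_le_one⟩, by simp⟩
    · have h5 : 0 < 1 - τ := by linarith
      refine ⟨(1 - s) / (1 - τ), ⟨div_nonneg (by linarith) h5.le, by rw [div_le_one h5]; linarith⟩, ?_⟩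
      have h6 : (a + τ • (b - a)) - b = -((1 - τ) • (b - a)) := by module
      simp only [h6, smul_neg, smul_smul]
      rw [div_mul_cancel₀ _ h5.ne']
      module

section Retraction

variable [Fintype I] {ι : H.Cell → ℤ}

theorem IsFree.sg_eq_idx (hT : H.IsTame ι) {n : I → ℤ} {k : I × Bool} {x : ℝ × ℝ} (hx : x ∈ H.ClosedCell n)
    (hk : H.gap n k x = 0) : H.IsFree ι n k ↔ sg k.2 = H.idx ι n := by
  have h1 := hT.idx_step hx hk
  have h2 := hT.isCellVec (H.mem_closedCell_step hx hk)
  rw [IsFree, and_iff_right h2, h1]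
  omega

/-- The star edge through a given side of a triangular cell. -/
theorem IsTame.exists_star (hT : H.IsTame ι) (htri : ∀ P, |ι P| = 2 → H.IsTriangle P) {n : I → ℤ}
    {k : I × Bool} (h2 : |H.idx ι n| = 2) (hk : H.IsCellVec (step n k)) :
    ∃ x, H.IsEdge ι x n (step n k) (H.gate n k) := by
  have hn := isCellVec_of_abs two_pos h2
  obtain ⟨b, p, lam, ht, -⟩ := hT.exists_isTri htri h2
  obtain ⟨a, rfl⟩ := ht.side _ (gate_mem hT.gen hn hk) k (gap_gate hT.gen hn hk)
  exact ⟨p a, .star (ht.crosses a) (ht.mem a) h2 hk fun h => (ht.gap_iff _ _).1 h rfl⟩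

theorem tripodMap_eq_ctr {n : I → ℤ} {x : ℝ × ℝ}
    (h : ∀ k, H.IsCellVec (step n k) → H.bump n k x = 0) : H.tripodMap n x = H.ctr n := by
  unfold tripodMap
  rw [Finset.sum_eq_zero, add_zero]
  intro k _
  split_ifs with hk
  · rw [h k hk, zero_smul]
  · rw [zero_smul]

section
variable (hT : H.IsTame ι) (htri : ∀ P, |ι P| = 2 → H.IsTriangle P)
include hT

theorem tripodMap_cases {n : I → ℤ} {x : ℝ × ℝ} (h2 : |H.idx ι n| = 2) (hx : x ∈ H.ClosedCell n) :
    H.tripodMap n x = H.ctr n ∨ ∃ k, H.IsCellVec (step n k) ∧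
      H.tripodMap n x ∈ segment ℝ (H.ctr n) (H.gate n k) := by
  have hG := hT.gen
  have hn := isCellVec_of_abs two_pos h2
  by_cases h : ∃ k, H.IsCellVec (step n k) ∧ 0 < H.bump n k x
  · obtain ⟨k, hk, hpos⟩ := h
    have hmin : ∀ j, H.ngap n k x ≤ H.ngap n j x := by
      intro j
      by_cases hj : j = k
      · rw [hj]
      · exact (lt_of_bump_pos hG hn hk hpos hj).le
    refine Or.inr ⟨k, hk, ?_⟩
    rw [tripodMap_eq_single hG hn hk hmin, segment_eq_image']
    refine ⟨_, ⟨hpos.le, ?_⟩, rfl⟩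
    have := (mem_closedCell_iff_ngap hG hn).1 hx k
    linarith [bump_le_one_sub hG hn hk hmin]
  · push Not at h
    exact Or.inl (tripodMap_eq_ctr fun k hk => le_antisymm (h k hk) (bump_nonneg n k x))

theorem tripodMap_mem {n : I → ℤ} {x : ℝ × ℝ} (h2 : |H.idx ι n| = 2) (hx : x ∈ H.ClosedCell n) :
    H.tripodMap n x ∈ H.ClosedCell n := by
  have hn := isCellVec_of_abs two_pos h2
  have hc := H.openCell_subset_closedCell _ (ctr_mem hT.gen hn)
  rcases tripodMap_cases hT h2 hx with h | ⟨k, hk, h⟩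
  · rw [h]; exact hc
  · exact (H.convex_closedCell n).segment_subset hc (gate_mem hT.gen hn hk) h

theorem coneMap_mem_segment {n : I → ℤ} {k : I × Bool} {x : ℝ × ℝ} (hn : H.IsCellVec n)
    (hk : H.IsCellVec (step n k)) (hx : x ∈ H.cone n k) :
    H.coneMap n k x ∈ segment ℝ (H.ctr n) (H.ctr (step n k)) := by
  have hG := hT.gen
  have h1 := bump_le_one_sub hG hn hk hx.2
  have h2 := (mem_closedCell_iff_ngap hG hn).1 hx.1 k
  have h3 := bump_nonneg (H := H) n k x
  have h4 := gate_mem_segment hG hn hk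
  rw [segment_eq_image'] at h4
  obtain ⟨τ, hτ, h4⟩ := h4
  rw [coneMap, ← h4, segment_eq_image']
  refine ⟨H.bump n k x * τ + (1 - H.ngap n k x - H.bump n k x), ⟨?_, ?_⟩, ?_⟩
  · nlinarith [mul_nonneg h3 hτ.1]
  · nlinarith [mul_nonneg h3 (sub_nonneg.2 hτ.2)]
  · module

/-- The image of the second stage lies in the graph. -/
theorem Folds.mem_planeGraph (htri : ∀ P, |ι P| = 2 → H.IsTriangle P) {x z : ℝ × ℝ} (h : H.Folds ι x z) : z ∈ H.planeGraph ι := by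
  have hG := hT.gen
  cases h with
  | @tripod n _ h1 h2 =>
    rcases tripodMap_cases hT h1 h2 with h | ⟨k, hk, h⟩
    · exact Or.inl ⟨n, by intro h0; rw [h0] at h1; norm_num at h1, h⟩
    · obtain ⟨y, hy⟩ := hT.exists_star htri h1 hk
      exact Or.inr ⟨y, _, _, _, hy, Or.inl h⟩
  | @cone n k _ h1 h2 h3 =>
    have hn := isCellVec_of_abs one_pos h1
    have hk := isCellVec_of_abs two_pos h2
    obtain ⟨y, hy⟩ := hT.exists_star htri h2 (k := rev k) (by rwa [step_step_rev])
    rw [step_step_rev, gate_step_rev hG hn hk] at hy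
    refine Or.inr ⟨y, _, _, _, hy, ?_⟩
    have hz := coneMap_mem_segment hT hn hk h3
    rw [segment_symm] at hz
    have hg := gate_mem_segment hG hn hk
    rw [segment_symm] at hg
    exact segment_subset_union hg hz
  | @spoke n _ h1 h2 =>
    have hn := isCellVec_of_abs one_pos h1
    obtain ⟨hx, h | ⟨k, k', hkk, hk, hk', he, hmin⟩⟩ := h2
    · exact Or.inl ⟨n, by intro h0; rw [h0] at h1; norm_num at h1, h⟩
    by_cases hxc : x = H.ctr n
    · exact Or.inl ⟨n, by intro h0; rw [h0] at h1; norm_num at h1, hxc⟩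
    obtain ⟨hlt, y, hy, hy0, hxy, hyj⟩ := exists_radial hG hn hxc hmin
    have hy1 := hyj k' he.symm
    have s1 := (IsFree.sg_eq_idx hT hy hy0).1 hk
    have s2 := (IsFree.sg_eq_idx hT hy hy1).1 hk'
    have hl : k.1 ≠ k'.1 := fun h => hkk (eq_of_gap_eq_zero h hy0 hy1)
    have ho := hT.idx_step_step hl hy hy0 hy1
    have hm := H.mem_closedCell_step (H.mem_closedCell_step hy hy0)
      (k := k') (by rwa [gap_step_of_ne _ _ hl.symm])
    have hseg : x ∈ segment ℝ (H.ctr n) y := by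
      rw [segment_eq_image']
      refine ⟨1 - H.ngap n k x, ⟨by linarith, ?_⟩, hxy.symm⟩
      have := (mem_closedCell_iff_ngap hG hn).1 hx k
      linarith
    rw [s1, s2] at ho
    rcases (abs_eq (by norm_num)).1 h1 with h | h
    · refine Or.inr ⟨y, _, n, y, .point hm hy (by omega) h, Or.inr ?_⟩
      rwa [segment_symm]
    · exact Or.inr ⟨y, n, _, y, .point hy hm h (by omega), Or.inl hseg⟩

/-- The first stage is the identity on the graph, and so is the second one. -/
theorem folds_of_mem_planeGraph {z : ℝ × ℝ} (hz : z ∈ H.planeGraph ι) :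
    ∃ n, H.idx ι n ≠ 0 ∧ z ∈ H.ClosedCell n ∧ H.collapse ι n z = z ∧ H.Folds ι z z := by
  have hG := hT.gen
  have center : ∀ n, H.idx ι n ≠ 0 → z = H.ctr n →
      ∃ n, H.idx ι n ≠ 0 ∧ z ∈ H.ClosedCell n ∧ H.collapse ι n z = z ∧ H.Folds ι z z := by
    rintro n h0 rfl
    have hn := isCellVec_of_idx_ne_zero h0
    have hm := H.openCell_subset_closedCell _ (ctr_mem hG hn)
    refine ⟨n, h0, hm, collapse_eq_self fun k hk => bump_ctr hG hn hk.1, ?_⟩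
    rcases hT.one_or_two h0 with h | h
    · exact .spoke h ⟨hm, Or.inl rfl⟩
    · have := Folds.tripod h hm
      rwa [tripodMap_eq_ctr fun k hk => bump_ctr hG hn hk] at this
  have half : ∀ n w, |H.idx ι n| = 1 → w ∈ H.ClosedCell n → (∃ k k', k.1 ≠ k'.1 ∧ H.gap n k w = 0 ∧
      H.gap n k' w = 0 ∧ H.IsFree ι n k ∧ H.IsFree ι n k') → z ∈ segment ℝ (H.ctr n) w →
      ∃ n, H.idx ι n ≠ 0 ∧ z ∈ H.ClosedCell n ∧ H.collapse ι n z = z ∧ H.Folds ι z z := by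
    rintro n w h1 hw ⟨k, k', hkk, hk, hk', hf, hf'⟩ hz
    have hn := isCellVec_of_abs one_pos h1
    have hzm := (H.convex_closedCell n).segment_subset
      (H.openCell_subset_closedCell _ (ctr_mem hG hn)) hw hz
    rw [segment_eq_image'] at hz
    obtain ⟨ρ, hρ, hz⟩ := hz
    have hng : ∀ j, H.ngap n j z = 1 + ρ * (H.ngap n j w - 1) := fun j => by
      rw [← hz, ngap_add_smul_sub, ngap_ctr hG hn]
    have g1 := (ngap_eq_zero_iff hG hn).2 hk
    have g2 := (ngap_eq_zero_iff hG hn).2 hk'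
    have hmin : ∀ j, H.ngap n k z ≤ H.ngap n j z := by
      intro j
      have := (mem_closedCell_iff_ngap hG hn).1 hw j
      rw [hng, hng, g1]
      nlinarith [hρ.1]
    have he : H.ngap n k z = H.ngap n k' z := by rw [hng, hng, g1, g2]
    have hne : k ≠ k' := fun h => hkk (by rw [h])
    refine ⟨n, by intro h0; rw [h0] at h1; norm_num at h1, hzm, collapse_eq_self fun j hj => ?_,
      .spoke h1 ⟨hzm, Or.inr ⟨k, k', hne, hf, hf', he, hmin⟩⟩⟩
    by_cases hjk : k = j
    · exact bump_eq_zero hG hn hj.1 (k' := k') (by rw [← hjk]; exact hne.symm)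
        (by rw [← he]; exact hmin j)
    · exact bump_eq_zero hG hn hj.1 hjk (hmin j)
  rcases hz with ⟨n, h0, hz⟩ | ⟨x, n, m, w, he, hz⟩
  · exact center n h0 hz
  cases he with
  | point h1 h2 h3 h4 =>
    have nm : n ≠ m := by rintro rfl; omega
    have key : ∀ {n m : I → ℤ}, x ∈ H.ClosedCell n → x ∈ H.ClosedCell m → |H.idx ι n| = 1 →
        H.idx ι m = -H.idx ι n → n ≠ m → ∃ k k', k.1 ≠ k'.1 ∧ H.gap n k x = 0 ∧
        H.gap n k' x = 0 ∧ H.IsFree ι n k ∧ H.IsFree ι n k' := by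
      intro n m hn hm h h' hne
      obtain ⟨k, k', hkk, hk, hk', rfl⟩ := hT.opposite_of_one_one hn hm h (by rw [h', abs_neg, h]) hne
      have ho := hT.idx_step_step hkk hn hk hk'
      refine ⟨k, k', hkk, hk, hk', (IsFree.sg_eq_idx hT hn hk).2 ?_,
        (IsFree.sg_eq_idx hT hn hk').2 ?_⟩ <;>
      rcases sg_eq k.2 with e | e <;> rcases sg_eq k'.2 with e' | e' <;>
        rcases (abs_eq (by norm_num)).1 h with e'' | e'' <;> omega
    have a3 : |H.idx ι n| = 1 := by rw [h3]; rfl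
    have a4 : |H.idx ι m| = 1 := by rw [h4]; rfl
    rcases hz with hz | hz
    · exact half n _ a3 h1 (key h1 h2 a3 (by rw [h3, h4]; rfl) nm) hz
    · rw [segment_symm] at hz
      exact half m _ a4 h2 (key h2 h1 a4 (by rw [h3, h4]) nm.symm) hz
  | @star k h1 h2 h3 h4 h5 =>
    have hn := isCellVec_of_abs two_pos h3
    have hm0 := gate_mem hG hn h4
    have g0 := gap_gate hG hn h4
    rcases hz with hz | hz
    · have hzm := (H.convex_closedCell n).segment_subset
        (H.openCell_subset_closedCell _ (ctr_mem hG hn)) hm0 hz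
      rw [segment_eq_image'] at hz
      obtain ⟨ρ, hρ, hz⟩ := hz
      refine ⟨n, by intro h0; rw [h0] at h3; norm_num at h3, hzm,
        collapse_of_ne (by rw [h3]; norm_num) z, ?_⟩
      have := Folds.tripod h3 hzm
      have hb : H.bump n k z = ρ := by rw [← hz]; exact bump_ray hG hn h4 hρ.1
      have hz' : H.ctr n + ρ • (H.gate n k - H.ctr n) = z := hz
      rwa [tripodMap_eq_single hG hn h4 (k := k), hb, hz'] at this
      intro j
      have := (mem_closedCell_iff_ngap hG hn).1 hm0 j
      rw [← hz, ngap_add_smul_sub, ngap_add_smul_sub, ngap_ctr hG hn, ngap_ctr hG hn,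
        ngap_gate hG hn h4]
      nlinarith [hρ.1]
    · have h6 := (hT.abs_idx_step_two hm0 h3 g0).1
      have hk' : H.IsCellVec (step (step n k) (rev k)) := by rwa [step_step_rev]
      have hg := gate_step_rev hG hn h4
      have hm1 := gate_mem hG h4 hk'
      rw [segment_symm, ← hg] at hz
      have hzm := (H.convex_closedCell _).segment_subset
        (H.openCell_subset_closedCell _ (ctr_mem hG h4)) hm1 hz
      rw [segment_eq_image'] at hz
      obtain ⟨ρ, hρ, hz⟩ := hz
      have hmin : ∀ j, H.ngap (step n k) (rev k) z ≤ H.ngap (step n k) j z := by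
        intro j
        have := (mem_closedCell_iff_ngap hG h4).1 hm1 j
        rw [← hz, ngap_add_smul_sub, ngap_add_smul_sub, ngap_ctr hG h4, ngap_ctr hG h4,
          ngap_gate hG h4 hk']
        nlinarith [hρ.1]
      refine ⟨step n k, by intro h0; rw [h0] at h6; norm_num at h6, hzm,
        collapse_eq_self fun j hj => bump_eq_zero hG h4 hj.1 (k' := rev k) ?_ (hmin j), ?_⟩
      · rintro rfl
        have := hj.2
        rw [step_step_rev] at this
        rw [this] at h3; norm_num at h3
      · have := Folds.cone (ι := ι) h6 (k := rev k) (by rwa [step_step_rev]) ⟨hzm, hmin⟩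
        rw [coneMap] at this
        rw [← hz] at this ⊢
        rw [bump_ray hG h4 hk' hρ.1, ngap_add_smul_sub, ngap_ctr hG h4, ngap_gate hG h4 hk'] at this
        convert this using 1
        module

end

/-! ### The retraction -/

open Classical in
/-- The first stage of the retraction. -/
noncomputable def stageOne (ι : H.Cell → ℤ) (x : ℝ × ℝ) : ℝ × ℝ :=
  if h : ∃ n, H.idx ι n ≠ 0 ∧ x ∈ H.ClosedCell n then H.collapse ι h.choose x else x

open Classical in
/-- The second stage of the retraction. -/
noncomputable def stageTwo (ι : H.Cell → ℤ) (x : ℝ × ℝ) : ℝ × ℝ :=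
  if h : ∃ z, H.Folds ι x z then h.choose else x

variable (hT : H.IsTame ι) (htri : ∀ P, |ι P| = 2 → H.IsTriangle P)
include hT

theorem IsTame.stageOne_eq {n : I → ℤ} {x : ℝ × ℝ} (h0 : H.idx ι n ≠ 0) (hx : x ∈ H.ClosedCell n) :
    stageOne ι x = H.collapse ι n x := by
  have h : ∃ n, H.idx ι n ≠ 0 ∧ x ∈ H.ClosedCell n := ⟨n, h0, hx⟩
  rw [stageOne, dif_pos h]
  exact hT.collapse_agree h.choose_spec.2 hx h.choose_spec.1 h0

theorem IsTame.stageTwo_eq {x z : ℝ × ℝ} (h : H.Folds ι x z) : stageTwo ι x = z := by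
  have h' : ∃ z, H.Folds ι x z := ⟨z, h⟩
  rw [stageTwo, dif_pos h']
  exact hT.folds_unique h'.choose_spec h

open Classical in
theorem IsTame.continuousOn_stageOne : ContinuousOn (stageOne ι) (H.planeCoamoeba ι) := by
  let K : (I → ℤ) × Unit → Set (ℝ × ℝ) := fun j => if H.idx ι j.1 ≠ 0 then H.ClosedCell j.1 else ∅
  have hK : H.planeCoamoeba ι = ⋃ j, K j := by
    ext x
    simp only [planeCoamoeba, Set.mem_ofPred_eq, Set.mem_iUnion, K]
    constructor
    · rintro ⟨n, h0, hx⟩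
      exact ⟨(n, ()), by rwa [if_pos h0]⟩
    · rintro ⟨j, hj⟩
      split_ifs at hj with h
      · exact ⟨j.1, h, hj⟩
      · exact hj.elim
  rw [hK]
  refine LocallyFinite.continuousOn_iUnion (H.locallyFinite_of_subset_closedCell fun j => ?_)
    (fun j => ?_) fun j => ?_
  · simp only [K]; split_ifs
    · exact subset_rfl
    · exact Set.empty_subset _
  · simp only [K]; split_ifs
    · exact H.isClosed_closedCell _
    · exact isClosed_empty
  · simp only [K]; split_ifs with h
    · exact (continuous_collapse j.1).continuousOn.congr fun x hx => hT.stageOne_eq h hx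
    · exact continuousOn_empty _

open Classical in
theorem IsTame.continuousOn_stageTwo : ContinuousOn (stageTwo ι) {x | ∃ z, H.Folds ι x z} := by
  let K : (I → ℤ) × Option (I × Bool) → Set (ℝ × ℝ) := fun j => match j.2 with
    | none => if |H.idx ι j.1| = 2 then H.ClosedCell j.1 else
        if |H.idx ι j.1| = 1 then H.freeSpokes ι j.1 else ∅
    | some k => if |H.idx ι j.1| = 1 ∧ |H.idx ι (step j.1 k)| = 2 then H.cone j.1 k else ∅
  have hK : {x | ∃ z, H.Folds ι x z} ⊆ ⋃ j, K j := by
    rintro x ⟨z, hz⟩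
    rw [Set.mem_iUnion]
    cases hz with
    | @tripod n _ h1 h2 => exact ⟨(n, none), by simp only [K]; rwa [if_pos h1]⟩
    | @cone n k _ h1 h2 h3 => exact ⟨(n, some k), by simp only [K]; rwa [if_pos ⟨h1, h2⟩]⟩
    | @spoke n _ h1 h2 =>
      exact ⟨(n, none), by simp only [K]; rwa [if_neg (by rw [h1]; norm_num), if_pos h1]⟩
  refine ContinuousOn.mono ?_ hK
  refine LocallyFinite.continuousOn_iUnion (H.locallyFinite_of_subset_closedCell ?_) ?_ ?_
  · rintro ⟨n, _ | k⟩
    · simp only [K]; split_ifs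
      · exact subset_rfl
      · exact fun x hx => hx.1
      · exact Set.empty_subset _
    · simp only [K]; split_ifs
      · exact fun x hx => hx.1
      · exact Set.empty_subset _
  · rintro ⟨n, _ | k⟩
    · simp only [K]; split_ifs
      · exact H.isClosed_closedCell _
      · exact isClosed_freeSpokes _
      · exact isClosed_empty
    · simp only [K]; split_ifs
      · exact isClosed_cone _ _
      · exact isClosed_empty
  · rintro ⟨n, _ | k⟩
    · simp only [K]; split_ifs with h h'
      · exact (continuous_tripodMap n).continuousOn.congr fun x hx =>
          hT.stageTwo_eq (.tripod h hx)
      · exact continuousOn_id.congr fun x hx => hT.stageTwo_eq (.spoke h' hx)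
      · exact continuousOn_empty _
    · simp only [K]; split_ifs with h
      · exact (continuous_coneMap n k).continuousOn.congr fun x hx =>
          hT.stageTwo_eq (.cone h.1 h.2 hx)
      · exact continuousOn_empty _

theorem IsTame.stageOne_mem {n : I → ℤ} {x : ℝ × ℝ} (h0 : H.idx ι n ≠ 0) (hx : x ∈ H.ClosedCell n) :
    ∃ z, H.Folds ι (stageOne ι x) z ∧ (z ∈ H.ClosedCell n ∨
      ∃ k, |H.idx ι (step n k)| = 2 ∧ z ∈ H.ClosedCell n ∪ H.ClosedCell (step n k)) := by
  have hG := hT.gen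
  have hn := isCellVec_of_idx_ne_zero h0
  rw [hT.stageOne_eq h0 hx]
  rcases hT.one_or_two h0 with h | h
  · obtain ⟨h1, h2⟩ := collapse_spec hG h hx
    rcases hT.mem_cone_or_freeSpokes h h1 h2 with h3 | ⟨k, hk, h3⟩
    · exact ⟨_, .spoke h h3, Or.inl h1⟩
    · refine ⟨_, .cone h hk h3, Or.inr ⟨k, hk, ?_⟩⟩
      have hkc := isCellVec_of_abs two_pos hk
      refine (H.convex_union_step n k).segment_subset
        (Or.inl (H.openCell_subset_closedCell _ (ctr_mem hG hn)))
        (Or.inr (H.openCell_subset_closedCell _ (ctr_mem hG hkc)))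
        (coneMap_mem_segment hT hn hkc h3)
  · rw [collapse_of_ne (by rw [h]; norm_num)]
    exact ⟨_, .tripod h hx, Or.inl (tripodMap_mem hT h hx)⟩

include htri in
theorem IsTame.isStrongDeformationRetract {X : Set Torus}
    (hX : torusProj ⁻¹' X = H.planeCoamoeba ι) :
    IsStrongDeformationRetract (torusProj '' H.planeGraph ι) X := by
  have hG := hT.gen
  refine isStrongDeformationRetract_of_lift (r := stageTwo ι ∘ stageOne ι) ?_ ?_ ?_ ?_ ?_ ?_
  all_goals rw [hX] at *
  · intro z hz
    obtain ⟨n, h0, h1, -⟩ := folds_of_mem_planeGraph hT hz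
    exact ⟨n, h0, h1⟩
  · refine hT.continuousOn_stageTwo.comp hT.continuousOn_stageOne ?_
    rintro x ⟨n, h0, hx⟩
    obtain ⟨z, hz, -⟩ := hT.stageOne_mem h0 hx
    exact ⟨z, hz⟩
  · rintro x ⟨n, h0, hx⟩ d
    obtain ⟨z, hz, -⟩ := hT.stageOne_mem h0 hx
    have h1 : stageOne ι (x + deckVec d) = stageOne ι x + deckVec d := by
      rw [hT.stageOne_eq h0 hx, hT.stageOne_eq (n := n + H.deck d) (by rwa [idx_add_deck])
        (H.mem_closedCell_add_deckVec.2 hx), collapse_add_deck hG]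
    rw [Function.comp_apply, Function.comp_apply, h1, hT.stageTwo_eq hz,
      hT.stageTwo_eq (hz.add_deckVec hG d)]
  · rintro x ⟨n, h0, hx⟩
    obtain ⟨z, hz, -⟩ := hT.stageOne_mem h0 hx
    rw [Function.comp_apply, hT.stageTwo_eq hz]
    exact hz.mem_planeGraph hT htri
  · intro z hz
    obtain ⟨n, h0, h1, h2, h3⟩ := folds_of_mem_planeGraph hT hz
    rw [Function.comp_apply, hT.stageOne_eq h0 h1, h2, hT.stageTwo_eq h3]
  · rintro x ⟨n, h0, hx⟩ t ht
    obtain ⟨z, hz, hcase⟩ := hT.stageOne_mem h0 hx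
    rw [Function.comp_apply, hT.stageTwo_eq hz]
    have hmem : x + t • (z - x) ∈ segment ℝ x z := by
      rw [segment_eq_image']; exact ⟨t, ht, rfl⟩
    rcases hcase with h | ⟨k, hk, h⟩
    · exact ⟨n, h0, (H.convex_closedCell n).segment_subset hx h hmem⟩
    · rcases (H.convex_union_step n k).segment_subset (Or.inl hx) h hmem with h' | h'
      · exact ⟨n, h0, h'⟩
      · exact ⟨step n k, by intro h0; rw [h0] at hk; norm_num at hk, h'⟩

end Retraction

end Arrangement

namespace Arrangement

variable {I : Type*} {H : Arrangement I}

/-! ### Crossings in the torus and in the plane -/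

theorem secVec_eq_iff {x u : ℝ × ℝ} (hu : ∀ i, H.On i x → H.slope i u ≠ 0) {m : I → ℤ} :
    H.secVec x u = m ↔
      x ∈ H.ClosedCell m ∧ ∀ k, H.gap m k x = 0 → sg k.2 * H.slope k.1 u < 0 := by
  constructor
  · rintro rfl
    refine ⟨H.mem_closedCell_secVec x u, ?_⟩
    rintro ⟨i, b⟩ hk
    have hne := hu i (H.on_of_gap_eq_zero hk)
    by_cases hpos : 0 < H.slope i u
    · cases b
      · simpa [sg] using hpos
      · simp only [gap, secVec, if_pos hpos] at hk
        have := Int.lt_floor_add_one (H.height i x)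
        simp at hk; linarith
    · have hneg : H.slope i u < 0 := lt_of_le_of_ne (not_lt.1 hpos) hne
      cases b
      · simp only [gap, secVec, if_neg hpos] at hk
        have := Int.ceil_lt_add_one (H.height i x)
        simp at hk; linarith
      · simpa [sg] using hneg
  · rintro ⟨hm, hs⟩
    funext i
    have h1 := hm i
    by_cases ho : H.On i x
    · obtain ⟨b, hb⟩ := H.exists_gap_eq_zero hm ho
      have h2 := hs _ hb
      cases b
      · have hb : H.height i x = m i := by simp [gap] at hb; linarith
        have h2 : 0 < H.slope i u := by simpa [sg] using h2
        simp [secVec, h2, hb]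
      · have hb : H.height i x = (m i + 1 : ℤ) := by simp [gap] at hb; push_cast; linarith
        have h2 : H.slope i u < 0 := by simpa [sg] using h2
        simp only [secVec, if_neg h2.le.not_gt, hb, Int.ceil_intCast]; ring
    · have h2 : H.height i x ≠ m i := fun h => ho ⟨_, h⟩
      have h3 : H.height i x ≠ m i + 1 := fun h => ho ⟨m i + 1, by rw [h]; push_cast; rfl⟩
      have h4 := lt_of_le_of_ne h1.1 h2.symm
      have h5 := lt_of_le_of_ne h1.2 h3
      have h6 : ⌊H.height i x⌋ = m i := Int.floor_eq_iff.2 ⟨h1.1, h5⟩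
      have h7 : ⌈H.height i x⌉ = m i + 1 :=
        Int.ceil_eq_iff.2 ⟨by push_cast; linarith, by push_cast; linarith⟩
      simp [secVec, h6, h7]

theorem secVec_neg_eq (hG : H.IsGeneric) {x u : ℝ × ℝ} (hu : ∀ i, H.On i x → H.slope i u ≠ 0)
    {n : I → ℤ} (hn : H.secVec x u = n) {k k' : I × Bool} (hkk : k.1 ≠ k'.1)
    (hk : H.gap n k x = 0) (hk' : H.gap n k' x = 0) :
    H.secVec x (-u) = step (step n k) k' := by
  have hu' : ∀ i, H.On i x → H.slope i (-u) ≠ 0 := fun i hi => by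
    rw [slope_neg]; exact neg_ne_zero.2 (hu i hi)
  obtain ⟨hx, hs⟩ := (secVec_eq_iff hu).1 hn
  have hk2 : H.gap (step n k) k' x = 0 := by rwa [gap_step_of_ne _ _ hkk.symm]
  have r1 : H.gap (step (step n k) k') (rev k) x = 0 := by
    rw [gap_step_of_ne _ _ (by exact hkk), gap_step_rev, hk, neg_zero]
  have r2 : H.gap (step (step n k) k') (rev k') x = 0 := by rw [gap_step_rev, hk2, neg_zero]
  refine (secVec_eq_iff hu').2
    ⟨H.mem_closedCell_step (H.mem_closedCell_step hx hk) hk2, fun a ha => ?_⟩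
  rcases sides_eq hG (by exact hkk) r1 r2 ha with rfl | rfl <;>
    simp only [rev, sg_not, slope_neg] <;> push_cast
  · linarith [hs k hk]
  · linarith [hs k' hk']

theorem Crossing.crosses (c : H.Crossing) {x : ℝ × ℝ} (hx : torusProj x = c.pt) :
    c.fst ≠ c.snd ∧ H.On c.fst x ∧ H.On c.snd x := by
  refine ⟨fun h => ?_, H.mem_carrier_iff.1 (hx ▸ c.mem_fst), H.mem_carrier_iff.1 (hx ▸ c.mem_snd)⟩
  have := c.cross_pos
  rw [h, cross_self] at this
  exact this.false

theorem Crossing.crosses_lift (c : H.Crossing) {x : ℝ × ℝ} (hx : torusProj x = c.pt) :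
    H.Crosses x := ⟨_, _, c.crosses hx⟩

theorem Crossing.on_iff (hG : H.IsGeneric) (c : H.Crossing) {x : ℝ × ℝ} (hx : torusProj x = c.pt)
    {i : I} : H.On i x ↔ i = c.fst ∨ i = c.snd := by
  obtain ⟨h1, h2, h3⟩ := c.crosses hx
  constructor
  · intro h
    rcases eq_of_on_three hG.simple h2 h3 h with e | e | e
    · exact absurd e h1
    · exact Or.inr e.symm
    · exact Or.inl e.symm
  · rintro (rfl | rfl) <;> assumption

theorem Crossing.isTransverse_iff (hG : H.IsGeneric) (c : H.Crossing) {x u : ℝ × ℝ}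
    (hx : torusProj x = c.pt) : c.IsTransverse u ↔ ∀ i, H.On i x → H.slope i u ≠ 0 := by
  simp only [c.on_iff hG hx, forall_eq_or_imp, forall_eq, Ne, slope_eq_zero_iff, IsTransverse]

theorem Crossing.eq_of_pt_eq (hG : H.IsGeneric) {c d : H.Crossing} (h : c.pt = d.pt) : c = d := by
  obtain ⟨x, hx⟩ := torusProj_surjective c.pt
  obtain ⟨h1, h2, h3⟩ := c.crosses hx
  rw [d.on_iff hG (hx.trans h)] at h2 h3
  have p1 := c.cross_pos
  have p2 := d.cross_pos
  rcases c with ⟨i, j, p, _, _, _⟩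
  rcases d with ⟨i', j', p', _, _, _⟩
  simp only at *
  rcases h2 with rfl | rfl <;> rcases h3 with rfl | rfl
  · exact absurd rfl h1
  · subst h; rfl
  · rw [cross_swap] at p1; linarith
  · exact absurd rfl h1

theorem Crosses.exists_crossing (hG : H.IsGeneric) {x : ℝ × ℝ} (h : H.Crosses x) :
    ∃ c : H.Crossing, torusProj x = c.pt := by
  obtain ⟨i, j, hij, hi, hj⟩ := h
  rcases (cross_ne_zero_of_on hG hij hi hj).lt_or_gt with h | h
  · exact ⟨⟨j, i, torusProj x, by rw [cross_swap]; linarith, H.mem_carrier_iff.2 hj,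
      H.mem_carrier_iff.2 hi⟩, rfl⟩
  · exact ⟨⟨i, j, torusProj x, h, H.mem_carrier_iff.2 hi, H.mem_carrier_iff.2 hj⟩, rfl⟩

variable [Finite I]

theorem Crossing.isCorner_iff (hG : H.IsGeneric) (c : H.Crossing) {x : ℝ × ℝ}
    (hx : torusProj x = c.pt) {P : H.Cell} :
    c.IsCorner P ↔ ∃ n, H.Over n P ∧ x ∈ H.ClosedCell n := by
  constructor
  · rintro ⟨u, hu, hP⟩
    rw [c.isTransverse_iff hG hx] at hu
    rw [← hx, over_secVec hG hu] at hP
    exact ⟨_, hP, H.mem_closedCell_secVec x u⟩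
  · rintro ⟨n, hn, hxn⟩
    obtain ⟨u, hu, rfl⟩ := exists_secVec_eq hG hxn
    refine ⟨u, (c.isTransverse_iff hG hx).2 hu, ?_⟩
    rwa [← hx, over_secVec hG hu]

theorem Crossing.isOpposite_iff (hG : H.IsGeneric) (c : H.Crossing) {x : ℝ × ℝ}
    (hx : torusProj x = c.pt) {P Q : H.Cell} :
    c.IsOpposite P Q ↔ ∃ n k k', k.1 ≠ k'.1 ∧ x ∈ H.ClosedCell n ∧ H.gap n k x = 0 ∧
      H.gap n k' x = 0 ∧ H.Over n P ∧ H.Over (step (step n k) k') Q := by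
  have neg : ∀ {u}, (∀ i, H.On i x → H.slope i u ≠ 0) → ∀ i, H.On i x → H.slope i (-u) ≠ 0 :=
    fun hu i hi => by rw [slope_neg]; exact neg_ne_zero.2 (hu i hi)
  constructor
  · rintro ⟨u, hu, hP, hQ⟩
    rw [c.isTransverse_iff hG hx] at hu
    rw [← hx, over_secVec hG hu] at hP
    rw [← hx, over_secVec hG (neg hu)] at hQ
    have hxn := H.mem_closedCell_secVec x u
    obtain ⟨k, k', hkk, hk, hk'⟩ := (c.crosses_lift hx).exists_sides hxn
    rw [secVec_neg_eq hG hu rfl hkk hk hk'] at hQ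
    exact ⟨_, k, k', hkk, hxn, hk, hk', hP, hQ⟩
  · rintro ⟨n, k, k', hkk, hxn, hk, hk', hP, hQ⟩
    obtain ⟨u, hu, hun⟩ := exists_secVec_eq hG hxn
    refine ⟨u, (c.isTransverse_iff hG hx).2 hu, ?_, ?_⟩
    · rwa [← hx, over_secVec hG hu, hun]
    · rwa [← hx, over_secVec hG (neg hu), secVec_neg_eq hG hu hun hkk hk hk']

/-- The two sectors at a crossing between which a directed edge would run. -/
theorem Crossing.isFromTo_iff (hG : H.IsGeneric) (c : H.Crossing) {x : ℝ × ℝ}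
    (hx : torusProj x = c.pt) {X Y : H.Cell} :
    c.IsFromTo X Y ↔ H.Over (H.secVec x (-((H c.fst).tangent + (H c.snd).tangent))) X ∧
      H.Over (H.secVec x ((H c.fst).tangent + (H c.snd).tangent)) Y := by
  have hu : ∀ i, H.On i x → H.slope i ((H c.fst).tangent + (H c.snd).tangent) ≠ 0 := by
    have := c.cross_pos
    simp only [c.on_iff hG hx, forall_eq_or_imp, forall_eq, Ne, slope_eq_zero_iff, cross_add_right,
      cross_self, zero_add, add_zero]
    refine ⟨this.ne', ?_⟩
    rw [cross_swap]
    exact (neg_lt_zero.2 this).ne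
  have hu' : ∀ i, H.On i x → H.slope i (-((H c.fst).tangent + (H c.snd).tangent)) ≠ 0 :=
    fun i hi => by rw [slope_neg]; exact neg_ne_zero.2 (hu i hi)
  rw [IsFromTo, ← hx, over_secVec hG hu, over_secVec hG hu']

/-! ### The edges of the dimer model in the torus -/

/-- The two cells of index `-1` and `1` meet at the crossing `c`. -/
def PointEdge (ι : H.Cell → ℤ) (c : H.Crossing) (X Y : H.Cell) : Prop :=
  ∃ x n m, torusProj x = c.pt ∧ x ∈ H.ClosedCell n ∧ x ∈ H.ClosedCell m ∧ H.idx ι n = -1 ∧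
    H.idx ι m = 1 ∧ H.Over n X ∧ H.Over m Y

/-- `c` is the corner of the triangle `P` opposite to the side along which `Q` is adjacent. -/
def StarEdge (ι : H.Cell → ℤ) (c : H.Crossing) (P Q : H.Cell) : Prop :=
  ∃ x n k, torusProj x = c.pt ∧ x ∈ H.ClosedCell n ∧ |H.idx ι n| = 2 ∧ H.IsCellVec (step n k) ∧
    H.gap n k x ≠ 0 ∧ H.Over n P ∧ H.Over (step n k) Q

/-- The index graph after the Yang–Baxter modifications at the cells in `S`. -/
def dimerGraph (ι : H.Cell → ℤ) (S : Set H.Cell) : MixedGraph H.Cell H.Crossing where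
  W := {P | ι P = 1} ∪ {P | P ∈ S ∧ ι P = -2}
  B := {P | ι P = -1} ∪ {P | P ∈ S ∧ ι P = 2}
  U := {a | ∃ c X Y, a = (c, s(X, Y)) ∧ PointEdge ι c X Y} ∪
    {a | ∃ c P Q, a = (c, s(P, Q)) ∧ P ∈ S ∧ StarEdge ι c P Q}
  D := {a | a ∈ (H.indexGraph ι).D ∧ ∀ P ∈ S, ¬ a.1.IsCorner P}

/-- The corners `c i` of the triangle `P`, and the adjacent cells `N i` across the opposite sides. -/
structure IsStar (ι : H.Cell → ℤ) (P : H.Cell) (c : Fin 3 → H.Crossing) (N : Fin 3 → H.Cell) :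
    Prop where
  injective : Function.Injective c
  corner_iff : ∀ d : H.Crossing, d.IsCorner P ↔ ∃ i, d = c i
  fromTo_iff : ∀ i X Y, (c i).IsFromTo X Y ↔ X = N (i + 1) ∧ Y = N (i + 2)
  index : ∀ i, ι P = 2 * ι (N i)
  starEdge_iff : ∀ d Q, StarEdge ι d P Q ↔ ∃ i, d = c i ∧ Q = N i

section Tame

variable {ι : H.Cell → ℤ} (hT : H.IsTame ι) (htri : ∀ P, |ι P| = 2 → H.IsTriangle P)
include hT

omit [Finite I] in
/-- The cells at a corner of a triangle between which the directed edge runs. -/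
theorem IsTri.secVec_eq {n : I → ℤ} {b : Bool} {p : Fin 3 → ℝ × ℝ} {lam : Fin 3 → I}
    (h : H.IsTri n b p lam) (i : Fin 3) {c : H.Crossing} (hc : torusProj (p i) = c.pt) :
    H.secVec (p i) (-((H c.fst).tangent + (H c.snd).tangent)) = step n (lam (i + 1), b) ∧
      H.secVec (p i) ((H c.fst).tangent + (H c.snd).tangent) = step n (lam (i + 2), b) := by
  have hG := hT.gen
  obtain ⟨n1, n2, n3⟩ := fin_three_ne i
  have z1 : H.gap n (lam (i + 1), b) (p i) = 0 := (h.gap_iff i (i + 1)).2 n1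
  have z2 : H.gap n (lam (i + 2), b) (p i) = 0 := (h.gap_iff i (i + 2)).2 n2
  have hl : lam (i + 1) ≠ lam (i + 2) := fun e => n3 (h.lam_injective e)
  have hv : (H c.fst).tangent + (H c.snd).tangent =
      (H (lam (i + 1))).tangent + (H (lam (i + 2))).tangent := by
    rcases (c.on_iff hG hc).1 (H.on_of_gap_eq_zero z1) with e | e <;>
      rcases (c.on_iff hG hc).1 (H.on_of_gap_eq_zero z2) with e' | e' <;>
      simp only at e e'
    · exact absurd (e.trans e'.symm) hl
    · rw [e, e']
    · rw [e, e', add_comm]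
    · exact absurd (e.trans e'.symm) hl
  rw [hv]
  set v := (H (lam (i + 1))).tangent + (H (lam (i + 2))).tangent with hv
  have hor := h.orient i
  have h2 : 0 < sg b * H.slope (lam (i + 2)) v := by
    rw [slope, hv, cross_add_right, cross_self, add_zero, ← mul_div_assoc]
    positivity
  have h1 : sg b * H.slope (lam (i + 1)) v < 0 := by
    rw [slope, hv, cross_add_right, cross_self, zero_add, ← mul_div_assoc, cross_swap, mul_neg,
      neg_div, neg_lt_zero]
    positivity
  have hu : ∀ j, H.On j (p i) → H.slope j v ≠ 0 := by
    intro j hj h0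
    rcases eq_of_on_three hG.simple (H.on_of_gap_eq_zero z1) (H.on_of_gap_eq_zero z2) hj
      with e | e | e
    · exact hl e
    · simp only at e; rw [e, h0, mul_zero] at h2; exact h2.false
    · simp only at e; rw [e, h0, mul_zero] at h1; exact h1.false
  have key : ∀ {k k' : I × Bool} {u : ℝ × ℝ}, k.1 ≠ k'.1 → H.gap n k (p i) = 0 →
      H.gap n k' (p i) = 0 → (∀ j, H.On j (p i) → H.slope j u ≠ 0) →
      0 < sg k.2 * H.slope k.1 u → sg k'.2 * H.slope k'.1 u < 0 →
      H.secVec (p i) u = step n k := by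
    intro k k' u hkk hk hk' hu h1 h2
    refine (secVec_eq_iff hu).2 ⟨H.mem_closedCell_step (h.mem i) hk, fun a ha => ?_⟩
    have r1 : H.gap (step n k) (rev k) (p i) = 0 := by rw [gap_step_rev, hk, neg_zero]
    have r2 : H.gap (step n k) k' (p i) = 0 := by rwa [gap_step_of_ne _ _ hkk.symm]
    rcases sides_eq hG (by exact hkk) r1 r2 ha with rfl | rfl
    · simp only [rev, sg_not]; push_cast; linarith
    · exact h2
  refine ⟨key hl z1 z2 (fun j hj => ?_) ?_ ?_, key hl.symm z2 z1 hu h2 h1⟩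
  · rw [slope_neg]; exact neg_ne_zero.2 (hu j hj)
  · simp only [slope_neg]; linarith
  · simp only [slope_neg]; linarith

theorem IsTame.eq_of_isCorner {d : H.Crossing} {P Q : H.Cell} (hP : |ι P| = 2) (hQ : |ι Q| = 2)
    (h : d.IsCorner P) (h' : d.IsCorner Q) : P = Q := by
  obtain ⟨x, hx⟩ := torusProj_surjective d.pt
  obtain ⟨n, hn, hxn⟩ := (d.isCorner_iff hT.gen hx).1 h
  obtain ⟨m, hm, hxm⟩ := (d.isCorner_iff hT.gen hx).1 h'
  have := hT.eq_of_two_two hxn hxm (by rwa [hn.idx_eq]) (by rwa [hm.idx_eq])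
  subst this
  exact hn.eq hm

include htri

theorem IsTame.exists_isStar {P : H.Cell} (h2 : |ι P| = 2) : ∃ c N, IsStar ι P c N := by
  have hG := hT.gen
  obtain ⟨n, hn⟩ := exists_over P
  have h2n : |H.idx ι n| = 2 := by rwa [hn.idx_eq]
  obtain ⟨b, p, lam, ht, hidx⟩ := hT.exists_isTri htri h2n
  have hside : ∀ i, H.IsCellVec (step n (lam i, b)) ∧
      H.idx ι (step n (lam i, b)) = H.idx ι n - sg b := fun i => by
    have h0 := (ht.gap_iff (i + 1) i).2 (fin_three_ne i).1.symm
    exact ⟨hT.isCellVec (H.mem_closedCell_step (ht.mem _) h0), hT.idx_step (ht.mem _) h0⟩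
  choose c hc using fun i => (ht.crosses i).exists_crossing hG
  choose N hN using fun i => exists_cell_over (hside i).1
  have shift : ∀ {d : H.Crossing} {x : ℝ × ℝ} {m : I → ℤ}, torusProj x = d.pt →
      x ∈ H.ClosedCell m → H.Over m P → ∃ i e, d = c i ∧ m = n + H.deck e ∧ x = p i + deckVec e := by
    intro d x m hx hxm hm
    obtain ⟨e, rfl⟩ := hn.exists_deck hm
    have hx' : x - deckVec e + deckVec e = x := sub_add_cancel _ _
    rw [← hx', mem_closedCell_add_deckVec] at hxm
    have hpt : torusProj (x - deckVec e) = d.pt := by rw [← hx, ← hx', torusProj_add_deckVec, hx']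
    obtain ⟨i, hi⟩ := ht.exists_eq_vertex hG hxm (d.crosses_lift hpt)
    refine ⟨i, e, Crossing.eq_of_pt_eq hG ?_, rfl, by rw [← hi, hx']⟩
    rw [← hpt, ← hc, hi]
  refine ⟨c, N, ⟨fun i j hij => ?_, fun d => ⟨fun hd => ?_, ?_⟩, fun i X Y => ?_, fun i => ?_,
    fun d Q => ⟨?_, ?_⟩⟩⟩
  · by_contra hne
    obtain ⟨e, he⟩ := torusProj_eq_iff.1
      ((hc j).trans ((congrArg Crossing.pt hij.symm).trans (hc i).symm))
    obtain ⟨n1, n2, n3⟩ := fin_three_ne i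
    have h0 := H.on_of_gap_eq_zero ((ht.gap_iff j i).2 hne)
    have h1 := H.on_of_gap_eq_zero ((ht.gap_iff i (i + 1)).2 n1)
    have h2 := H.on_of_gap_eq_zero ((ht.gap_iff i (i + 2)).2 n2)
    have h0 := h0.add_deckVec e
    rw [← he] at h0
    rcases eq_of_on_three hG.simple h0 h1 h2 with h | h | h
    · exact n1 (ht.lam_injective h.symm)
    · exact n3 (ht.lam_injective h)
    · exact n2 (ht.lam_injective h.symm)
  · obtain ⟨x, hx⟩ := torusProj_surjective d.pt
    obtain ⟨m, hm, hxm⟩ := (d.isCorner_iff hG hx).1 hd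
    obtain ⟨i, -, hi, -⟩ := shift hx hxm hm
    exact ⟨i, hi⟩
  · rintro ⟨i, rfl⟩
    exact (Crossing.isCorner_iff hG _ (hc i)).2 ⟨n, hn, ht.mem i⟩
  · obtain ⟨e1, e2⟩ := ht.secVec_eq hT i (hc i)
    rw [Crossing.isFromTo_iff hG _ (hc i), e1, e2]
    constructor
    · rintro ⟨hX, hY⟩
      exact ⟨hX.eq (hN _), hY.eq (hN _)⟩
    · rintro ⟨rfl, rfl⟩
      exact ⟨hN _, hN _⟩
  · rw [← hn.idx_eq (ι := ι), ← (hN i).idx_eq (ι := ι), (hside i).2, hidx]; ring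
  · rintro ⟨x, m, k, hx, hxm, -, hk, h0, hP, hQ⟩
    obtain ⟨i, e, hi, rfl, rfl⟩ := shift hx hxm hP
    refine ⟨i, hi, ?_⟩
    rw [step_add] at hQ hk
    rw [gap_add_deckVec] at h0
    rw [isCellVec_add_deck_iff] at hk
    have hcv := isCellVec_of_abs two_pos h2n
    obtain ⟨j, rfl⟩ := ht.side _ (gate_mem hG hcv hk) k (gap_gate hG hcv hk)
    rw [Ne, ht.gap_iff, not_not] at h0
    subst h0
    exact hQ.eq ((hN j).add_deck e)
  · rintro ⟨i, rfl, rfl⟩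
    exact ⟨p i, n, (lam i, b), hc i, ht.mem i, h2n, (hside i).1,
      fun h0 => (ht.gap_iff _ _).1 h0 rfl, hn, hN i⟩

end Tame
end Arrangement

namespace Arrangement

/-- In any labelling of the directed triangle by its corners, the vertex opposite to an edge is the
cell opposite to the corner. -/
theorem opposite_of_triangle {V : Type*} {N v : Fin 3 → V} {σ : Fin 3 → Fin 3}
    (hσ : Function.Injective σ) (h1 : ∀ i, v i = N (σ i + 1)) (h2 : ∀ i, v (i + 1) = N (σ i + 2))
    (i : Fin 3) : v (i + 2) = N (σ i) := by
  obtain ⟨a1, a2, a3, -⟩ := fin_three_add i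
  have b := fun j => fin_three_add (σ j)
  have e1 := h1 i
  have e1' := h1 (i + 1)
  have e1'' := h1 (i + 2)
  have e2 := h2 i
  have e2' := h2 (i + 1)
  have e2'' := h2 (i + 2)
  rw [a1] at e2'
  rw [a3] at e2''
  obtain ⟨n1, n2, n3⟩ := fin_three_ne i
  have m1 := hσ.ne n1
  have m2 := hσ.ne n2
  have m3 := hσ.ne n3
  generalize σ i = p at *
  generalize σ (i + 1) = q at *
  generalize σ (i + 2) = r at *
  rcases fin_three_cases p q with rfl | rfl | rfl
  · exact absurd rfl m1
  · rw [e2', (fin_three_add p).2.1]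
  · have : r = p + 1 := by
      rcases fin_three_cases p r with rfl | rfl | rfl
      · exact absurd rfl m2
      · rfl
      · exact absurd rfl m3
    subst this
    have c1 : v i = N p := by rw [e2'', (fin_three_add p).2.1]
    rw [e1''] at *
    rw [(fin_three_add p).1, ← e2, e1', (fin_three_add p).2.2.1]

variable {I : Type*} {H : Arrangement I} [Finite I] {ι : H.Cell → ℤ}

/-! ### The sequence of Yang–Baxter modifications -/

theorem finite_cell : Finite H.Cell := by
  have hK : IsCompact (Set.Icc (0 : ℝ × ℝ) (2 * Real.pi, 2 * Real.pi)) := isCompact_Icc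
  have hb : ∀ i, ∃ M : ℤ, ∀ x ∈ Set.Icc (0 : ℝ × ℝ) (2 * Real.pi, 2 * Real.pi), |H.height i x| ≤ M := by
    intro i
    obtain ⟨C, hC⟩ := hK.exists_bound_of_continuousOn (H.continuous_height i).continuousOn
    exact ⟨⌈C⌉, fun x hx => (hC x hx).trans (Int.le_ceil C)⟩
  choose M hM using hb
  have hrep : ∀ P : H.Cell, ∃ n, H.Over n P ∧ ∀ i, n i ∈ Set.Icc (-M i - 1) (M i) := by
    intro P
    obtain ⟨n, hn⟩ := exists_over P
    obtain ⟨x, hx⟩ := hn.1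
    have h0 := Real.two_pi_pos
    let e : ℤ × ℤ := (-⌊x.1 / (2 * Real.pi)⌋, -⌊x.2 / (2 * Real.pi)⌋)
    have hf : ∀ t : ℝ, 0 ≤ t + ((-⌊t / (2 * Real.pi)⌋ : ℤ) : ℝ) * (2 * Real.pi) ∧
        t + ((-⌊t / (2 * Real.pi)⌋ : ℤ) : ℝ) * (2 * Real.pi) ≤ 2 * Real.pi := by
      intro t
      have h1 := (le_div_iff₀ h0).1 (Int.floor_le (t / (2 * Real.pi)))
      have h2 := (div_lt_iff₀ h0).1 (Int.lt_floor_add_one (t / (2 * Real.pi)))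
      push_cast
      constructor <;> linarith
    have hx' : x + deckVec e ∈ Set.Icc (0 : ℝ × ℝ) (2 * Real.pi, 2 * Real.pi) :=
      ⟨⟨(hf x.1).1, (hf x.2).1⟩, ⟨(hf x.1).2, (hf x.2).2⟩⟩
    refine ⟨n + H.deck e, hn.add_deck e, fun i => ?_⟩
    have h1 := (H.mem_openCell_add_deckVec (d := e)).2 hx i
    have h2 := abs_le.1 (hM i _ hx')
    constructor
    · have : (-M i : ℝ) - 1 < ((n + H.deck e) i : ℤ) := by linarith [h1.2]
      have : -M i - 1 < (n + H.deck e) i := by exact_mod_cast this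
      omega
    · have : (((n + H.deck e) i : ℤ) : ℝ) ≤ M i := by linarith [h1.1]
      exact_mod_cast this
  choose f hf hf' using hrep
  have hfin : {n : I → ℤ | ∀ i, n i ∈ Set.Icc (-M i - 1) (M i)}.Finite :=
    Set.Finite.pi' fun i => Set.finite_Icc _ _
  have := hfin.to_subtype
  refine Finite.of_injective (fun P => (⟨f P, hf' P⟩ : {n : I → ℤ | ∀ i, n i ∈ Set.Icc (-M i - 1) (M i)}))
    fun P Q h => ?_
  have h : f P = f Q := congrArg Subtype.val h
  exact (hf P).eq (h ▸ hf Q)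

variable (hT : H.IsTame ι) (htri : ∀ P, |ι P| = 2 → H.IsTriangle P)

section
include hT

omit [Finite I] in
theorem IsTame.cases (P : H.Cell) : ι P = -2 ∨ ι P = -1 ∨ ι P = 0 ∨ ι P = 1 ∨ ι P = 2 :=
  abs_cases_of_le_two (hT.abs_le P)

omit [Finite I] in
theorem IsTame.odd_iff {P : H.Cell} : Odd (ι P) ↔ |ι P| = 1 := by
  rcases hT.cases P with h | h | h | h | h <;> rw [h] <;> decide

theorem IsTame.pointEdge_of_isOpposite {c : H.Crossing} {P Q : H.Cell} (h : c.IsOpposite P Q)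
    (hP : ι P = -1) (hQ : ι Q = 1) : PointEdge ι c P Q := by
  obtain ⟨x, hx⟩ := torusProj_surjective c.pt
  obtain ⟨n, k, k', hkk, hxn, hk, hk', hn, hm⟩ := (c.isOpposite_iff hT.gen hx).1 h
  exact ⟨x, _, _, hx, hxn, H.mem_closedCell_step (H.mem_closedCell_step hxn hk)
    (by rwa [gap_step_of_ne _ _ hkk.symm]), by rw [hn.idx_eq, hP], by rw [hm.idx_eq, hQ], hn, hm⟩

omit hT [Finite I] in
theorem Crossing.IsOpposite.symm {c : H.Crossing} {P Q : H.Cell} (h : c.IsOpposite P Q) :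
    c.IsOpposite Q P := by
  obtain ⟨u, hu, h1, h2⟩ := h
  refine ⟨-u, ?_, h2, by rwa [neg_neg]⟩
  have hneg : ∀ v, cross v (-u) = -cross v u := fun v => by
    simp only [cross, Prod.fst_neg, Prod.snd_neg]
    ring
  simpa only [IsTransverse, hneg, neg_ne_zero] using hu

omit hT [Finite I] in
theorem Crossing.IsFromTo.isOpposite {c : H.Crossing} {P Q : H.Cell} (h : c.IsFromTo P Q) :
    c.IsOpposite P Q := by
  refine ⟨_, ⟨?_, ?_⟩, h.1, by rw [neg_neg]; exact h.2⟩
  · have := c.cross_pos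
    simp only [cross, Prod.fst_neg, Prod.snd_neg, Prod.fst_add, Prod.snd_add] at this ⊢
    nlinarith
  · have := c.cross_pos
    simp only [cross, Prod.fst_neg, Prod.snd_neg, Prod.fst_add, Prod.snd_add] at this ⊢
    nlinarith

theorem IsTame.isOpposite_of_pointEdge {c : H.Crossing} {P Q : H.Cell} (h : PointEdge ι c P Q) :
    ι P = -1 ∧ ι Q = 1 ∧ c.IsOpposite P Q := by
  obtain ⟨x, n, m, hx, hxn, hxm, h1, h2, hn, hm⟩ := h
  refine ⟨by rw [← hn.idx_eq (ι := ι), h1], by rw [← hm.idx_eq (ι := ι), h2], ?_⟩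
  obtain ⟨k, k', hkk, hk, hk', rfl⟩ := hT.opposite_of_one_one hxn hxm (by rw [h1]; rfl)
    (by rw [h2]; rfl) (by rintro rfl; omega)
  exact (c.isOpposite_iff hT.gen hx).2 ⟨n, k, k', hkk, hxn, hk, hk', hn, hm⟩

theorem IsTame.dimerGraph_empty : dimerGraph ι ∅ = H.indexGraph ι := by
  have hmod : ∀ P, (ι P ≡ 1 [ZMOD 4] ↔ ι P = 1) ∧ (ι P ≡ -1 [ZMOD 4] ↔ ι P = -1) := by
    intro P
    rcases hT.cases P with h | h | h | h | h <;> rw [h] <;> decide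
  ext x
  · simp [dimerGraph, indexGraph, hmod]
  · simp [dimerGraph, indexGraph, hmod]
  · simp only [dimerGraph, indexGraph, Set.mem_empty_iff_false, false_and, and_false, exists_false,
      Set.ofPred_false, Set.union_empty, Set.mem_ofPred_eq]
    constructor
    · rintro ⟨c, X, Y, rfl, h⟩
      obtain ⟨hX, hY, ho⟩ := hT.isOpposite_of_pointEdge h
      exact ⟨c, X, Y, rfl, by rw [hX]; decide, by rw [hY]; decide, by rw [hX, hY]; decide, ho⟩
    · rintro ⟨c, P, Q, rfl, h1, h2, h3, ho⟩
      rw [hT.odd_iff, abs_eq zero_le_one] at h1 h2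
      rcases h1 with h1 | h1 <;> rcases h2 with h2 | h2
      · rw [h1, h2] at h3; exact absurd rfl h3
      · exact ⟨c, Q, P, by rw [Sym2.eq_swap], hT.pointEdge_of_isOpposite ho.symm h2 h1⟩
      · exact ⟨c, P, Q, rfl, hT.pointEdge_of_isOpposite ho h1 h2⟩
      · rw [h1, h2] at h3; exact absurd rfl h3
  · simp [dimerGraph]

omit hT in
theorem IsStar.mem_D {P : H.Cell} {c : Fin 3 → H.Crossing} {N : Fin 3 → H.Cell}
    (hs : IsStar ι P c N) {d : H.Crossing} {X Y : H.Cell} (hd : d.IsCorner P)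
    (h : (d, (X, Y)) ∈ (H.indexGraph ι).D) : ∃ i, d = c i ∧ X = N (i + 1) ∧ Y = N (i + 2) := by
  obtain ⟨i, rfl⟩ := (hs.corner_iff d).1 hd
  obtain ⟨_, _, _, he, -, -, -, hft⟩ := h
  obtain ⟨he', he⟩ := Prod.mk.inj he
  obtain ⟨rfl, rfl⟩ := Prod.mk.inj he
  rw [← he'] at hft
  exact ⟨i, rfl, (hs.fromTo_iff _ _ _).1 hft⟩

variable {S : Set H.Cell}
include htri

theorem IsTame.isYangBaxterAt_iff (hS : ∀ P ∈ S, |ι P| = 2) {P : H.Cell} (hP : |ι P| = 2)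
    (hPS : P ∉ S) {G : MixedGraph H.Cell H.Crossing} :
    H.IsYangBaxterAt P (dimerGraph ι S) G ↔ G = dimerGraph ι (insert P S) := by
  obtain ⟨c, N, hs⟩ := hT.exists_isStar htri hP
  have hU : ∀ a : H.Crossing × Sym2 H.Cell, a ∈ (dimerGraph ι (insert P S)).U ↔
      a ∈ (dimerGraph ι S).U ∪ Set.range fun i => (c i, s(P, N i)) := by
    intro a
    simp only [dimerGraph, Set.mem_union, Set.mem_ofPred_eq, Set.mem_insert_iff, Set.mem_range]
    constructor
    · rintro (h | ⟨d, P', Q, rfl, rfl | h, h'⟩)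
      · exact Or.inl (Or.inl h)
      · obtain ⟨i, rfl, rfl⟩ := (hs.starEdge_iff _ _).1 h'
        exact Or.inr ⟨i, rfl⟩
      · exact Or.inl (Or.inr ⟨_, _, _, rfl, h, h'⟩)
    · rintro ((h | ⟨d, P', Q, rfl, h, h'⟩) | ⟨i, rfl⟩)
      · exact Or.inl h
      · exact Or.inr ⟨_, _, _, rfl, Or.inr h, h'⟩
      · exact Or.inr ⟨_, _, _, rfl, Or.inl rfl, (hs.starEdge_iff _ _).2 ⟨i, rfl, rfl⟩⟩
  have hD : ∀ a : H.Crossing × (H.Cell × H.Cell), a ∈ (dimerGraph ι (insert P S)).D ↔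
      a ∈ (dimerGraph ι S).D \ Set.range fun i => (c i, (N (i + 1), N (i + 2))) := by
    rintro ⟨d, X, Y⟩
    simp only [dimerGraph, Set.mem_ofPred_eq, Set.mem_insert_iff, forall_eq_or_imp, Set.mem_sdiff,
      Set.mem_range, not_exists]
    constructor
    · rintro ⟨h1, h2, h3⟩
      refine ⟨⟨h1, h3⟩, fun i hi => h2 ((hs.corner_iff _).2 ⟨i, ?_⟩)⟩
      exact (Prod.mk.inj hi).1.symm
    · rintro ⟨⟨h1, h3⟩, h2⟩
      refine ⟨h1, fun h => ?_, h3⟩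
      obtain ⟨i, rfl, rfl, rfl⟩ := hs.mem_D h h1
      exact h2 i rfl
  have hN := hs.index
  have h2 : ι P = 2 → (dimerGraph ι (insert P S)).W = (dimerGraph ι S).W ∧
      (dimerGraph ι (insert P S)).B = insert P (dimerGraph ι S).B := by
    intro h
    constructor <;> ext Q <;> by_cases hQ : Q = P <;> simp [dimerGraph, hQ, h, hPS]
  have hm2 : ι P = -2 → (dimerGraph ι (insert P S)).W = insert P (dimerGraph ι S).W ∧
      (dimerGraph ι (insert P S)).B = (dimerGraph ι S).B := by
    intro h
    constructor <;> ext Q <;> by_cases hQ : Q = P <;> simp [dimerGraph, hQ, h, hPS]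
  constructor
  · rintro ⟨e, v, he, hinj, -, hmem, hGU, hGD, hcol⟩
    have hex : ∀ i, ∃ j, e i = c j ∧ v i = N (j + 1) ∧ v (i + 1) = N (j + 2) :=
      fun i => hs.mem_D (he i) (hmem i).1
    choose σ hσ h1 h2' using hex
    have hσi : Function.Injective σ := fun i j hij => hinj (by rw [hσ, hσ, hij])
    have hopp := opposite_of_triangle hσi h1 h2'
    have hσs := Finite.surjective_of_injective hσi
    have r1 : (Set.range fun i => (e i, s(P, v (i + 2)))) = Set.range fun i => (c i, s(P, N i)) := by
      rw [← hσs.range_comp fun i => (c i, s(P, N i))]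
      congr 1; funext i
      simp only [Function.comp, hσ, hopp]
    have r2 : (Set.range fun i => (e i, (v i, v (i + 1)))) =
        Set.range fun i => (c i, (N (i + 1), N (i + 2))) := by
      rw [← hσs.range_comp fun i => (c i, (N (i + 1), N (i + 2)))]
      congr 1; funext i
      simp only [Function.comp, hσ, ← h1, ← h2']
    have hv : ι P = 2 * ι (v 0) := by rw [h1]; exact hN _
    rw [r1] at hGU
    rw [r2] at hGD
    rcases (abs_eq two_pos.le).1 hP with h | h
    · rcases hcol with ⟨-, c1, c2⟩ | ⟨c0, -, -⟩
      · ext a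
        · rw [c1, (h2 h).1]
        · rw [c2, (h2 h).2]
        · rw [hU, hGU]
        · rw [hD, hGD]
      · rcases c0 0 with (c0 : ι (v 0) = _) | ⟨-, c0⟩ <;> omega
    · rcases hcol with ⟨c0, -, -⟩ | ⟨-, c1, c2⟩
      · rcases c0 0 with (c0 : ι (v 0) = _) | ⟨-, c0⟩ <;> omega
      · ext a
        · rw [c1, (hm2 h).1]
        · rw [c2, (hm2 h).2]
        · rw [hU, hGU]
        · rw [hD, hGD]
  · rintro rfl
    have hcor : ∀ i, (c i).IsCorner P := fun i => (hs.corner_iff _).2 ⟨i, rfl⟩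
    refine ⟨c, fun i => N (i + 1), hcor, hs.injective, ?_, fun i => ⟨?_, ?_⟩, ?_, ?_, ?_⟩
    · rintro ((h | ⟨h, -⟩) | (h | ⟨h, -⟩))
      · rw [Set.mem_ofPred_eq] at h; rw [h] at hP; norm_num at hP
      · exact hPS h
      · rw [Set.mem_ofPred_eq] at h; rw [h] at hP; norm_num at hP
      · exact hPS h
    · have hodd : ∀ j, Odd (ι (N j)) := fun j => by
        rw [hT.odd_iff, ← mul_right_inj' (two_ne_zero' ℤ), ← abs_two, ← abs_mul, ← hN, hP]
        rfl
      refine ⟨_, _, _, rfl, hodd _, hodd _, ?_, (hs.fromTo_iff _ _ _).2 ⟨rfl, ?_⟩⟩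
      · rw [show ι (N (i + 1)) = ι (N (i + 1 + 1)) by
          have := hN (i + 1); have := hN (i + 1 + 1); omega]
      · simp only [(fin_three_add i).1]
    · intro Q hQ hc
      exact hPS (hT.eq_of_isCorner hP (hS Q hQ) (hcor i) hc ▸ hQ)
    · ext a
      rw [hU]
      simp only [(fin_three_add _).2.2.1]
    · ext a
      rw [hD]
      simp only [(fin_three_add _).1]
    · rcases (abs_eq two_pos.le).1 hP with h | h
      · refine Or.inl ⟨fun i => Or.inl ?_, h2 h⟩
        have := hN (i + 1)
        simp only [Set.mem_ofPred_eq]; omega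
      · refine Or.inr ⟨fun i => Or.inl ?_, hm2 h⟩
        have := hN (i + 1)
        simp only [Set.mem_ofPred_eq]; omega

theorem IsTame.eq_dimerGraph {G : MixedGraph H.Cell H.Crossing} (h : H.YangBaxterSeq ι S G) :
    (∀ P ∈ S, |ι P| = 2) ∧ G = dimerGraph ι S := by
  induction h with
  | nil => exact ⟨by simp, hT.dimerGraph_empty.symm⟩
  | step P _ h2 hP hYB ih =>
    obtain ⟨ih, rfl⟩ := ih
    refine ⟨?_, (hT.isYangBaxterAt_iff htri ih h2 hP).1 hYB⟩
    rintro Q (rfl | hQ)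
    exacts [h2, ih Q hQ]

theorem IsTame.isDimerModel_iff {G : MixedGraph H.Cell H.Crossing} :
    H.IsDimerModel ι G ↔ G = dimerGraph ι {P | |ι P| = 2} := by
  refine ⟨fun h => (hT.eq_dimerGraph htri h).2, ?_⟩
  rintro rfl
  have := finite_cell (H := H)
  have key : ∀ S : Set H.Cell, S.Finite → (∀ P ∈ S, |ι P| = 2) →
      H.YangBaxterSeq ι S (dimerGraph ι S) := by
    intro S hS
    induction S, hS using Set.Finite.induction_on with
    | empty => intro _; rw [hT.dimerGraph_empty]; exact .nil
    | @insert P S hP _ ih =>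
      intro h
      have h' : ∀ Q ∈ S, |ι Q| = 2 := fun Q hQ => h Q (Set.mem_insert_of_mem _ hQ)
      have h2 := h P (Set.mem_insert _ _)
      exact .step P (ih h') h2 hP ((hT.isYangBaxterAt_iff htri h' h2 hP).2 rfl)
  exact key _ (Set.toFinite _) fun P h => h

theorem IsTame.isBipartite : (dimerGraph ι {P | |ι P| = 2}).IsBipartite := by
  refine ⟨?_, ?_, ?_⟩
  · rw [Set.eq_empty_iff_forall_notMem]
    rintro _ ⟨⟨c, X, Y, rfl, hX, hY, hXY, hft⟩, h⟩
    obtain ⟨x, hx⟩ := torusProj_surjective c.pt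
    rcases hT.crossing_cases (c.crosses_lift hx) with ⟨n, m, hn, hm, h1, h2⟩ | ⟨n, hn, h2⟩
    · rw [hT.odd_iff] at hX hY
      obtain ⟨n', k, k', hkk, hn', hk, hk', oX, oY⟩ := (c.isOpposite_iff hT.gen hx).1 hft.isOpposite
      have hm' := H.mem_closedCell_step (H.mem_closedCell_step hn' hk)
        (by rwa [gap_step_of_ne _ _ hkk.symm])
      have hne : n' ≠ step (step n' k) k' := fun h => by
        have := congrFun h k.1
        rw [step_of_ne _ _ hkk, step_same] at this
        rcases sg_eq k.2 with e | e <;> omega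
      rw [← oX.idx_eq (ι := ι)] at hX
      rw [← oY.idx_eq (ι := ι)] at hY
      rw [← oX.idx_eq (ι := ι), ← oY.idx_eq (ι := ι)] at hXY
      have key : ∀ {a}, x ∈ H.ClosedCell a → |H.idx ι a| = 1 → a = n' ∨ a = step (step n' k) k' := by
        intro a ha h
        by_contra! hcon
        exact hcon.2 (hT.opposite_unique hn' ha hm' hX h hY hcon.1.symm hne)
      have hXY' : H.idx ι n' = H.idx ι (step (step n' k) k') := by
        rcases (abs_eq zero_le_one).1 hX with e | e <;> rcases (abs_eq zero_le_one).1 hY with e' | e' <;>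
          rw [e, e'] at hXY ⊢ <;> exact absurd hXY (by decide)
      rcases key hn (by rw [h1]; rfl) with rfl | rfl <;> rcases key hm (by rw [h2]; rfl) with rfl | rfl <;>
        omega
    · obtain ⟨P, hP⟩ := exists_cell_over (hT.isCellVec hn)
      refine h P ?_ ((c.isCorner_iff hT.gen hx).2 ⟨n, hP, hn⟩)
      rw [Set.mem_ofPred_eq, ← hP.idx_eq (ι := ι), h2]
  · rw [Set.disjoint_left]
    rintro P ((h : ι P = 1) | ⟨-, h⟩) ((h' : ι P = -1) | ⟨-, h'⟩) <;> omega
  · rintro _ (⟨c, X, Y, rfl, h⟩ | ⟨c, P, Q, rfl, h2, h⟩)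
    · obtain ⟨h1, h2, -⟩ := hT.isOpposite_of_pointEdge h
      exact ⟨Y, Or.inl h2, X, Or.inl h1, Sym2.eq_swap⟩
    · obtain ⟨c', N, hs⟩ := hT.exists_isStar htri h2
      obtain ⟨i, rfl, rfl⟩ := (hs.starEdge_iff _ _).1 h
      have hN := hs.index i
      rcases (abs_eq two_pos.le).1 h2 with h | h
      · exact ⟨N i, Or.inl (by simp only [Set.mem_ofPred_eq]; omega), P, Or.inr ⟨h2, h⟩,
          Sym2.eq_swap⟩
      · exact ⟨P, Or.inr ⟨h2, h⟩, N i, Or.inl (by simp only [Set.mem_ofPred_eq]; omega), rfl⟩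

end
end Arrangement

namespace Arrangement

variable {I : Type*} {H : Arrangement I} [Finite I] {ι : H.Cell → ℤ}

/-! ### The embedding of the dimer model -/

/-- An embedding that places vertices and edges at the images of the centers of mass of cells and of
the curves of edges in the plane. -/
structure IsStandard (ι : H.Cell → ℤ) {G : MixedGraph H.Cell H.Crossing} (Φ : G.TorusEmbedding) :
    Prop where
  pos_eq : ∀ {n P}, H.Over n P → Φ.pos P = torusProj (H.ctr n)
  curve_eq : ∀ {c x n m w}, torusProj x = c.pt → H.IsEdge ι x n m w →
    ∀ s, Φ.curve c s = torusProj (H.edgePath n m w s)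

theorem mem_U_of_isEdge {c : H.Crossing} {x w : ℝ × ℝ} {n m : I → ℤ} {X Y : H.Cell}
    (hx : torusProj x = c.pt) (h : H.IsEdge ι x n m w) (hX : H.Over n X) (hY : H.Over m Y) :
    (c, s(X, Y)) ∈ (dimerGraph ι {P | |ι P| = 2}).U := by
  cases h with
  | point h1 h2 h3 h4 => exact Or.inl ⟨_, _, _, rfl, x, n, m, hx, h1, h2, h3, h4, hX, hY⟩
  | star h1 h2 h3 h4 h5 =>
    exact Or.inr ⟨_, _, _, rfl, by rw [Set.mem_ofPred_eq, ← hX.idx_eq (ι := ι), h3], x, n, _, hx,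
      h2, h3, h4, h5, hX, hY⟩

theorem exists_isEdge_of_mem_U {c : H.Crossing} {a : Sym2 H.Cell}
    (h : (c, a) ∈ (dimerGraph ι {P | |ι P| = 2}).U) : ∃ x n m w X Y, torusProj x = c.pt ∧
      H.IsEdge ι x n m w ∧ H.Over n X ∧ H.Over m Y ∧ a = s(X, Y) := by
  rcases h with ⟨_, X, Y, he, x, n, m, hx, h1, h2, h3, h4, hX, hY⟩ |
    ⟨_, X, Y, he, -, x, n, k, hx, h2, h3, h4, h5, hX, hY⟩ <;>
    obtain ⟨rfl, rfl⟩ := Prod.mk.inj he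
  · exact ⟨x, n, m, x, X, Y, hx, .point h1 h2 h3 h4, hX, hY, rfl⟩
  · exact ⟨x, n, _, _, X, Y, hx, .star (Crossing.crosses_lift _ hx) h2 h3 h4 h5, hX, hY, rfl⟩

theorem IsTame.mem_verts_iff (hT : H.IsTame ι) {P : H.Cell} :
    P ∈ (dimerGraph ι {P | |ι P| = 2}).verts ↔ ι P ≠ 0 := by
  simp only [MixedGraph.verts, dimerGraph, Set.mem_union, Set.mem_ofPred_eq]
  rcases hT.cases P with h | h | h | h | h <;> simp [h]

section
variable (hT : H.IsTame ι) (htri : ∀ P, |ι P| = 2 → H.IsTriangle P)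
include hT htri

theorem IsTame.exists_isStandard :
    ∃ Φ : (dimerGraph ι {P | |ι P| = 2}).TorusEmbedding, IsStandard ι Φ := by
  have hG := hT.gen
  choose σ hσ using fun P : H.Cell => exists_over P
  choose ξ hξ using fun c : H.Crossing => torusProj_surjective c.pt
  choose a b w hE using fun c : H.Crossing => hT.exists_isEdge htri (c.crosses_lift (hξ c))
  have hpos : ∀ {n P}, H.Over n P → torusProj (H.ctr (σ P)) = torusProj (H.ctr n) := by
    intro n P h
    obtain ⟨d, rfl⟩ := (hσ P).exists_deck h
    rw [ctr_add_deck hG (hσ P).1, torusProj_add_deckVec]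
  let γ : H.Crossing → C(unitInterval, Torus) := fun c =>
    ⟨fun s => torusProj (H.edgePath (a c) (b c) (w c) s),
      continuous_torusProj.comp ((continuous_edgePath _ _ _).comp continuous_subtype_val)⟩
  have hcurve : ∀ {c x n m w'}, torusProj x = c.pt → H.IsEdge ι x n m w' →
      ∀ s, γ c s = torusProj (H.edgePath n m w' s) := by
    intro c x n m w' hx h s
    obtain ⟨d, rfl⟩ := torusProj_eq_iff.1 ((hξ c).trans hx.symm)
    obtain ⟨rfl, rfl, rfl⟩ := hT.isEdge_unique htri h ((hE c).add_deck hG d)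
    obtain ⟨h1, h2, -⟩ := (hE c).spec hT
    rw [edgePath_add_deck hG h1 h2, torusProj_add_deckVec]
    rfl
  have meet : ∀ {c c' : H.Crossing} {s t : unitInterval}, s ∈ Set.Ioo 0 1 → γ c s = γ c' t →
      c = c' ∧ s = t := by
    intro c c' s t hs h
    obtain ⟨d, hd⟩ := torusProj_eq_iff.1 h
    obtain ⟨h1, h2, -⟩ := (hE c).spec hT
    rw [← edgePath_add_deck hG h1 h2] at hd
    obtain ⟨hx, hst⟩ := hT.edgePath_injective htri ((hE c).add_deck hG d) (hE c') hs t.2 hd.symm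
    refine ⟨Crossing.eq_of_pt_eq hG ?_, Subtype.ext hst⟩
    rw [← hξ c, ← hξ c', ← hx, torusProj_add_deckVec]
  refine ⟨⟨fun P => torusProj (H.ctr (σ P)), γ, ?_, ?_, ?_, ?_, ?_, ?_⟩, hpos, hcurve⟩
  · intro P _ Q _ h
    obtain ⟨d, hd⟩ := torusProj_eq_iff.1 h
    rw [← ctr_add_deck hG (hσ P).1] at hd
    have h1 := ctr_mem hG ((hσ P).1.add_deck d)
    rw [← hd] at h1
    have := eq_of_mem_openCell h1 (H.openCell_subset_closedCell _ (ctr_mem hG (hσ Q).1))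
    have h2 := (hσ P).add_deck d
    rw [this] at h2
    exact h2.eq (hσ Q)
  · intro c P Q h
    obtain ⟨x, n, m, w', X, Y, hx, h1, hX, hY, he⟩ := exists_isEdge_of_mem_U h
    have h0 : γ c 0 = torusProj (H.ctr (σ X)) := by
      rw [hcurve hx h1, hpos hX]; simp [edgePath_zero]
    have h1 : γ c 1 = torusProj (H.ctr (σ Y)) := by
      rw [hcurve hx h1, hpos hY]; simp [edgePath_one]
    rcases Sym2.eq_iff.1 he with ⟨rfl, rfl⟩ | ⟨rfl, rfl⟩
    · exact Or.inl ⟨h0, h1⟩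
    · exact Or.inr ⟨h0, h1⟩
  · intro e x y h
    rw [(hT.isBipartite htri).1] at h
    exact h.elim
  · intro c _ s t hs h
    exact (meet hs h).2
  · intro c _ P _ s hs h
    obtain ⟨d, hd⟩ := torusProj_eq_iff.1 h
    obtain ⟨h1, h2, -⟩ := (hE c).spec hT
    rw [← edgePath_add_deck hG h1 h2] at hd
    exact hT.edgePath_ne_ctr ((hE c).add_deck hG d) (hσ P).1 hs hd.symm
  · intro c _ c' _ hne s t hs h
    exact hne (meet hs h).1

variable {Φ : (dimerGraph ι {P | |ι P| = 2}).TorusEmbedding} (hΦ : IsStandard ι Φ)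
include hΦ

omit hT htri in
theorem IsStandard.range_curve {c : H.Crossing} {x w : ℝ × ℝ} {n m : I → ℤ}
    (hx : torusProj x = c.pt) (h : H.IsEdge ι x n m w) :
    Set.range (Φ.curve c) = torusProj '' (segment ℝ (H.ctr n) w ∪ segment ℝ w (H.ctr m)) := by
  rw [← image_edgePath, Set.image_image]
  ext z
  constructor
  · rintro ⟨s, rfl⟩
    exact ⟨s, s.2, (hΦ.curve_eq hx h s).symm⟩
  · rintro ⟨s, hs, rfl⟩
    exact ⟨⟨s, hs⟩, hΦ.curve_eq hx h ⟨s, hs⟩⟩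

theorem IsStandard.carrier_eq : Φ.carrier = torusProj '' H.planeGraph ι := by
  ext z
  constructor
  · rintro (⟨P, hP, rfl⟩ | hz)
    · obtain ⟨n, hn⟩ := exists_over P
      rw [hT.mem_verts_iff, ← hn.idx_eq (ι := ι)] at hP
      exact ⟨_, Or.inl ⟨n, hP, rfl⟩, (hΦ.pos_eq hn).symm⟩
    · obtain ⟨c, hc, hz⟩ := Set.mem_iUnion₂.1 hz
      obtain ⟨x, hx⟩ := torusProj_surjective c.pt
      obtain ⟨n, m, w, h⟩ := hT.exists_isEdge htri (c.crosses_lift hx)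
      rw [hΦ.range_curve hx h] at hz
      obtain ⟨y, hy, rfl⟩ := hz
      exact ⟨y, Or.inr ⟨x, n, m, w, h, hy⟩, rfl⟩
  · rintro ⟨y, ⟨n, hn, rfl⟩ | ⟨x, n, m, w, h, hy⟩, rfl⟩
    · obtain ⟨P, hP⟩ := exists_cell_over (isCellVec_of_idx_ne_zero hn)
      refine Or.inl ⟨P, hT.mem_verts_iff.2 ?_, hΦ.pos_eq hP⟩
      rwa [← hP.idx_eq (ι := ι)]
    · obtain ⟨h1, h2, -, -, -, -, hc⟩ := h.spec hT
      obtain ⟨c, hc⟩ := hc.exists_crossing hT.gen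
      obtain ⟨X, hX⟩ := exists_cell_over h1
      obtain ⟨Y, hY⟩ := exists_cell_over h2
      refine Or.inr (Set.mem_iUnion₂.2 ⟨c, Or.inl ⟨_, mem_U_of_isEdge hc h hX hY, rfl⟩, ?_⟩)
      rw [hΦ.range_curve hc h]
      exact ⟨y, hy, rfl⟩

theorem IsStandard.isCenterOfMassEmbedding : H.IsCenterOfMassEmbedding ι Φ := by
  have hG := hT.gen
  have lift : ∀ {x u : ℝ × ℝ} {P : H.Cell}, (∀ i, H.On i x → H.slope i u ≠ 0) →
      H.IsLiftOf (H.liftSector x u) P → H.Over (H.secVec x u) P := by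
    intro x u P hu h
    obtain ⟨n, hn, he⟩ := isLiftOf_iff.1 h
    rw [liftSector_eq hu] at he
    rwa [← openCell_injective hn.1 he.symm]
  constructor
  · intro P _ R hR
    obtain ⟨n, hn, rfl⟩ := isLiftOf_iff.1 hR
    exact hΦ.pos_eq hn
  · intro c P Q hU hP hQ x hx u hu hlP hlQ
    rw [c.isTransverse_iff hG hx] at hu
    have hu' : ∀ i, H.On i x → H.slope i (-u) ≠ 0 := fun i hi => by
      rw [slope_neg]; exact neg_ne_zero.2 (hu i hi)
    have oP := lift hu hlP
    have oQ := lift hu' hlQ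
    have mP := H.mem_closedCell_secVec x u
    have mQ := H.mem_closedCell_secVec x (-u)
    rw [liftSector_eq hu, liftSector_eq hu']
    rcases hU with ⟨_, X, Y, he, h⟩ | ⟨_, X, Y, he, h2, -⟩ <;> obtain ⟨rfl, he'⟩ := Prod.mk.inj he
    · obtain ⟨hX, hY, -⟩ := hT.isOpposite_of_pointEdge h
      rcases Sym2.eq_iff.1 he' with ⟨rfl, rfl⟩ | ⟨rfl, rfl⟩
      · exact hΦ.range_curve hx (.point mP mQ (by rw [oP.idx_eq, hX]) (by rw [oQ.idx_eq, hY]))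
      · rw [hΦ.range_curve hx (.point mQ mP (by rw [oQ.idx_eq, hX]) (by rw [oP.idx_eq, hY])),
          Set.union_comm, segment_symm, segment_symm ℝ (H.ctr (H.secVec x (-u)))]
        rfl
    · rcases Sym2.eq_iff.1 he' with ⟨rfl, rfl⟩ | ⟨rfl, rfl⟩
      · exact absurd h2 hP
      · exact absurd h2 hQ
  · intro c P Q hU hP x hx R S hR hS hxR hxS ⟨y, ⟨hyR, hyS⟩, _⟩
    obtain ⟨n, hn, rfl⟩ := isLiftOf_iff.1 hR
    obtain ⟨m, hm, rfl⟩ := isLiftOf_iff.1 hS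
    rw [closure_openCell hn.1] at hxR hyR
    rw [closure_openCell hm.1] at hxS hyS
    have h2 : |H.idx ι n| = 2 := by rw [hn.idx_eq, hP]
    have h1 : |H.idx ι m| = 1 := by
      rw [hm.idx_eq]
      rcases hU with ⟨_, X, Y, he, h⟩ | ⟨_, X, Y, he, h2, h⟩ <;>
        obtain ⟨rfl, he'⟩ := Prod.mk.inj he
      · obtain ⟨hX, hY, -⟩ := hT.isOpposite_of_pointEdge h
        rcases Sym2.eq_iff.1 he' with ⟨rfl, rfl⟩ | ⟨rfl, rfl⟩
        · rw [hY]; rfl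
        · rw [hX]; rfl
      · obtain ⟨_, N, hs⟩ := hT.exists_isStar htri h2
        obtain ⟨i, -, rfl⟩ := (hs.starEdge_iff _ _).1 h
        have hN := hs.index i
        rw [Set.mem_ofPred_eq, hN, abs_mul, abs_two] at h2
        rcases Sym2.eq_iff.1 he' with ⟨rfl, rfl⟩ | ⟨rfl, rfl⟩ <;> omega
    obtain ⟨k, rfl, hk⟩ := hT.adjacent_of_one_two hyS hyR h1 h2
    have hmv := hm.1
    rw [← step_step_rev m k] at hmv
    have hne : H.gap (step m k) (rev k) x ≠ 0 := by
      intro h0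
      have := H.mem_closedCell_step hxR h0
      rw [step_step_rev] at this
      exact hxS this
    have hE := IsEdge.star (c.crosses_lift hx) hxR h2 hmv hne
    have hgm := gate_mem_segment hG hn.1 hmv
    rw [hΦ.range_curve hx hE]
    rw [step_step_rev] at hgm ⊢
    congr 1
    exact Set.Subset.antisymm (Set.union_subset
      ((convex_segment _ _).segment_subset (left_mem_segment ℝ _ _) hgm)
      ((convex_segment _ _).segment_subset hgm (right_mem_segment ℝ _ _)))
      (segment_subset_union hgm)

end

theorem preimage_combCoamoeba (hG : H.IsGeneric) :
    torusProj ⁻¹' H.combCoamoeba ι = H.planeCoamoeba ι := by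
  have hcl : ∀ {n P}, H.Over n P → closure P.1 = torusProj '' H.ClosedCell n := by
    intro n P h
    rw [h.2]
    refine Set.Subset.antisymm (closure_minimal (Set.image_mono (H.openCell_subset_closedCell n))
      ((isCompact_closedCell hG n).image continuous_torusProj).isClosed) ?_
    rw [← closure_openCell h.1]
    exact image_closure_subset_closure_image continuous_torusProj
  ext x
  simp only [Set.mem_preimage, combCoamoeba, Set.mem_iUnion, Subtype.exists, abs_pos]
  constructor
  · rintro ⟨P, hP, hx⟩
    obtain ⟨n, hn⟩ := exists_over P
    rw [hcl hn] at hx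
    obtain ⟨y, hy, hyx⟩ := hx
    obtain ⟨d, rfl⟩ := torusProj_eq_iff.1 hyx
    refine ⟨n + H.deck d, ?_, H.mem_closedCell_add_deckVec.2 hy⟩
    rwa [idx_add_deck, hn.idx_eq]
  · rintro ⟨n, hn, hx⟩
    obtain ⟨P, hP⟩ := exists_cell_over (isCellVec_of_idx_ne_zero hn)
    refine ⟨P, ?_, ?_⟩
    · rwa [← hP.idx_eq (ι := ι)]
    · rw [hcl hP]; exact ⟨x, hx, rfl⟩

end Arrangement

/-! ### Facets at a vertex of a lattice polygon -/

theorem exists_extreme_ray {A : Finset (ℤ × ℤ)} {v : ℤ × ℤ} {M : ℤ} (hne : ∃ α ∈ A, α ≠ v)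
    (hM : ∀ α ∈ A, α ≠ v → 0 < M * (α - v).1 + (α - v).2) (ε : ℤ) :
    ∃ w ∈ A, w ≠ v ∧ ∀ α ∈ A, 0 ≤ ε * intCross (w - v) (α - v) ∧
      (intCross (w - v) (α - v) = 0 →
        0 ≤ (α - v).1 * (w - v).1 + (α - v).2 * (w - v).2 ∧
        0 ≤ (α - w).1 * (v - w).1 + (α - w).2 * (v - w).2) := by
  classical
  let f : ℤ × ℤ → ℤ := fun α => M * (α - v).1 + (α - v).2
  obtain ⟨w, hw, hmax⟩ := Finset.exists_max_image (A.filter (· ≠ v))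
    (fun α => toLex (((ε * (α - v).1 : ℤ) : ℚ) / f α, f α))
    (by obtain ⟨α, h1, h2⟩ := hne; exact ⟨α, Finset.mem_filter.2 ⟨h1, h2⟩⟩)
  obtain ⟨hwA, hwv⟩ := Finset.mem_filter.1 hw
  have hfw : 0 < f w := hM w hwA hwv
  refine ⟨w, hwA, hwv, fun α hα => ?_⟩
  by_cases hαv : α = v
  · subst hαv
    simp only [intCross, sub_self, Prod.fst_zero, Prod.snd_zero, Prod.fst_sub, Prod.snd_sub]
    refine ⟨by simp, fun _ => ⟨by simp, ?_⟩⟩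
    nlinarith [sq_nonneg (α.1 - w.1), sq_nonneg (α.2 - w.2)]
  have hfα : 0 < f α := hM α hα hαv
  have h := hmax α (Finset.mem_filter.2 ⟨hα, hαv⟩)
  rw [Prod.Lex.toLex_le_toLex] at h
  have hcross : intCross (w - v) (α - v) = (w - v).1 * f α - (α - v).1 * f w := by
    simp only [intCross, f]; ring
  have hlt : ε * (α - v).1 * f w ≤ ε * (w - v).1 * f α ∧
      (ε * (α - v).1 * f w = ε * (w - v).1 * f α → f α ≤ f w) := by
    have q1 : (0 : ℚ) < f w := by exact_mod_cast hfw
    have q2 : (0 : ℚ) < f α := by exact_mod_cast hfα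
    simp only [div_lt_div_iff₀ q2 q1, div_eq_div_iff q2.ne' q1.ne'] at h
    rcases h with h | ⟨h, h'⟩
    · have : ε * (α - v).1 * f w < ε * (w - v).1 * f α := by exact_mod_cast h
      exact ⟨this.le, fun e => absurd e this.ne⟩
    · have : ε * (α - v).1 * f w = ε * (w - v).1 * f α := by exact_mod_cast h
      exact ⟨this.le, fun _ => h'⟩
  refine ⟨by rw [hcross]; linarith [hlt.1], fun h0 => ?_⟩
  rw [hcross] at h0
  have hle := hlt.2 (by linear_combination -ε * h0)
  have e1 : f w * (α - v).1 = f α * (w - v).1 := by linear_combination -h0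
  have e2 : f w * (α - v).2 = f α * (w - v).2 := by
    simp only [f] at h0 ⊢; linear_combination M * h0
  set p := w - v with hp
  set r := α - v with hr
  have hαw : α - w = r - p := by rw [hp, hr]; abel
  have hvw : v - w = -p := by rw [hp]; abel
  rw [hαw, hvw]
  simp only [Prod.fst_sub, Prod.snd_sub, Prod.fst_neg, Prod.snd_neg]
  generalize f w = a at *
  generalize f α = b at *
  have s1 : 0 ≤ p.1 ^ 2 + p.2 ^ 2 := by positivity
  constructor
  · refine nonneg_of_mul_nonneg_right (?_ : 0 ≤ a * _) hfw
    rw [show a * (r.1 * p.1 + r.2 * p.2) = b * (p.1 ^ 2 + p.2 ^ 2) by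
      linear_combination p.1 * e1 + p.2 * e2]
    positivity
  · refine nonneg_of_mul_nonneg_right (?_ : 0 ≤ a * _) hfw
    rw [show a * ((r.1 - p.1) * -p.1 + (r.2 - p.2) * -p.2) = (a - b) * (p.1 ^ 2 + p.2 ^ 2) by
      linear_combination -p.1 * e1 - p.2 * e2]
    exact mul_nonneg (by linarith) s1

theorem SpansPolygon.exists_facets {A : Finset (ℤ × ℤ)} (hA : SpansPolygon A) :
    ∃ u v w, IsFacet A v w ∧ IsFacet A u v ∧ intCross (w - v) (v - u) ≠ 0 := by
  obtain ⟨α, hα, β, hβ, δ, hδ, hne⟩ := hA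
  obtain ⟨v, hv, hmin⟩ := Finset.exists_min_image A toLex ⟨α, hα⟩
  have hM : ∀ α ∈ A, α ≠ v → 0 < (1 + ∑ α ∈ A, |(α - v).2|) * (α - v).1 + (α - v).2 := by
    intro α hα hαv
    have h1 : |(α - v).2| ≤ ∑ α ∈ A, |(α - v).2| :=
      Finset.single_le_sum (f := fun α : ℤ × ℤ => |(α - v).2|) (fun _ _ => abs_nonneg _) hα
    have h2 := neg_abs_le (α - v).2
    have h3 := hmin α hα
    rw [Prod.Lex.toLex_le_toLex] at h3
    rcases h3 with h3 | ⟨h3, h4⟩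
    · have : 1 ≤ (α - v).1 := by rw [Prod.fst_sub]; omega
      nlinarith [abs_nonneg (α - v).2]
    · have h5 : v.2 ≠ α.2 := fun h => hαv (Prod.ext h3.symm h.symm)
      rw [Prod.fst_sub, Prod.snd_sub, h3, sub_self, mul_zero, zero_add]
      omega
  have hne' : ∃ α ∈ A, α ≠ v := by
    by_contra! hcon
    rw [hcon α hα, hcon β hβ, hcon δ hδ] at hne
    simp [intCross] at hne
  obtain ⟨w, hw, hwv, hw'⟩ := exists_extreme_ray hne' hM 1
  obtain ⟨u, hu, huv, hu'⟩ := exists_extreme_ray hne' hM (-1)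
  refine ⟨u, v, w, ⟨hv, hw, hwv.symm, fun α hα => ⟨?_, (hw' α hα).2⟩⟩,
    ⟨hu, hv, huv, fun α hα => ?_⟩, fun h0 => hne ?_⟩
  · linarith [(hw' α hα).1]
  · have e : intCross (v - u) (α - u) = -intCross (u - v) (α - v) := by
      simp only [intCross, Prod.fst_sub, Prod.snd_sub]; ring
    rw [e]
    obtain ⟨h1, h2⟩ := hu' α hα
    exact ⟨by linarith, fun h => (h2 (by linarith)).symm⟩
  · have hp : 0 < (w - v).1 ^ 2 + (w - v).2 ^ 2 := by
      rcases not_and_or.1 (fun h : (w - v).1 = 0 ∧ (w - v).2 = 0 =>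
        hwv (sub_eq_zero.1 (Prod.ext h.1 h.2))) with h | h <;> positivity
    have hq : 0 < (u - v).1 ^ 2 + (u - v).2 ^ 2 := by
      rcases not_and_or.1 (fun h : (u - v).1 = 0 ∧ (u - v).2 = 0 =>
        huv (sub_eq_zero.1 (Prod.ext h.1 h.2))) with h | h <;> positivity
    have hpq : intCross (w - v) (u - v) = 0 := by
      simp only [intCross, Prod.fst_sub, Prod.snd_sub] at h0 ⊢; linarith
    have hd := ((hw' u hu).2 hpq).1
    set p := w - v
    set q := u - v
    simp only [intCross] at hpq
    have hd' : 0 < q.1 * p.1 + q.2 * p.2 := by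
      refine hd.lt_of_ne fun h => ?_
      have : (p.1 ^ 2 + p.2 ^ 2) * (q.1 ^ 2 + q.2 ^ 2) = 0 := by
        linear_combination (p.1 * q.2 - p.2 * q.1) * hpq - (q.1 * p.1 + q.2 * p.2) * h
      exact (mul_pos hp hq).ne' this
    have hcol : ∀ α ∈ A, intCross p (α - v) = 0 := by
      intro α hα
      have h1 := (hw' α hα).1
      have h2 := (hu' α hα).1
      have e : (p.1 ^ 2 + p.2 ^ 2) * intCross q (α - v) =
          (q.1 * p.1 + q.2 * p.2) * intCross p (α - v) := by
        simp only [intCross]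
        linear_combination -(p.1 * (α - v).1 + p.2 * (α - v).2) * hpq
      have h3 : (p.1 ^ 2 + p.2 ^ 2) * intCross q (α - v) ≤ 0 :=
        mul_nonpos_of_nonneg_of_nonpos hp.le (by linarith)
      nlinarith
    have c1 := hcol α hα
    have c2 := hcol β hβ
    have c3 := hcol δ hδ
    have hsq : (p.1 ^ 2 + p.2 ^ 2) * intCross (β - α) (δ - α) = 0 := by
      clear_value p
      simp only [intCross, Prod.fst_sub, Prod.snd_sub] at c1 c2 c3 ⊢
      linear_combination (p.1 * (β.1 - α.1) + p.2 * (β.2 - α.2)) * (c3 - c1) -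
        (p.1 * (δ.1 - α.1) + p.2 * (δ.2 - α.2)) * (c2 - c1)
    exact (mul_eq_zero.1 hsq).resolve_left hp.ne'

namespace Arrangement

theorem IsDual.exists_cross_ne_zero {I : Type*} [Fintype I] {H : Arrangement I}
    {A : Finset (ℤ × ℤ)} (h : H.IsDual A) (hA : SpansPolygon A) :
    ∃ i j, cross (H i).tangent (H j).tangent ≠ 0 := by
  classical
  have key : ∀ v w, IsFacet A v w → ∃ i, (H i).IsParallel (rotCW (w - v)) := by
    intro v w hvw
    by_contra! hcon
    have := h.2 v w hvw
    rw [Finset.filter_false_of_mem (fun i _ => hcon i), Finset.sum_empty] at this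
    refine hvw.2.2.1 (sub_eq_zero.1 ?_).symm
    simp only [rotCW, Prod.zero_eq_mk, Prod.mk.injEq] at this
    exact Prod.ext (neg_eq_zero.1 this.2.symm) this.1.symm
  obtain ⟨u, v, w, h1, h2, hne⟩ := hA.exists_facets
  obtain ⟨i, k, -, hi⟩ := key v w h1
  obtain ⟨j, l, -, hj⟩ := key u v h2
  refine ⟨i, j, fun h0 => hne ?_⟩
  have h0 : intCross (H i).dir (H j).dir = 0 := by
    simp only [cross, TorusLine.tangent] at h0
    simp only [intCross]
    exact_mod_cast h0
  have : intCross (rotCW (w - v)) (rotCW (v - u)) = k * l * intCross (H i).dir (H j).dir := by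
    rw [hi, hj]; simp only [intCross, Prod.smul_fst, Prod.smul_snd, smul_eq_mul]; ring
  rw [h0, mul_zero] at this
  rw [← this]; simp only [intCross, rotCW]; ring

end Arrangement

theorem mainTheorem5 {I : Type*} [Fintype I] (A : Finset (ℤ × ℤ)) (hA : SpansPolygon A)
    (H : Arrangement I) (hdual : H.IsDual A) (hsimple : H.IsSimple)
    (ι : H.Cell → ℤ) (hι : H.IsIndexMap ι)
    (hle : ∀ P, |ι P| ≤ 2) (htri : ∀ P, |ι P| = 2 → H.IsTriangle P) :
    (∃ G, H.IsDimerModel ι G) ∧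
    ∀ G, H.IsDimerModel ι G →
      G.IsBipartite ∧
      ∃ Φ : G.TorusEmbedding, H.IsCenterOfMassEmbedding ι Φ ∧
        IsStrongDeformationRetract Φ.carrier (H.combCoamoeba ι) := by
  have hT : H.IsTame ι := ⟨⟨hsimple, hdual.exists_cross_ne_zero hA⟩, hι, hle⟩
  refine ⟨⟨_, (hT.isDimerModel_iff htri).2 rfl⟩, fun G hG => ?_⟩
  obtain rfl := (hT.isDimerModel_iff htri).1 hG
  obtain ⟨Φ, hΦ⟩ := hT.exists_isStandard htri
  refine ⟨hT.isBipartite htri, Φ, hΦ.isCenterOfMassEmbedding hT htri, ?_⟩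
  rw [hΦ.carrier_eq hT htri]
  exact hT.isStrongDeformationRetract htri (Arrangement.preimage_combCoamoeba hT.gen)
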